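/- **Setting.** Manifolds, Lie groups and bundles are modelled on Fréchet spaces (this includes Hilbert spaces), with the usual (Michal–Bastiani/Hamilton) notion of smooth map. Let $B$ be a smooth Fréchet manifold, $G$ a Fréchet Lie group with Lie algebra $\mathfrak g$, $\mathcal A$ a unital associative complex algebra which is a Fréchet space with continuous multiplication and acts continuously on a complex Fréchet space $V$, and let $\rho:G\to\mathcal A^\times\subset \mathcal A$ be a smooth homomorphism, so that $G$ acts on $V$ through $\rho$. (The basic case is that $G=\mathcal A^\times$ and $\mathcal A=\mathfrak g$.) Let $E\to B$ be a vector bundle with fiber $V$ and structure group $G$, i.e. with trivializations over an open cover $(U_i)$ and smooth transition functions $g_{ij}:U_i\cap U_j\to G$ satisfying the cocycle condition, and let $P=P^E$ be the associated principal $G$-bundle. Let ${\rm Ad}\,P=P\times_G\mathcal A$, where $g\in G$ acts by $a\mapsto \rho(g)a\rho(g)^{-1}$. A connection $\nabla$ on $E$ (equivalently on $P$) is given by smooth $\mathfrak g$-valued one-forms $\theta_i$ on $U_i$ with $\theta_j={\rm Ad}_{g_{ij}^{-1}}\theta_i+g_{ij}^{-1}dg_{ij}$; locally $\nabla=d+D\rho(\theta_i)$.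 Its curvature $\Omega=\nabla^2$ is the ${\rm Ad}\,P$-valued two-form given locally by $d\vartheta_i+\vartheta_i\wedge\vartheta_i$, $\vartheta_i=D\rho(\theta_i)$, and $\nabla$ induces the connection $\nabla^{\rm ad}=d+[\vartheta_i,\cdot\,]$ on ${\rm Ad}\,P$. For an analytic function $f:\mathbb C\to\mathbb C$, $f(\Omega)$ is the ${\rm Ad}\,P$-valued form whose component of degree $2k$ is $\frac{f^{(k)}(0)}{k!}\,\Omega^k$, $k=0,1,2,\dots$ **Proposition.** Let $\lambda:{\rm Ad}\,P\to B\times\mathbb C$ be a smooth bundle morphism that is (real-)linear on the fibers, and let $f:\mathbb C\to\mathbb C$ be analytic. 1. If $\nabla$ is a connection with $d\circ\lambda=\lambda\circ\nabla^{\rm ad}$ on local sections of ${\rm Ad}\,P$, then for every $k$ the component of degree $2k$ of $\lambda(f(\Omega))$ is a well defined (independent of the local trivializations) smooth closed $2k$-form on $B$. 2. The de Rham cohomology class of $\lambda(f(\Omega))$ in $H^*(B;\mathbb C)$ is independent of the choice of $\nabla$: if $\nabla$ and $\nabla'$ are two connections with $d\circ\lambda=\lambda\circ\nabla^{\rm ad}$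 and $d\circ\lambda=\lambda\circ\nabla'^{\,\rm ad}$, and $\Omega,\Omega'$ are their curvatures, then for every $k$ the components of degree $2k$ of $\lambda(f(\Omega))$ and $\lambda(f(\Omega'))$ differ by the exterior derivative of a smooth $(2k-1)$-form (they are equal for $k=0$). 3. If $\lambda$ is induced by a continuous linear form $\lambda:\mathcal A\to\mathbb C$ that is ${\rm Ad}$-invariant, i.e. $\lambda(\rho(g)a\rho(g)^{-1})=\lambda(a)$ for all $g\in G$, $a\in\mathcal A$, then $d\circ\lambda=\lambda\circ\nabla^{\rm ad}$ holds for every connection $\nabla$; so in this case 1 and 2 hold for all connections. -/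

import Mathlib

noncomputable section

namespace FrechetCW

open Set Filter
open scoped Topology Nat

universe u v

/-! ## Frechet spaces and smooth maps between them -/

/-- A real Frechet space: a complete metrizable locally convex topological vector space.
Hilbert and Banach spaces are Frechet spaces. -/
class FrechetSpace (E : Type*) [AddCommGroup E] [Module ℝ E] [TopologicalSpace E] : Prop
    extends IsTopologicalAddGroup E, ContinuousSMul ℝ E, LocallyConvexSpace ℝ E,
      TopologicalSpace.MetrizableSpace E where
  complete : @CompleteSpace E (IsTopologicalAddGroup.rightUniformSpace E)

instance instFrechetSpaceOfBanach (E : Type*) [NormedAddCommGroup E] [NormedSpace ℝ E]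
    [h : CompleteSpace E] : FrechetSpace E where
  complete := by
    rw [IsUniformAddGroup.rightUniformSpace_eq]
    exact h

section Calculus

variable {E : Type u} [AddCommGroup E] [Module ℝ E] [TopologicalSpace E]
  {F : Type v} [AddCommGroup F] [Module ℝ F] [TopologicalSpace F]

/-- `w` is the directional derivative of `f` at `x` in the direction `v`. -/
def HasDirDeriv (f : E → F) (x v : E) (w : F) : Prop :=
  Tendsto (fun t : ℝ => t⁻¹ • (f (x + t • v) - f x)) (𝓝[≠] 0) (𝓝 w)

/-- The directional derivative `Df(x) v` (only meaningful where the limit exists). -/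
def dirDeriv (f : E → F) (x v : E) : F :=
  limUnder (𝓝[≠] (0 : ℝ)) (fun t : ℝ => t⁻¹ • (f (x + t • v) - f x))

/-- Maps of class `C^n` on an open set, in the sense of Michal-Bastiani and Hamilton (the usual
calculus on Frechet spaces): `f` is `C^(n+1)` if it is continuous, all its directional derivatives
exist, and `(x, v) ↦ Df(x) v` is `C^n`. -/
def CkOn {F : Type v} [AddCommGroup F] [Module ℝ F] [TopologicalSpace F] :
    ℕ → {E : Type u} → [AddCommGroup E] → [Module ℝ E] → [TopologicalSpace E] →
      (E → F) → Set E → Prop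
  | 0, _, _, _, _, f, U => ContinuousOn f U
  | n + 1, E, _, _, _, f, U => ContinuousOn f U ∧ ∃ f' : E × E → F,
      (∀ x ∈ U, ∀ v, HasDirDeriv f x v (f' (x, v))) ∧ CkOn n f' (U ×ˢ univ)

/-- Smooth maps on an open subset of a Frechet space. On Banach and Hilbert spaces these are the
usual `C^∞` maps. -/
def SmoothOn (f : E → F) (U : Set E) : Prop := ∀ n : ℕ, CkOn n f U

theorem hasDirDeriv_continuousLinearMap (L : E →L[ℝ] F) (x v : E) : HasDirDeriv L x v (L v) := by
  refine Tendsto.congr' ?_ tendsto_const_nhds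
  filter_upwards [self_mem_nhdsWithin] with t ht
  have ht' : t ≠ 0 := ht
  simp [smul_smul, ht']

theorem ckOn_continuousLinearMap (n : ℕ) {E : Type u} [AddCommGroup E] [Module ℝ E]
    [TopologicalSpace E] (L : E →L[ℝ] F) (U : Set E) : CkOn n L U := by
  induction n generalizing E with
  | zero => exact L.continuous.continuousOn
  | succ n ih =>
    exact ⟨L.continuous.continuousOn, L.comp (ContinuousLinearMap.snd ℝ E E),
      fun x _ v => hasDirDeriv_continuousLinearMap L x v, ih _ _⟩

end Calculus

/-! ## Manifolds modelled on Frechet spaces, differential forms -/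

section Manifolds

variable (H : Type*) [AddCommGroup H] [Module ℝ H] [TopologicalSpace H]
  {B : Type*} [TopologicalSpace B] [ChartedSpace H B]
  {F : Type*} [AddCommGroup F] [Module ℝ F] [TopologicalSpace F]

/-- A smooth manifold (without boundary) modelled on `H`: the changes of charts are smooth. -/
class FrechetManifold (B : Type*) [TopologicalSpace B] [ChartedSpace H B] : Prop where
  smooth_change : ∀ e ∈ atlas H B, ∀ e' ∈ atlas H B,
    SmoothOn (fun x => e' (e.symm x)) (e.symm.trans e').source

/-- Smoothness, on the open set `W`, of a function from a manifold to a Frechet space. -/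
def SmoothFunOn (f : B → F) (W : Set B) : Prop :=
  ∀ e ∈ atlas H B, SmoothOn (fun x => f (e.symm x)) (e.target ∩ e.symm ⁻¹' W)

/-- Smoothness, on the open set `W`, of a map between manifolds modelled on `H` and `K`. -/
def SmoothMapOn (K : Type*) [AddCommGroup K] [Module ℝ K] [TopologicalSpace K]
    {N : Type*} [TopologicalSpace N] [ChartedSpace K N] (f : B → N) (W : Set B) : Prop :=
  ContinuousOn f W ∧ ∀ e ∈ atlas H B, ∀ e' ∈ atlas K N,
    SmoothOn (fun x => e' (f (e.symm x))) (e.target ∩ e.symm ⁻¹' (W ∩ f ⁻¹' e'.source))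

/-- The tangent space `T_b B` is identified with `H` by means of the preferred chart at `b`.
This is the derivative at `b` of a function `f` in the direction `v ∈ T_b B`. -/
def mDeriv (f : B → F) (b : B) (v : H) : F :=
  dirDeriv (fun x => f ((chartAt H b).symm x)) (chartAt H b b) v

variable {H}

/-- The element of `T_b B`, `b = e.symm x`, that has the coordinate expression `v` in the
chart `e`. -/
def chartVec (e : OpenPartialHomeomorph B H) (x v : H) : H :=
  dirDeriv (fun y => chartAt H (e.symm x) (e.symm y)) x v

variable (H)

/-- The underlying functions of `F`-valued differential `k`-forms on `B`: `ω b v` is the value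
of the form at the point `b` on the tangent vectors `v 0, …, v (k - 1)` at `b`. Genuine
(smooth) forms are singled out by `IsSmoothFormOn`. -/
abbrev Form (B F : Type*) (k : ℕ) := B → (Fin k → H) → F

variable {H} {k : ℕ}

/-- The coordinate expression of the form `ω` in the chart `e`. -/
def Form.inChart (ω : Form H B F k) (e : OpenPartialHomeomorph B H) (x : H) (v : Fin k → H) : F :=
  ω (e.symm x) (fun j => chartVec e x (v j))

/-- `ω` is a smooth differential `k`-form on the open set `W`. -/
def IsSmoothFormOn (ω : Form H B F k) (W : Set B) : Prop :=
  (∀ b ∈ W, ∃ a : H [⋀^Fin k]→ₗ[ℝ] F, ∀ v, ω b v = a v) ∧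
  ∀ e ∈ atlas H B, SmoothOn (fun p : H × (Fin k → H) => ω.inChart e p.1 p.2)
    ((e.target ∩ e.symm ⁻¹' W) ×ˢ univ)

/-- The exterior derivative, computed at `b` in the preferred chart at `b`:
`dω(v 0, …, v k) = ∑ i, (-1)^i D_(v i) (ω (v 0, …, omit v i, …, v k))`. -/
def extD (ω : Form H B F k) : Form H B F (k + 1) := fun b v =>
  ∑ i : Fin (k + 1), (-1 : ℝ) ^ (i : ℕ) •
    dirDeriv (fun x => ω.inChart (chartAt H b) x (i.removeNth v)) (chartAt H b b) (v i)

/-- Closed forms. -/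
def IsClosedForm (ω : Form H B F k) : Prop := ∀ b v, extD ω b v = 0

/-- Exact forms: `ω = dη` for some smooth form `η` of one degree less; in degree `0` only the
zero form is exact. -/
def IsExactForm : {k : ℕ} → Form H B F k → Prop
  | 0, ω => ∀ b v, ω b v = 0
  | k + 1, ω => ∃ η : Form H B F k, IsSmoothFormOn η univ ∧ ∀ b v, ω b v = extD η b v

/-- Two (closed) forms have the same de Rham cohomology class. -/
def SameDeRhamClass (ω ω' : Form H B F k) : Prop :=
  IsExactForm (fun b v => ω b v - ω' b v)

end Manifolds

/-! ## Exterior products of alternating forms with values in an algebra -/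

section Wedge

variable {H : Type*} {A : Type*} [Ring A] [Algebra ℂ A]

/-- `(α ∧ β)(v) = 1 / (p! q!) ∑ σ, sign σ • α (v_σ(1), …, v_σ(p)) β (v_σ(p+1), …, v_σ(p+q))`. -/
def wedge {p q : ℕ} (α : (Fin p → H) → A) (β : (Fin q → H) → A) (v : Fin (p + q) → H) : A :=
  ((p ! : ℝ) * (q ! : ℝ))⁻¹ • ∑ σ : Equiv.Perm (Fin (p + q)), Equiv.Perm.sign σ •
    (α (fun i => v (σ (Fin.castAdd q i))) * β (fun j => v (σ (Fin.natAdd p j))))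

/-- The exterior power `α ^ k = α ∧ … ∧ α` of a two-form. -/
def wedgePow (α : (Fin 2 → H) → A) : (k : ℕ) → (Fin (2 * k) → H) → A
  | 0 => fun _ => 1
  | k + 1 => wedge (wedgePow α k) α

end Wedge

/-! ## Frechet Lie groups -/

section LieGroups

variable (L : Type*) [AddCommGroup L] [Module ℝ L] [TopologicalSpace L]

/-- A Lie group modelled on the Frechet space `L`: multiplication and inversion are smooth. -/
class FrechetLieGroup (G : Type*) [Group G] [TopologicalSpace G] [IsTopologicalGroup G]
    [ChartedSpace L G] : Prop extends FrechetManifold L G where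
  smooth_mul : ∀ e₁ ∈ atlas L G, ∀ e₂ ∈ atlas L G, ∀ e₃ ∈ atlas L G,
    SmoothOn (fun p : L × L => e₃ (e₁.symm p.1 * e₂.symm p.2))
      {p | p.1 ∈ e₁.target ∧ p.2 ∈ e₂.target ∧ e₁.symm p.1 * e₂.symm p.2 ∈ e₃.source}
  smooth_inv : SmoothMapOn L L (fun g : G => g⁻¹) univ

variable {L} {G : Type*} [Group G] [TopologicalSpace G] [ChartedSpace L G]

/-- The Lie algebra `Lie(G) = T_1 G` is identified with `L` by means of the preferred chart at `1`.
The adjoint action `Ad_g a = D_1(C_g) a`, where `C_g(h) = g h g⁻¹`. -/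
def Ad (g : G) (a : L) : L :=
  dirDeriv (fun z => chartAt L (1 : G) (g * (chartAt L (1 : G)).symm z * g⁻¹))
    (chartAt L (1 : G) 1) a

/-- The derivative `Lie(G) → A` at `1` of a homomorphism `ρ` from `G` to the units of the
algebra `A`. -/
def dRep {A : Type*} [Ring A] [Algebra ℂ A] [TopologicalSpace A] (ρ : G →* A) (a : L) : A :=
  mDeriv L (fun g : G => ρ g) 1 a

/-- The `Lie(G)`-valued one-form `g⁻¹ dg` of a map `g : B → G`: the derivative at `b`
of `y ↦ g(b)⁻¹ g(y)`, an element of `T_1 G`. -/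
def mcForm {H : Type*} [AddCommGroup H] [Module ℝ H] [TopologicalSpace H]
    {B : Type*} [TopologicalSpace B] [ChartedSpace H B] (g : B → G) (b : B) (v : H) : L :=
  mDeriv H (fun y => chartAt L (1 : G) ((g b)⁻¹ * g y)) b v

end LieGroups

/-! ## Bundles with structure group, connections, curvature -/

section Bundles

variable (H : Type*) [AddCommGroup H] [Module ℝ H] [TopologicalSpace H]
  {B : Type*} [TopologicalSpace B] [ChartedSpace H B]
  (L : Type*) [AddCommGroup L] [Module ℝ L] [TopologicalSpace L]
  {G : Type*} [Group G] [TopologicalSpace G] [ChartedSpace L G]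
  {A : Type*} [Ring A] [Algebra ℂ A] [TopologicalSpace A]
  (ρ : G →* A)
  (V : Type*) [AddCommGroup V] [Module ℂ V] [TopologicalSpace V] [Module A V]
  (I : Type*)
  (E : B → Type*) [∀ b, AddCommGroup (E b)] [∀ b, Module ℂ (E b)]

/-- A vector bundle `E → B` with typical fiber `V` and structure group `G`, where `G` acts on `V`
through the homomorphism `ρ` into an algebra `A` of operators on `V`. The bundle is given by an
open cover `U i`, trivializations over the `U i`, and smooth transition functions `g i j` into `G`
which satisfy the cocycle condition. Gluing copies of `G` by the same `g i j` gives the associated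
principal bundle `P = P^E`; gluing copies of `A` (or of `Lie(G)`) by the adjoint action of `g i j`
gives the adjoint bundle. -/
structure GVectorBundle where
  U : I → Set B
  isOpen_U : ∀ i, IsOpen (U i)
  /-- some index `i` with `b ∈ U i` -/
  indexAt : B → I
  mem_indexAt : ∀ b, b ∈ U (indexAt b)
  /-- the trivialization over `U i` at the point `b` (only used for `b ∈ U i`) -/
  triv : I → ∀ b, V ≃ₗ[ℂ] E b
  /-- the transition functions (only used on `U i ∩ U j`) -/
  g : I → I → B → G
  smooth_g : ∀ i j, SmoothMapOn H L (g i j) (U i ∩ U j)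
  cocycle : ∀ i j k, ∀ b ∈ U i ∩ U j ∩ U k, g i j b * g j k b = g i k b
  triv_change : ∀ i j, ∀ b ∈ U i ∩ U j, ∀ x : V, triv j b x = triv i b (ρ (g i j b) • x)

variable {H L ρ V I E}

/-- A connection on the bundle `E` with structure group `G`: a connection on `P^E`, i.e. a family
of smooth one-forms `θ i` on `U i` with values in `Lie(G)` which satisfy
`θ j = Ad(g_ij⁻¹) θ i + g_ij⁻¹ dg_ij`, together with the covariant derivative `∇ = d + θ i`
that it defines on (local) sections of `E`. -/
structure Connection (P : GVectorBundle H L ρ V I E) where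
  θ : I → Form H B L 1
  smooth_θ : ∀ i, IsSmoothFormOn (θ i) (P.U i)
  gauge : ∀ i j, ∀ b ∈ P.U i ∩ P.U j, ∀ v : Fin 1 → H,
    θ j b v = Ad (P.g i j b)⁻¹ (θ i b v) + mcForm (P.g i j) b (v 0)
  nabla : (∀ b, E b) → ∀ b, H → E b
  nabla_eq : ∀ (i : I) (W : Set B), IsOpen W → W ⊆ P.U i → ∀ s : ∀ b, E b,
    SmoothFunOn H (fun b => (P.triv i b).symm (s b)) W → ∀ b ∈ W, ∀ v : H,
      nabla s b v = P.triv i b (mDeriv H (fun b' => (P.triv i b').symm (s b')) b v +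
        dRep ρ (θ i b (fun _ => v)) • (P.triv i b).symm (s b))

namespace Connection

variable {P : GVectorBundle H L ρ V I E} (D : Connection P)

/-- The connection one-form over `U i` as an operator-valued form. -/
def opForm (i : I) : Form H B A 1 := fun b v => dRep ρ (D.θ i b v)

/-- The curvature `Ω = ∇² = dθ + θ ∧ θ` over `U i`. -/
def curv (i : I) : Form H B A 2 := fun b v =>
  extD (D.opForm i) b v + wedge (D.opForm i b) (D.opForm i b) v

/-- The component of degree `2k` of `f(Ω)` over `U i`, for an analytic function `f`: it is
`(f^(k)(0) / k!) Ω^k`. -/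
def curvFun (f : ℂ → ℂ) (k : ℕ) (i : I) : Form H B A (2 * k) := fun b v =>
  (iteratedDeriv k f 0 / (k ! : ℂ)) • wedgePow (D.curv i b) k v

/-- The induced connection `∇^ad = d + [θ, ·]` over `U i`. -/
def adNabla (i : I) (σ : B → A) (b : B) (v : H) : A :=
  mDeriv H σ b v + (D.opForm i b (fun _ => v) * σ b - σ b * D.opForm i b (fun _ => v))

end Connection

/-- A smooth morphism `λ : Ad P → B × ℂ`, linear on the fibers, given over each `U i` by smoothly
varying linear forms on `A` which match on overlaps. -/
structure AdMorphism (P : GVectorBundle H L ρ V I E) where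
  form : I → B → A →ₗ[ℝ] ℂ
  smooth_form : ∀ i, ∀ e ∈ atlas H B, SmoothOn (fun p : H × A => form i (e.symm p.1) p.2)
    ((e.target ∩ e.symm ⁻¹' P.U i) ×ˢ univ)
  form_change : ∀ i j, ∀ b ∈ P.U i ∩ P.U j, ∀ a : A,
    form i b (ρ (P.g i j b) * a * ρ (P.g i j b)⁻¹) = form j b a

/-- `Ad`-invariance of a linear form, `Ad_g^* l = l` for all `g` in `G`. -/
def AdInvariant (ρ : G →* A) (l : A →L[ℝ] ℂ) : Prop :=
  ∀ (g : G) (a : A), l (ρ g * a * ρ g⁻¹) = l a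

namespace AdMorphism

variable {P : GVectorBundle H L ρ V I E}

/-- The morphism `Ad P → B × ℂ` induced by an `Ad`-invariant linear form. -/
def induced (P : GVectorBundle H L ρ V I E) (l : A →L[ℝ] ℂ) (hl : AdInvariant ρ l) :
    AdMorphism P where
  form _ _ := l
  smooth_form _ _ _ n :=
    ckOn_continuousLinearMap n (l.comp (ContinuousLinearMap.snd ℝ H A)) _
  form_change _ _ _ _ a := hl _ a

variable (Λ : AdMorphism P)

/-- `d ∘ λ = λ ∘ ∇^ad` on all local sections of `Ad P`. -/
def CommutesWith (D : Connection P) : Prop :=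
  ∀ (i : I) (W : Set B), IsOpen W → W ⊆ P.U i → ∀ σ : B → A, SmoothFunOn H σ W →
    ∀ b ∈ W, ∀ v : H,
      mDeriv H (fun b' => Λ.form i b' (σ b')) b v = Λ.form i b (D.adNabla i σ b v)

/-- The component of degree `2k` of the form `λ(f(Ω))` on `B`. -/
def chernForm (D : Connection P) (f : ℂ → ℂ) (k : ℕ) : Form H B ℂ (2 * k) := fun b v =>
  Λ.form (P.indexAt b) b (D.curvFun f k (P.indexAt b) b v)

end AdMorphism

end Bundles

end FrechetCW

end

noncomputable section

namespace FrechetCW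

open Set Filter
open scoped Topology Nat

universe u v w

set_option linter.unusedSectionVars false

/-! ## Directional derivatives -/

section DirDeriv

variable {E : Type*} [AddCommGroup E] [Module ℝ E] [TopologicalSpace E]
  [IsTopologicalAddGroup E] [ContinuousSMul ℝ E]
  {F : Type*} [AddCommGroup F] [Module ℝ F] [TopologicalSpace F]

/-! The theorem reduces to computations with an operator-valued connection form `T` on an open
subset of `H`. At a point `x` the operators `δ_u s = D_u s + [T(x, u), s]` are derivations from the
ring of smooth `A`-valued functions to `A`, over evaluation at `x` (`covDeriv_mul`). The curvature
`R = dT + T ∧ T` satisfies the Bianchi identity: the cyclic sum of `δ_u R(v, w)` vanishes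
(`bianchi`), by symmetry of second derivatives and the Jacobi identity.

Up to a constant, `Ω^k` is the antisymmetrization of the plain product `R ⋯ R`. The covariant
exterior derivative of such an antisymmetrization is the antisymmetrization of `δ_(v 0)(R ⋯ R)`. By
Leibniz every term contains one differentiated `R`, and an even 3-cycle of the arguments turns it
into a Bianchi sum, so it is zero (`altSum_deriv_prodPow`). The hypothesis `d ∘ λ = λ ∘ ∇^ad`
converts `d(λ ∘ F)` into `λ` of the covariant exterior derivative of `F` (`AdMorphism.extD_glue`),
which gives closedness.

For two connections, the segment `ϑ + t(ϑ' - ϑ)` consists of connections that still commute with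
`λ`. With `η = ϑ' - ϑ`, the `t`-derivative of `R_t` is the covariant exterior derivative of `η`.
Hence the `t`-derivative of `R_t^k` is covariantly exact, with primitive the sum of the products
`R_t ⋯ η ⋯ R_t` (`altSum_deriv_transProd`). Since `R_t` is quadratic in `t`, the power is a
polynomial in `t`, and the integral over `[0, 1]` can be replaced by an exact quadrature formula.
The transgression form is therefore a finite sum, and no integral of Fréchet-valued forms is needed
(`prodPow_curvature_sub`, `IsConnectionFamily.exists_transgression`).

For an invariant linear form, differentiating `l(ρ(g) s) = l(s ρ(g))` at `g = 1` shows that `l`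
kills the commutators in `∇^ad`.

The calculus underneath rests on a mean value theorem obtained from Hahn-Banach separation. With
compactness of `[0, 1]` it yields strict differentiability, and from this the chain rule, additivity
of the derivative in the direction and symmetry of second derivatives. -/

theorem tendsto_line (x v : E) : Tendsto (fun t : ℝ => x + t • v) (𝓝[≠] 0) (𝓝 x) := by
  have h : Continuous (fun t : ℝ => x + t • v) := by fun_prop
  have := h.tendsto 0
  simp only [zero_smul, add_zero] at this
  exact this.mono_left nhdsWithin_le_nhds

theorem HasDirDeriv.congr {f g : E → F} {x v : E} {w : F} (h : HasDirDeriv f x v w)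
    (hfg : f =ᶠ[𝓝 x] g) : HasDirDeriv g x v w := by
  refine Tendsto.congr' ?_ h
  filter_upwards [(tendsto_line x v).eventually hfg] with t ht
  rw [ht, hfg.self_of_nhds]

theorem dirDeriv_congr {f g : E → F} {x : E} (hfg : f =ᶠ[𝓝 x] g) (v : E) :
    dirDeriv f x v = dirDeriv g x v := by
  unfold dirDeriv limUnder
  congr 1
  refine Filter.map_congr ?_
  filter_upwards [(tendsto_line x v).eventually hfg] with t ht
  rw [ht, hfg.self_of_nhds]

theorem HasDirDeriv.dirDeriv_eq [T2Space F] {f : E → F} {x v : E} {w : F}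
    (h : HasDirDeriv f x v w) : dirDeriv f x v = w := h.limUnder_eq

variable [IsTopologicalAddGroup F] [ContinuousSMul ℝ F]

theorem HasDirDeriv.add {f g : E → F} {x v : E} {a b : F} (hf : HasDirDeriv f x v a)
    (hg : HasDirDeriv g x v b) : HasDirDeriv (fun y => f y + g y) x v (a + b) := by
  refine (Tendsto.add hf hg).congr fun t => ?_
  rw [← smul_add]; congr 1; beta_reduce; abel

theorem HasDirDeriv.sub {f g : E → F} {x v : E} {a b : F} (hf : HasDirDeriv f x v a)
    (hg : HasDirDeriv g x v b) : HasDirDeriv (fun y => f y - g y) x v (a - b) := by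
  refine (Tendsto.sub hf hg).congr fun t => ?_
  rw [← smul_sub]; congr 1; beta_reduce; abel

theorem HasDirDeriv.const (c : F) (x v : E) : HasDirDeriv (fun _ : E => c) x v 0 := by
  simpa [HasDirDeriv] using tendsto_const_nhds

theorem HasDirDeriv.shift {f : E → F} {x v y : E} {a : F} (hf : HasDirDeriv f (x + y) v a) :
    HasDirDeriv (fun z => f (z + y)) x v a := by
  refine Tendsto.congr (fun t => ?_) hf
  rw [add_right_comm]

theorem HasDirDeriv.clm {K : Type*} [AddCommGroup K] [Module ℝ K] [TopologicalSpace K]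
    {f : E → F} {x v : E} {a : F} (hf : HasDirDeriv f x v a) (L : F →L[ℝ] K) :
    HasDirDeriv (fun y => L (f y)) x v (L a) := by
  refine ((L.continuous.tendsto a).comp hf).congr fun t => ?_
  simp

theorem HasDirDeriv.smul_dir {f : E → F} {x v : E} {a : F} (hf : HasDirDeriv f x v a) (c : ℝ) :
    HasDirDeriv f x (c • v) (c • a) := by
  rcases eq_or_ne c 0 with rfl | hc
  · simpa [HasDirDeriv] using tendsto_const_nhds
  · have h1 : Tendsto (fun t : ℝ => t * c) (𝓝[≠] 0) (𝓝[≠] 0) := by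
      refine tendsto_nhdsWithin_iff.2 ⟨?_, ?_⟩
      · have : Continuous fun t : ℝ => t * c := by fun_prop
        have := this.tendsto 0
        rw [zero_mul] at this
        exact this.mono_left nhdsWithin_le_nhds
      · filter_upwards [self_mem_nhdsWithin] with t ht
        exact mul_ne_zero ht hc
    refine ((Tendsto.comp hf h1).const_smul c).congr fun t => ?_
    simp only [Function.comp, smul_smul]
    rw [mul_inv, mul_comm c, mul_assoc, inv_mul_cancel₀ hc, mul_one]

/-- The mean value theorem for curves in a locally convex space. -/
theorem sub_mem_of_slopes_mem [LocallyConvexSpace ℝ F] {γ γ' : ℝ → F} {C : Set F}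
    (hC : Convex ℝ C) (hCc : IsClosed C)
    (hγ : ∀ s ∈ Icc (0 : ℝ) 1,
      Tendsto (fun t : ℝ => t⁻¹ • (γ (s + t) - γ s)) (𝓝[≠] 0) (𝓝 (γ' s)))
    (hm : ∀ s ∈ Icc (0 : ℝ) 1, γ' s ∈ C) : γ 1 - γ 0 ∈ C := by
  by_contra hcon
  -- A functional that separates the increment from `C` reduces the claim to the real mean value
  -- theorem for `ℓ ∘ γ`.
  obtain ⟨ℓ, c, h1, h2⟩ := geometric_hahn_banach_closed_point hC hCc hcon
  have hd : ∀ s ∈ Icc (0 : ℝ) 1, HasDerivAt (fun s => ℓ (γ s)) (ℓ (γ' s)) s := by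
    intro s hs
    rw [hasDerivAt_iff_tendsto_slope_zero]
    refine ((ℓ.continuous.tendsto _).comp (hγ s hs)).congr fun t => ?_
    simp
  obtain ⟨s, hs, hs'⟩ := exists_hasDerivAt_eq_slope (fun s => ℓ (γ s)) (fun s => ℓ (γ' s))
    (zero_lt_one' ℝ) (fun s hs => (hd s hs).continuousAt.continuousWithinAt)
    (fun s hs => hd s (Ioo_subset_Icc_self hs))
  have h3 := h1 _ (hm s (Ioo_subset_Icc_self hs))
  simp only [sub_zero, div_one] at hs'
  rw [hs', ← map_sub] at h3
  exact lt_asymm h2 h3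

/-- The mean value theorem for the curve `s ↦ τ⁻¹ • f (y + (s * τ) • V)`: the factor `τ` produced by
the inner derivative cancels `τ⁻¹`, so the velocity is `W s`. -/
theorem segment_slope_mem [LocallyConvexSpace ℝ F] {f : E → F} {y V : E} {τ : ℝ} (hτ : τ ≠ 0)
    {W : ℝ → F} {C : Set F} (hC : Convex ℝ C) (hCc : IsClosed C)
    (h : ∀ s ∈ Icc (0 : ℝ) 1, HasDirDeriv f (y + (s * τ) • V) V (W s))
    (hm : ∀ s ∈ Icc (0 : ℝ) 1, W s ∈ C) : τ⁻¹ • (f (y + τ • V) - f y) ∈ C := by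
  have := sub_mem_of_slopes_mem (γ := fun s => τ⁻¹ • f (y + (s * τ) • V)) (γ' := W) hC hCc
    (fun s hs => ?_) hm
  · simpa [smul_sub] using this
  · have h1 : Tendsto (fun t : ℝ => t * τ) (𝓝[≠] 0) (𝓝[≠] 0) := by
      refine tendsto_nhdsWithin_iff.2 ⟨?_, ?_⟩
      · have : Continuous fun t : ℝ => t * τ := by fun_prop
        have := this.tendsto 0
        rw [zero_mul] at this
        exact this.mono_left nhdsWithin_le_nhds
      · filter_upwards [self_mem_nhdsWithin] with t ht
        exact mul_ne_zero ht hτ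
    refine (Tendsto.comp (h s hs) h1).congr fun t => ?_
    simp only [Function.comp]
    rw [mul_inv, mul_smul, add_mul, add_smul, add_assoc, ← smul_sub]

/-- Regularity gives a closed neighbourhood, local convexity a convex one inside it, and the closure
of the latter is still convex. Separation arguments need both properties at once. -/
theorem exists_closed_convex_nhds [LocallyConvexSpace ℝ F] {a : F} {N : Set F} (hN : N ∈ 𝓝 a) :
    ∃ C ∈ 𝓝 a, IsClosed C ∧ Convex ℝ C ∧ C ⊆ N := by
  obtain ⟨N', hN', hc, hs⟩ := exists_mem_nhds_isClosed_subset hN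
  obtain ⟨C, ⟨hC, hCc⟩, hCN⟩ := (LocallyConvexSpace.convex_basis (𝕜 := ℝ) a).mem_iff.1 hN'
  exact ⟨closure C, mem_of_superset hC subset_closure, isClosed_closure, hCc.closure,
    (closure_minimal hCN hc).trans hs⟩

/-- If the directional derivatives of `f` depend continuously on the point and the direction,
they are derivatives in a strict sense. -/
theorem tendsto_slope_of_continuousOn [LocallyConvexSpace ℝ F] {ι : Type*} {l : Filter ι}
    {f : E → F} {f' : E × E → F} {U : Set E} (hU : IsOpen U) {x v : E} (hx : x ∈ U)
    (hf : ∀ y ∈ U, ∀ v, HasDirDeriv f y v (f' (y, v))) (hc : ContinuousOn f' (U ×ˢ univ))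
    {X Y : ι → E} {τ : ι → ℝ} (hX : Tendsto X l (𝓝 x)) (hY : Tendsto Y l (𝓝 v))
    (hτ : Tendsto τ l (𝓝[≠] 0)) :
    Tendsto (fun i => (τ i)⁻¹ • (f (X i + τ i • Y i) - f (X i))) l (𝓝 (f' (x, v))) := by
  rw [tendsto_def]
  intro N hN
  obtain ⟨C, hCn, hCc, hC, hCN⟩ := exists_closed_convex_nhds hN
  have hW : {p : E × E | p.1 ∈ U ∧ f' p ∈ C} ∈ 𝓝 (x, v) := by
    have h1 : U ×ˢ univ ∈ 𝓝 (x, v) := (hU.prod isOpen_univ).mem_nhds ⟨hx, mem_univ _⟩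
    filter_upwards [h1, (hc.continuousAt h1) hCn] with p hp hp'
    exact ⟨hp.1, hp'⟩
  -- Compactness of `[0, 1]` keeps the whole segment, not only its endpoints, where `f'` takes
  -- values in `C`.
  have key : ∀ᶠ q : E × E × ℝ in 𝓝 (x, v, 0), ∀ s ∈ Icc (0 : ℝ) 1,
      (q.1 + (s * q.2.2) • q.2.1, q.2.1) ∈ {p : E × E | p.1 ∈ U ∧ f' p ∈ C} := by
    refine isCompact_Icc.eventually_forall_of_forall_eventually fun s _ => ?_
    have hcont : Continuous (fun z : (E × E × ℝ) × ℝ =>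
      (z.1.1 + (z.2 * z.1.2.2) • z.1.2.1, z.1.2.1)) := by fun_prop
    have := hcont.tendsto ((x, v, 0), s)
    simp only [mul_zero, zero_smul, add_zero] at this
    exact this hW
  have hlim : Tendsto (fun i => (X i, Y i, τ i)) l (𝓝 (x, v, 0)) :=
    hX.prodMk_nhds (hY.prodMk_nhds (hτ.mono_right nhdsWithin_le_nhds))
  filter_upwards [hlim.eventually key, hτ.eventually (self_mem_nhdsWithin (a := (0 : ℝ)))] with i hi hi'
  exact hCN (segment_slope_mem hi' hC hCc (fun s hs => hf _ (hi s hs).1 _)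
    (fun s hs => (hi s hs).2))

/-- The chain rule. -/
theorem HasDirDeriv.comp {K : Type*} [AddCommGroup K] [Module ℝ K] [TopologicalSpace K]
    [IsTopologicalAddGroup K] [ContinuousSMul ℝ K] [LocallyConvexSpace ℝ K]
    {g : F → K} {g' : F × F → K} {V : Set F} (hV : IsOpen V)
    (hg : ∀ y ∈ V, ∀ v, HasDirDeriv g y v (g' (y, v))) (hc : ContinuousOn g' (V ×ˢ univ))
    {f : E → F} {x v : E} {a : F} (hf : HasDirDeriv f x v a) (hx : f x ∈ V) :
    HasDirDeriv (fun y => g (f y)) x v (g' (f x, a)) := by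
  -- Here the base point is constant and the varying direction is the difference quotient of `f`
  -- itself.
  refine (tendsto_slope_of_continuousOn hV hx hg hc tendsto_const_nhds hf tendsto_id).congr' ?_
  filter_upwards [self_mem_nhdsWithin] with t ht
  have ht' : t ≠ 0 := ht
  simp [smul_smul, ht']

/-- The increment along `t • (v + w)` is one along `t • v` from `x` plus one along `t • w` from `x +
t • v`; the moving base point of the second is harmless by strict differentiability. -/
theorem hasDirDeriv_add_dir [LocallyConvexSpace ℝ F] {f : E → F} {f' : E × E → F} {U : Set E}
    (hU : IsOpen U) (hf : ∀ y ∈ U, ∀ v, HasDirDeriv f y v (f' (y, v)))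
    (hc : ContinuousOn f' (U ×ˢ univ)) {x : E} (hx : x ∈ U) (v w : E) :
    HasDirDeriv f x (v + w) (f' (x, v) + f' (x, w)) := by
  have h1 := tendsto_slope_of_continuousOn hU (v := w) hx hf hc (tendsto_line x v)
    tendsto_const_nhds tendsto_id
  refine (Tendsto.add (hf x hx v) h1).congr fun t => ?_
  simp only [id]
  rw [← smul_add, smul_add t v w, ← add_assoc]; simp

/-- Two applications of the mean value theorem, along `v` to the increment of `f` by `t • w` and
then along `w` to `f' (·, v)`, put the second difference quotient into any given closed convex
neighbourhood of the limit. -/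
theorem tendsto_second_difference [LocallyConvexSpace ℝ F] {f : E → F} {f' : E × E → F}
    {f'' : (E × E) × (E × E) → F} {U : Set E} (hU : IsOpen U)
    (hf : ∀ y ∈ U, ∀ v, HasDirDeriv f y v (f' (y, v)))
    (hf' : ∀ y ∈ U ×ˢ univ, ∀ v, HasDirDeriv f' y v (f'' (y, v)))
    (hc : ContinuousOn f'' ((U ×ˢ univ) ×ˢ univ)) {x : E} (hx : x ∈ U) (v w : E) :
    Tendsto (fun t : ℝ => t⁻¹ • (t⁻¹ • ((f (x + t • v + t • w) - f (x + t • v)) -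
      (f (x + t • w) - f x)))) (𝓝[≠] 0) (𝓝 (f'' ((x, v), (w, 0)))) := by
  rw [tendsto_def]
  intro N hN
  obtain ⟨C, hCn, hCc, hC, hCN⟩ := exists_closed_convex_nhds hN
  have hW : {y : E | y ∈ U ∧ f'' ((y, v), (w, 0)) ∈ C} ∈ 𝓝 x := by
    have h1 : (U ×ˢ univ) ×ˢ univ ∈ 𝓝 ((x, v), (w, (0 : E))) :=
      ((hU.prod isOpen_univ).prod isOpen_univ).mem_nhds ⟨⟨hx, mem_univ _⟩, mem_univ _⟩
    have h2 : Tendsto (fun y : E => ((y, v), (w, (0 : E)))) (𝓝 x) (𝓝 ((x, v), (w, 0))) :=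
      Continuous.tendsto (by fun_prop) x
    filter_upwards [hU.mem_nhds hx, h2 ((hc.continuousAt h1) hCn)] with p hp hp'
    exact ⟨hp, hp'⟩
  have key : ∀ᶠ t : ℝ in 𝓝 0, ∀ p ∈ Icc (0 : ℝ) 1 ×ˢ Icc (0 : ℝ) 1,
      x + (p.1 * t) • v + (p.2 * t) • w ∈ {y : E | y ∈ U ∧ f'' ((y, v), (w, 0)) ∈ C} := by
    refine (isCompact_Icc.prod isCompact_Icc).eventually_forall_of_forall_eventually
      fun p _ => ?_
    have hcont : Continuous (fun z : ℝ × ℝ × ℝ =>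
      x + (z.2.1 * z.1) • v + (z.2.2 * z.1) • w) := by fun_prop
    have := hcont.tendsto (0, p)
    simp only [mul_zero, zero_smul, add_zero] at this
    exact this hW
  filter_upwards [key.filter_mono nhdsWithin_le_nhds, self_mem_nhdsWithin] with t ht ht0
  have h01 : (1 : ℝ) ∈ Icc (0 : ℝ) 1 := by simp
  have h00 : (0 : ℝ) ∈ Icc (0 : ℝ) 1 := by simp
  refine hCN ?_
  have hmain := segment_slope_mem (f := fun z => t⁻¹ • (f (z + t • w) - f z)) (y := x) (V := v)
    (τ := t) (W := fun s => t⁻¹ • (f' (x + (s * t) • v + t • w, v) - f' (x + (s * t) • v, v)))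
    ht0 hC hCc ?_ ?_
  · simpa only [smul_sub] using hmain
  · intro s hs
    have h1 := (ht (s, 1) ⟨hs, h01⟩).1
    have h0 := (ht (s, 0) ⟨hs, h00⟩).1
    simp only [one_mul, zero_mul, zero_smul, add_zero] at h1 h0
    exact (((hf _ h1 v).shift).sub (hf _ h0 v)).clm (t⁻¹ • ContinuousLinearMap.id ℝ F)
  · intro s hs
    have := segment_slope_mem (f := fun z => f' (z, v)) (y := x + (s * t) • v) (V := w)
      (τ := t) (W := fun r => f'' ((x + (s * t) • v + (r * t) • w, v), (w, 0)))
      ht0 hC hCc ?_ ?_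
    · exact this
    · intro r hr
      have := hf' _ (show (x + (s * t) • v + (r * t) • w, v) ∈ U ×ˢ univ from
        ⟨(ht (s, r) ⟨hs, hr⟩).1, mem_univ _⟩) (w, 0)
      refine Tendsto.congr (fun q => ?_) this
      simp
    · intro r hr
      exact (ht (s, r) ⟨hs, hr⟩).2

/-- The second difference is symmetric in `v` and `w`, and limits in a Hausdorff space are unique.
-/
theorem second_dirDeriv_symm [LocallyConvexSpace ℝ F] [T2Space F] {f : E → F} {f' : E × E → F}
    {f'' : (E × E) × (E × E) → F} {U : Set E} (hU : IsOpen U)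
    (hf : ∀ y ∈ U, ∀ v, HasDirDeriv f y v (f' (y, v)))
    (hf' : ∀ y ∈ U ×ˢ univ, ∀ v, HasDirDeriv f' y v (f'' (y, v)))
    (hc : ContinuousOn f'' ((U ×ˢ univ) ×ˢ univ)) {x : E} (hx : x ∈ U) (v w : E) :
    f'' ((x, v), (w, 0)) = f'' ((x, w), (v, 0)) := by
  refine tendsto_nhds_unique (tendsto_second_difference hU hf hf' hc hx v w)
    ((tendsto_second_difference hU hf hf' hc hx w v).congr fun t => ?_)
  congr 2
  rw [add_right_comm x (t • w)]
  abel

end DirDeriv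

/-! ## Maps of class `C^n` -/

section Ck

variable {E : Type u} [AddCommGroup E] [Module ℝ E] [TopologicalSpace E]
  [IsTopologicalAddGroup E] [ContinuousSMul ℝ E]
  {F : Type v} [AddCommGroup F] [Module ℝ F] [TopologicalSpace F]
  [IsTopologicalAddGroup F] [ContinuousSMul ℝ F]
  {K : Type w} [AddCommGroup K] [Module ℝ K] [TopologicalSpace K]
  [IsTopologicalAddGroup K] [ContinuousSMul ℝ K]
  {n : ℕ}

theorem CkOn.continuousOn {f : E → F} {U : Set E} (h : CkOn n f U) : ContinuousOn f U := by
  cases n with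
  | zero => exact h
  | succ n => exact h.1

theorem CkOn.mono {f : E → F} {U V : Set E} (h : CkOn n f U) (hV : V ⊆ U) : CkOn n f V := by
  induction n generalizing E with
  | zero => exact ContinuousOn.mono h hV
  | succ n ih =>
    obtain ⟨h1, f', h2, h3⟩ := h
    exact ⟨h1.mono hV, f', fun x hx => h2 x (hV hx), ih h3 (prod_mono hV Subset.rfl)⟩

theorem CkOn.congr {f g : E → F} {U : Set E} (h : CkOn n f U) (hU : IsOpen U)
    (hfg : EqOn f g U) : CkOn n g U := by
  cases n with
  | zero => exact ContinuousOn.congr h hfg.symm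
  | succ n =>
    obtain ⟨h1, f', h2, h3⟩ := h
    exact ⟨h1.congr hfg.symm, f', fun x hx v =>
      (h2 x hx v).congr (hfg.eventuallyEq_of_mem (hU.mem_nhds hx)), h3⟩

theorem CkOn.of_succ {f : E → F} {U : Set E} (h : CkOn (n + 1) f U) : CkOn n f U := by
  induction n generalizing E with
  | zero => exact h.1
  | succ n ih =>
    obtain ⟨h1, f', h2, h3⟩ := h
    exact ⟨h1, f', h2, ih h3⟩

theorem CkOn.hasDirDeriv [T2Space F] {f : E → F} {U : Set E} (h : CkOn (n + 1) f U) {x : E}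
    (hx : x ∈ U) (v : E) : HasDirDeriv f x v (dirDeriv f x v) := by
  obtain ⟨h1, f', h2, h3⟩ := h
  rw [(h2 x hx v).dirDeriv_eq]
  exact h2 x hx v

theorem CkOn.dirDeriv [T2Space F] {f : E → F} {U : Set E} (h : CkOn (n + 1) f U)
    (hU : IsOpen U) : CkOn n (fun p : E × E => dirDeriv f p.1 p.2) (U ×ˢ univ) := by
  obtain ⟨h1, f', h2, h3⟩ := h
  exact h3.congr (hU.prod isOpen_univ) fun p hp => ((h2 _ hp.1 _).dirDeriv_eq).symm

/-- The derivative in `CkOn` is only asserted to exist, so different patches could supply different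
witnesses; in a Hausdorff target they all agree with `dirDeriv`, which glues. -/
theorem CkOn.of_local [T2Space F] {f : E → F} {U : Set E} (hU : IsOpen U)
    (h : ∀ x ∈ U, ∃ V, IsOpen V ∧ x ∈ V ∧ CkOn n f (U ∩ V)) : CkOn n f U := by
  induction n generalizing E with
  | zero =>
    intro x hx
    obtain ⟨V, hV, hxV, hf⟩ := h x hx
    have hn := (hU.inter hV).mem_nhds ⟨hx, hxV⟩
    exact (ContinuousOn.continuousAt hf hn).continuousWithinAt
  | succ n ih =>
    refine ⟨?_, fun p => FrechetCW.dirDeriv f p.1 p.2, ?_, ?_⟩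
    · intro x hx
      obtain ⟨V, hV, hxV, hf⟩ := h x hx
      exact (ContinuousOn.continuousAt hf.continuousOn
        ((hU.inter hV).mem_nhds ⟨hx, hxV⟩)).continuousWithinAt
    · intro x hx v
      obtain ⟨V, hV, hxV, hf⟩ := h x hx
      exact hf.hasDirDeriv ⟨hx, hxV⟩ v
    · refine ih (hU.prod isOpen_univ) fun p hp => ?_
      obtain ⟨V, hV, hxV, hf⟩ := h p.1 hp.1
      refine ⟨V ×ˢ univ, hV.prod isOpen_univ, ⟨hxV, mem_univ _⟩, ?_⟩
      rw [prod_inter_prod, univ_inter]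
      exact hf.dirDeriv (hU.inter hV)

theorem CkOn.comp_clm {f : F → K} {U : Set F} (h : CkOn n f U) (A : E →L[ℝ] F) :
    CkOn n (fun x => f (A x)) (A ⁻¹' U) := by
  induction n generalizing E F with
  | zero => exact ContinuousOn.comp h A.continuous.continuousOn (mapsTo_preimage _ _)
  | succ n ih =>
    obtain ⟨h1, f', h2, h3⟩ := h
    refine ⟨h1.comp A.continuous.continuousOn (mapsTo_preimage _ _),
      fun p => f' (A.prodMap A p), fun x hx v => ?_, ?_⟩
    · refine Tendsto.congr (fun t => ?_) (h2 (A x) hx (A v))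
      simp
    · refine (ih h3 (A.prodMap A)).mono ?_
      rintro ⟨x, v⟩ hx
      exact ⟨hx.1, mem_univ _⟩

theorem CkOn.clm_comp {f : E → F} {U : Set E} (h : CkOn n f U) (A : F →L[ℝ] K) :
    CkOn n (fun x => A (f x)) U := by
  induction n generalizing E with
  | zero => exact A.continuous.comp_continuousOn h
  | succ n ih =>
    obtain ⟨h1, f', h2, h3⟩ := h
    exact ⟨A.continuous.comp_continuousOn h1, fun p => A (f' p),
      fun x hx v => (h2 x hx v).clm A, ih h3⟩

theorem CkOn.prodMk {f : E → F} {g : E → K} {U : Set E} (hf : CkOn n f U) (hg : CkOn n g U) :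
    CkOn n (fun x => (f x, g x)) U := by
  induction n generalizing E with
  | zero => exact ContinuousOn.prodMk hf hg
  | succ n ih =>
    obtain ⟨h1, f', h2, h3⟩ := hf
    obtain ⟨k1, g', k2, k3⟩ := hg
    refine ⟨h1.prodMk k1, fun p => (f' p, g' p), fun x hx v => ?_, ih h3 k3⟩
    exact (h2 x hx v).prodMk_nhds (k2 x hx v)

/-- The derivative `g' (f x, f' (x, v))` of the composite is itself a composite of maps of one class
less, which drives the induction through the spaces `E × E` and `F × F`. -/
theorem CkOn.comp [LocallyConvexSpace ℝ K] {g : F → K} {V : Set F} {f : E → F} {U : Set E}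
    (hg : CkOn n g V) (hf : CkOn n f U) (hV : IsOpen V) (hfV : MapsTo f U V) :
    CkOn n (fun x => g (f x)) U := by
  induction n generalizing E F with
  | zero => exact ContinuousOn.comp hg hf hfV
  | succ n ih =>
    have hf0 := hf.of_succ
    obtain ⟨h1, f', h2, h3⟩ := hf
    obtain ⟨k1, g', k2, k3⟩ := hg
    refine ⟨k1.comp h1 hfV, fun p => g' (f p.1, f' p),
      fun x hx v => (h2 x hx v).comp hV k2 k3.continuousOn (hfV hx), ?_⟩
    refine ih k3 (CkOn.prodMk (((hf0.comp_clm (ContinuousLinearMap.fst ℝ E E))).mono ?_) h3)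
      (hV.prod isOpen_univ) ?_
    · rintro ⟨x, v⟩ hx
      exact hx.1
    · rintro ⟨x, v⟩ hx
      exact ⟨hfV hx.1, mem_univ _⟩

theorem CkOn.add {f g : E → F} {U : Set E} (hf : CkOn n f U) (hg : CkOn n g U) :
    CkOn n (fun x => f x + g x) U :=
  (hf.prodMk hg).clm_comp (ContinuousLinearMap.fst ℝ F F + ContinuousLinearMap.snd ℝ F F)

theorem ckOn_const (c : F) (U : Set E) : CkOn n (fun _ : E => c) U := by
  induction n generalizing E c with
  | zero => exact continuousOn_const
  | succ n ih => exact ⟨continuousOn_const, fun _ => 0, fun x _ v => HasDirDeriv.const c x v, ih 0 _⟩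

/-- The derivative of the product is a sum of two products precomposed with continuous linear maps,
so differentiability of every order follows from continuity. The difference quotient is exactly `c *
b + a * d + t • (c * d)`. -/
theorem ckOn_mul {A : Type w} [Ring A] [Algebra ℝ A] [TopologicalSpace A]
    [IsTopologicalAddGroup A] [ContinuousSMul ℝ A] [ContinuousMul A] (U : Set (A × A)) :
    CkOn n (fun p : A × A => p.1 * p.2) U := by
  induction n generalizing U with
  | zero => exact continuous_mul.continuousOn
  | succ n ih =>
    refine ⟨continuous_mul.continuousOn, fun q => q.2.1 * q.1.2 + q.1.1 * q.2.2, ?_, ?_⟩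
    · rintro ⟨a, b⟩ - ⟨c, d⟩
      have hlim : Tendsto (fun t : ℝ => c * b + a * d + t • (c * d)) (𝓝[≠] 0)
          (𝓝 (c * b + a * d)) := tendsto_line (E := A) _ _
      refine hlim.congr' ?_
      filter_upwards [self_mem_nhdsWithin] with t ht
      have ht' : t ≠ 0 := ht
      simp only [Prod.fst_add, Prod.snd_add, Prod.smul_mk, add_mul, mul_add, smul_mul_assoc,
        mul_smul_comm]
      rw [show a * b + t • (c * b) + t • (a * d + t • (c * d)) - a * b =
        t • (c * b + a * d + t • (c * d)) by simp only [smul_add]; abel, smul_smul,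
        inv_mul_cancel₀ ht', one_smul]
    · have h1 := (ih univ).comp_clm (E := (A × A) × (A × A))
        (((ContinuousLinearMap.fst ℝ A A).comp (ContinuousLinearMap.snd ℝ (A × A) (A × A))).prod
          ((ContinuousLinearMap.snd ℝ A A).comp (ContinuousLinearMap.fst ℝ (A × A) (A × A))))
      have h2 := (ih univ).comp_clm (E := (A × A) × (A × A))
        (((ContinuousLinearMap.fst ℝ A A).comp (ContinuousLinearMap.fst ℝ (A × A) (A × A))).prod
          ((ContinuousLinearMap.snd ℝ A A).comp (ContinuousLinearMap.snd ℝ (A × A) (A × A))))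
      exact (h1.add h2).mono (subset_univ _)

end Ck

/-! ## Smooth maps -/

section Smooth

variable {E : Type u} [AddCommGroup E] [Module ℝ E] [TopologicalSpace E]
  [IsTopologicalAddGroup E] [ContinuousSMul ℝ E]
  {F : Type v} [AddCommGroup F] [Module ℝ F] [TopologicalSpace F]
  [IsTopologicalAddGroup F] [ContinuousSMul ℝ F]
  {K : Type w} [AddCommGroup K] [Module ℝ K] [TopologicalSpace K]
  [IsTopologicalAddGroup K] [ContinuousSMul ℝ K]

namespace SmoothOn

theorem mono {f : E → F} {U V : Set E} (h : SmoothOn f U) (hV : V ⊆ U) : SmoothOn f V :=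
  fun n => (h n).mono hV

theorem congr {f g : E → F} {U : Set E} (h : SmoothOn f U) (hU : IsOpen U)
    (hfg : EqOn f g U) : SmoothOn g U := fun n => (h n).congr hU hfg

theorem continuousOn {f : E → F} {U : Set E} (h : SmoothOn f U) : ContinuousOn f U := h 0

theorem of_local [T2Space F] {f : E → F} {U : Set E} (hU : IsOpen U)
    (h : ∀ x ∈ U, ∃ V, IsOpen V ∧ x ∈ V ∧ SmoothOn f (U ∩ V)) : SmoothOn f U := fun _ =>
  CkOn.of_local hU fun x hx => let ⟨V, h1, h2, h3⟩ := h x hx; ⟨V, h1, h2, h3 _⟩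

theorem clm (A : E →L[ℝ] F) (U : Set E) : SmoothOn A U :=
  fun n => ckOn_continuousLinearMap n A U

theorem const (c : F) (U : Set E) : SmoothOn (fun _ : E => c) U := fun _ => ckOn_const c U

theorem comp_clm {f : F → K} {U : Set F} (h : SmoothOn f U) (A : E →L[ℝ] F) :
    SmoothOn (fun x => f (A x)) (A ⁻¹' U) := fun n => (h n).comp_clm A

theorem clm_comp {f : E → F} {U : Set E} (h : SmoothOn f U) (A : F →L[ℝ] K) :
    SmoothOn (fun x => A (f x)) U := fun n => (h n).clm_comp A

theorem prodMk {f : E → F} {g : E → K} {U : Set E} (hf : SmoothOn f U) (hg : SmoothOn g U) :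
    SmoothOn (fun x => (f x, g x)) U := fun n => (hf n).prodMk (hg n)

theorem comp [LocallyConvexSpace ℝ K] {g : F → K} {V : Set F} {f : E → F} {U : Set E}
    (hg : SmoothOn g V) (hf : SmoothOn f U) (hV : IsOpen V) (hfV : MapsTo f U V) :
    SmoothOn (fun x => g (f x)) U := fun n => (hg n).comp (hf n) hV hfV

theorem add {f g : E → F} {U : Set E} (hf : SmoothOn f U) (hg : SmoothOn g U) :
    SmoothOn (fun x => f x + g x) U := fun n => (hf n).add (hg n)

theorem const_smul {f : E → F} {U : Set E} (hf : SmoothOn f U) (c : ℝ) :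
    SmoothOn (fun x => c • f x) U := hf.clm_comp (c • ContinuousLinearMap.id ℝ F)

theorem sub {f g : E → F} {U : Set E} (hf : SmoothOn f U) (hg : SmoothOn g U) :
    SmoothOn (fun x => f x - g x) U :=
  (hf.prodMk hg).clm_comp (ContinuousLinearMap.fst ℝ F F - ContinuousLinearMap.snd ℝ F F)

theorem sum {ι : Type*} (s : Finset ι) {f : ι → E → F} {U : Set E}
    (hf : ∀ i ∈ s, SmoothOn (f i) U) : SmoothOn (fun x => ∑ i ∈ s, f i x) U := by
  classical
  induction s using Finset.induction_on with
  | empty => simpa using const (0 : F) U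
  | insert a s ha ih =>
    simp only [Finset.sum_insert ha]
    exact (hf a (by simp)).add (ih fun i hi => hf i (by simp [hi]))

theorem mul {A : Type w} [Ring A] [Algebra ℝ A] [TopologicalSpace A]
    [IsTopologicalAddGroup A] [ContinuousSMul ℝ A] [ContinuousMul A] [LocallyConvexSpace ℝ A]
    {f g : E → A} {U : Set E} (hf : SmoothOn f U) (hg : SmoothOn g U) :
    SmoothOn (fun x => f x * g x) U :=
  SmoothOn.comp (g := fun p : A × A => p.1 * p.2) (V := univ) (fun _ => ckOn_mul univ)
    (hf.prodMk hg) isOpen_univ (mapsTo_univ _ _)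

variable [T2Space F] {f : E → F} {U : Set E}

theorem hasDirDeriv (h : SmoothOn f U) {x : E} (hx : x ∈ U) (v : E) :
    HasDirDeriv f x v (dirDeriv f x v) := (h 1).hasDirDeriv hx v

theorem dirDeriv (h : SmoothOn f U) (hU : IsOpen U) :
    SmoothOn (fun p : E × E => dirDeriv f p.1 p.2) (U ×ˢ univ) := fun n => (h (n + 1)).dirDeriv hU

variable [LocallyConvexSpace ℝ F]

theorem dirDeriv_add (h : SmoothOn f U) (hU : IsOpen U) {x : E} (hx : x ∈ U) (v w : E) :
    FrechetCW.dirDeriv f x (v + w) = FrechetCW.dirDeriv f x v + FrechetCW.dirDeriv f x w :=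
  (hasDirDeriv_add_dir hU (f' := fun p => FrechetCW.dirDeriv f p.1 p.2)
    (fun _ hy v => h.hasDirDeriv hy v) (h.dirDeriv hU).continuousOn hx v w).dirDeriv_eq

theorem dirDeriv_smul (h : SmoothOn f U) {x : E} (hx : x ∈ U) (c : ℝ) (v : E) :
    FrechetCW.dirDeriv f x (c • v) = c • FrechetCW.dirDeriv f x v :=
  ((h.hasDirDeriv hx v).smul_dir c).dirDeriv_eq

theorem continuous_dirDeriv (h : SmoothOn f U) (hU : IsOpen U) {x : E} (hx : x ∈ U) :
    Continuous (FrechetCW.dirDeriv f x) := by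
  have h1 : ContinuousOn (fun p : E × E => FrechetCW.dirDeriv f p.1 p.2) (U ×ˢ univ) :=
    (h.dirDeriv hU).continuousOn
  have h2 : Continuous fun v : E => (x, v) := by fun_prop
  have h3 := h1.comp_continuous h2 fun v => ⟨hx, mem_univ _⟩
  exact h3

/-- The derivative of a smooth map as a continuous linear map. -/
def fderivL (h : SmoothOn f U) (hU : IsOpen U) {x : E} (hx : x ∈ U) : E →L[ℝ] F :=
  ⟨⟨⟨FrechetCW.dirDeriv f x, h.dirDeriv_add hU hx⟩, fun c v => h.dirDeriv_smul hx c v⟩,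
    h.continuous_dirDeriv hU hx⟩

theorem dirDeriv_comp {g : K → E} {x v : K} {a : E} (h : SmoothOn f U) (hU : IsOpen U)
    (hg : HasDirDeriv g x v a) (hx : g x ∈ U) :
    HasDirDeriv (fun y => f (g y)) x v (FrechetCW.dirDeriv f (g x) a) :=
  hg.comp hU (g' := fun p => FrechetCW.dirDeriv f p.1 p.2) (fun _ hy v => h.hasDirDeriv hy v)
    (h.dirDeriv hU).continuousOn hx

/-- Second derivatives are symmetric. -/
theorem dirDeriv_symm (h : SmoothOn f U) (hU : IsOpen U) {x : E} (hx : x ∈ U) (v w : E) :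
    FrechetCW.dirDeriv (fun y => FrechetCW.dirDeriv f y v) x w =
      FrechetCW.dirDeriv (fun y => FrechetCW.dirDeriv f y w) x v := by
  have hU2 : IsOpen (U ×ˢ (univ : Set E)) := hU.prod isOpen_univ
  have h1 := h.dirDeriv hU
  -- With the inner direction frozen, the iterated derivative is the derivative of `(x, v) ↦ Df(x)
  -- v` in a direction whose second component is zero.
  have key : ∀ v w : E, FrechetCW.dirDeriv (fun y => FrechetCW.dirDeriv f y v) x w =
      FrechetCW.dirDeriv (fun p : E × E => FrechetCW.dirDeriv f p.1 p.2) (x, v) (w, 0) := by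
    intro v w
    refine HasDirDeriv.dirDeriv_eq (Tendsto.congr (fun t => ?_)
      (h1.hasDirDeriv (show (x, v) ∈ U ×ˢ univ from ⟨hx, mem_univ _⟩) (w, 0)))
    simp
  rw [key, key]
  exact second_dirDeriv_symm hU (f' := fun p => FrechetCW.dirDeriv f p.1 p.2)
    (f'' := fun q => FrechetCW.dirDeriv (fun p : E × E => FrechetCW.dirDeriv f p.1 p.2) q.1 q.2)
    (fun _ hy v => h.hasDirDeriv hy v) (fun _ hy v => h1.hasDirDeriv hy v)
    (h1.dirDeriv hU2).continuousOn hx v w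

end SmoothOn

section Product

variable {A : Type w} [Ring A] [Algebra ℝ A] [TopologicalSpace A]
  [IsTopologicalAddGroup A] [ContinuousSMul ℝ A] [ContinuousMul A] [LocallyConvexSpace ℝ A]

/-- The Leibniz rule. -/
theorem HasDirDeriv.mul {f g : E → A} {x v : E} {a b : A} (hf : HasDirDeriv f x v a)
    (hg : HasDirDeriv g x v b) :
    HasDirDeriv (fun y => f y * g y) x v (a * g x + f x * b) := by
  -- Existence of the directional derivative already forces continuity along the line.
  have hgc : Tendsto (fun t : ℝ => g (x + t • v)) (𝓝[≠] 0) (𝓝 (g x)) := by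
    have h1 : Tendsto (fun t : ℝ => t • (t⁻¹ • (g (x + t • v) - g x)) + g x) (𝓝[≠] 0)
        (𝓝 ((0 : ℝ) • b + g x)) :=
      ((tendsto_id.mono_left nhdsWithin_le_nhds).smul hg).add_const _
    rw [zero_smul, zero_add] at h1
    refine h1.congr' ?_
    filter_upwards [self_mem_nhdsWithin] with t ht
    have ht' : t ≠ 0 := ht
    simp [smul_smul, ht']
  refine ((Tendsto.mul hf hgc).add (Tendsto.const_mul (f x) hg)).congr fun t => ?_
  rw [smul_mul_assoc, mul_smul_comm, ← smul_add, sub_mul, mul_sub]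
  congr 1
  abel

end Product

end Smooth

/-! ## Alternating sums -/

section Alternation

variable {H M : Type*} [AddCommGroup M]

/-- The alternating sum over all permutations of the arguments. -/
def altSum {n : ℕ} (F : (Fin n → H) → M) (v : Fin n → H) : M :=
  ∑ σ : Equiv.Perm (Fin n), Equiv.Perm.sign σ • F (fun i => v (σ i))

variable {n : ℕ}

theorem altSum_comp_perm (F : (Fin n → H) → M) (τ : Equiv.Perm (Fin n)) (v : Fin n → H) :
    altSum (fun w => F (fun i => w (τ i))) v = Equiv.Perm.sign τ • altSum F v := by
  unfold altSum
  rw [Finset.smul_sum, ← Equiv.sum_comp (Equiv.mulRight τ)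
    (fun σ => Equiv.Perm.sign τ • Equiv.Perm.sign σ • F (fun i => v (σ i)))]
  refine Finset.sum_congr rfl fun σ _ => ?_
  rw [Equiv.coe_mulRight, Equiv.Perm.sign_mul, smul_smul, mul_comm, mul_assoc,
    Int.units_mul_self, mul_one]
  rfl

theorem altSum_add (F G : (Fin n → H) → M) (v : Fin n → H) :
    altSum (fun w => F w + G w) v = altSum F v + altSum G v := by
  simp [altSum, smul_add, Finset.sum_add_distrib]

theorem altSum_sub (F G : (Fin n → H) → M) (v : Fin n → H) :
    altSum (fun w => F w - G w) v = altSum F v - altSum G v := by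
  simp [altSum, smul_sub, Finset.sum_sub_distrib]

theorem altSum_zero (v : Fin n → H) : altSum (fun _ => (0 : M)) v = 0 := by
  simp [altSum]

theorem altSum_nsmul (m : ℕ) (F : (Fin n → H) → M) (v : Fin n → H) :
    altSum (fun w => m • F w) v = m • altSum F v := by
  simp only [altSum, Finset.smul_sum]
  exact Finset.sum_congr rfl fun σ _ => smul_comm _ _ _

theorem altSum_sum {T : Type*} (s : Finset T) (F : T → (Fin n → H) → M) (v : Fin n → H) :
    altSum (fun w => ∑ τ ∈ s, F τ w) v = ∑ τ ∈ s, altSum (F τ) v := by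
  simp only [altSum, Finset.smul_sum]
  exact Finset.sum_comm

theorem map_altSum {N : Type*} [AddCommGroup N] (f : M →+ N) (F : (Fin n → H) → M) (v : Fin n → H) :
    f (altSum F v) = altSum (fun w => f (F w)) v := by
  simp only [altSum, map_sum]
  refine Finset.sum_congr rfl fun σ _ => ?_
  rcases Int.units_eq_one_or (Equiv.Perm.sign σ) with h | h <;> simp [h]

/-- Partial antisymmetrization is absorbed by the full one. -/
theorem altSum_partial {T : Type*} [Fintype T] (e : T → Equiv.Perm (Fin n))
    (F : (Fin n → H) → M) (v : Fin n → H) :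
    altSum (fun w => ∑ τ, Equiv.Perm.sign (e τ) • F (fun i => w (e τ i))) v =
      Fintype.card T • altSum F v := by
  rw [altSum_sum, ← Finset.card_univ, ← Finset.sum_const]
  refine Finset.sum_congr rfl fun τ _ => ?_
  have : altSum (fun w => Equiv.Perm.sign (e τ) • F (fun i => w (e τ i))) v =
      Equiv.Perm.sign (e τ) • altSum (fun w => F (fun i => w (e τ i))) v := by
    simp only [altSum, Finset.smul_sum]
    exact Finset.sum_congr rfl fun σ _ => smul_comm _ _ _
  rw [this, altSum_comp_perm, smul_smul, Int.units_mul_self, one_smul]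

theorem eq_of_nsmul_eq [Module ℝ M] {m : ℕ} (hm : m ≠ 0) {a b : M} (h : m • a = m • b) :
    a = b := by
  rw [← Nat.cast_smul_eq_nsmul ℝ, ← Nat.cast_smul_eq_nsmul ℝ] at h
  have := congrArg (fun x => (m : ℝ)⁻¹ • x) h
  simpa [smul_smul, Nat.cast_ne_zero.2 hm] using this

/-- Averaging over `1, σ, σ²`, all even, multiplies the alternating sum by three by
`altSum_partial`, while the averaged function is zero. -/
theorem altSum_eq_zero_of_cyclic [Module ℝ M] (F : (Fin n → H) → M) (σ : Equiv.Perm (Fin n))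
    (hσ : Equiv.Perm.sign σ = 1)
    (h : ∀ v, F v + F (fun i => v (σ i)) + F (fun i => v (σ (σ i))) = 0) (v : Fin n → H) :
    altSum F v = 0 := by
  have h1 := altSum_partial (fun j : Fin 3 => σ ^ (j : ℕ)) F v
  rw [Fintype.card_fin] at h1
  refine eq_of_nsmul_eq (m := 3) (by norm_num) ?_
  rw [← h1, smul_zero, ← altSum_zero v]
  congr 1
  ext w
  rw [Fin.sum_univ_three]
  simpa [hσ, pow_two] using h w

theorem units_neg_one_pow_smul [Module ℝ M] (j : ℕ) (a : M) :
    ((-1 : ℤˣ) ^ j) • a = (-1 : ℝ) ^ j • a := by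
  rcases neg_one_pow_eq_or ℝ j with h | h
  · have h' : Even j := by
      by_contra hc
      rw [(Nat.not_even_iff_odd.1 hc).neg_one_pow] at h
      norm_num at h
    rw [h'.neg_one_pow, h'.neg_one_pow, one_smul, one_smul]
  · have h' : Odd j := by
      by_contra hc
      rw [(Nat.not_odd_iff_even.1 hc).neg_one_pow] at h
      norm_num at h
    rw [h'.neg_one_pow, h'.neg_one_pow, neg_smul, Units.neg_smul, one_smul, one_smul]

/-- Extension of a permutation of the last `n` among `n + 1` indices, followed by the cycle that
moves `0` to `i`. -/
def consPerm (p : Fin (n + 1) × Equiv.Perm (Fin n)) : Equiv.Perm (Fin (n + 1)) :=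
  p.1.cycleRange.symm * Equiv.Perm.decomposeFin.symm (0, p.2)

theorem consPerm_zero (p : Fin (n + 1) × Equiv.Perm (Fin n)) : consPerm p 0 = p.1 := by
  simp [consPerm]

theorem consPerm_succ (p : Fin (n + 1) × Equiv.Perm (Fin n)) (j : Fin n) :
    consPerm p j.succ = p.1.succAbove (p.2 j) := by
  simp [consPerm]

theorem sign_consPerm (p : Fin (n + 1) × Equiv.Perm (Fin n)) :
    Equiv.Perm.sign (consPerm p) = (-1) ^ (p.1 : ℕ) * Equiv.Perm.sign p.2 := by
  simp [consPerm, Equiv.Perm.sign_mul, Equiv.Perm.sign_symm]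

/-- The image of `0` recovers `i`, injectivity of `succAbove` recovers the remaining permutation,
and `(n + 1)! = (n + 1) * n !`. -/
theorem consPerm_bijective : Function.Bijective (consPerm (n := n)) := by
  rw [Fintype.bijective_iff_injective_and_card]
  constructor
  · rintro ⟨i, σ⟩ ⟨j, τ⟩ h
    have h0 : i = j := by
      have := congrArg (fun e : Equiv.Perm (Fin (n + 1)) => e 0) h
      simpa [consPerm_zero] using this
    subst h0
    have h1 : σ = τ := by
      ext l
      have := congrArg (fun e : Equiv.Perm (Fin (n + 1)) => e l.succ) h
      simp only [consPerm_succ] at this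
      rw [Fin.succAbove_right_injective this]
    rw [h1]
  · simp [Fintype.card_perm, Nat.factorial_succ]

/-- Alternating sums in `n + 1` arguments by expansion along the first argument. -/
theorem sum_altSum_removeNth [Module ℝ M] (G : H → (Fin n → H) → M) (v : Fin (n + 1) → H) :
    ∑ i : Fin (n + 1), (-1 : ℝ) ^ (i : ℕ) • altSum (G (v i)) (i.removeNth v) =
      altSum (fun w : Fin (n + 1) → H => G (w 0) (fun j => w j.succ)) v := by
  rw [altSum, ← Equiv.sum_comp (Equiv.ofBijective _ consPerm_bijective), Fintype.sum_prod_type]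
  refine Finset.sum_congr rfl fun i _ => ?_
  rw [← units_neg_one_pow_smul, altSum, Finset.smul_sum]
  refine Finset.sum_congr rfl fun σ _ => ?_
  simp only [Equiv.ofBijective_apply, consPerm_zero, consPerm_succ, sign_consPerm, smul_smul]
  rfl

end Alternation

/-! ## Products of forms -/

section Products

variable {H A : Type*} [Ring A]

/-- The product of two functions of `p` and `q` arguments, without antisymmetrization. -/
def prodForm {p q : ℕ} (α : (Fin p → H) → A) (β : (Fin q → H) → A) (v : Fin (p + q) → H) : A :=
  α (fun i => v (Fin.castAdd q i)) * β (fun j => v (Fin.natAdd p j))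

/-- The permutation of the first `p` among `p + q` indices. -/
def leftPerm {p : ℕ} (q : ℕ) (τ : Equiv.Perm (Fin p)) : Equiv.Perm (Fin (p + q)) :=
  finSumFinEquiv.permCongr (Equiv.sumCongr τ 1)

theorem leftPerm_castAdd {p q : ℕ} (τ : Equiv.Perm (Fin p)) (i : Fin p) :
    leftPerm q τ (Fin.castAdd q i) = Fin.castAdd q (τ i) := by
  simp [leftPerm, Equiv.permCongr_apply]

theorem leftPerm_natAdd {p q : ℕ} (τ : Equiv.Perm (Fin p)) (j : Fin q) :
    leftPerm q τ (Fin.natAdd p j) = Fin.natAdd p j := by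
  simp [leftPerm, Equiv.permCongr_apply]

theorem sign_leftPerm {p q : ℕ} (τ : Equiv.Perm (Fin p)) :
    Equiv.Perm.sign (leftPerm q τ) = Equiv.Perm.sign τ := by
  rw [leftPerm, Equiv.Perm.sign_permCongr]
  exact (Equiv.Perm.sign_sumCongr τ 1).trans (by simp)

theorem altSum_prodForm_altSum {p q : ℕ} (α : (Fin p → H) → A) (β : (Fin q → H) → A)
    (v : Fin (p + q) → H) :
    altSum (prodForm (altSum α) β) v = p ! • altSum (prodForm α β) v := by
  have h := altSum_partial (leftPerm (p := p) q) (prodForm α β) v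
  rw [Fintype.card_perm, Fintype.card_fin] at h
  rw [← h]
  congr 1
  ext w
  simp only [prodForm, leftPerm_castAdd, leftPerm_natAdd, sign_leftPerm, altSum,
    Finset.sum_mul, smul_mul_assoc]

/-- By `altSum_prodForm_altSum`, `p !` times either side sees the left factor only through its
antisymmetrization. This lets inductions over products proceed without tracking permutations. -/
theorem altSum_prodForm_congr [Module ℝ A] {p q : ℕ} {α α' : (Fin p → H) → A}
    (h : ∀ v, altSum α v = altSum α' v) (β : (Fin q → H) → A) (v : Fin (p + q) → H) :
    altSum (prodForm α β) v = altSum (prodForm α' β) v := by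
  refine eq_of_nsmul_eq (Nat.factorial_ne_zero p) ?_
  rw [← altSum_prodForm_altSum, ← altSum_prodForm_altSum, funext h]

theorem altSum_prodForm_eq_zero [Module ℝ A] {p q : ℕ} {α : (Fin p → H) → A}
    (h : ∀ v, altSum α v = 0) (β : (Fin q → H) → A) (v : Fin (p + q) → H) :
    altSum (prodForm α β) v = 0 := by
  rw [altSum_prodForm_congr (α' := fun _ => 0) (fun v => by rw [h, altSum_zero])]
  simp [prodForm, altSum]

/-- The products `R (v 0, v 1) * R (v 2, v 3) * ⋯`. -/
def prodPow (R : (Fin 2 → H) → A) : (k : ℕ) → (Fin (2 * k) → H) → A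
  | 0 => fun _ => 1
  | k + 1 => prodForm (prodPow R k) R

theorem map_prodPow {A' : Type*} [Ring A'] (f : A →+* A') (R : (Fin 2 → H) → A) (k : ℕ)
    (v : Fin (2 * k) → H) : f (prodPow R k v) = prodPow (fun w => f (R w)) k v := by
  induction k with
  | zero => simp [prodPow]
  | succ k ih =>
    change f (_ * _) = _ * _
    rw [map_mul, ih]

/-- The formal derivative of `prodPow R k` when `Y` is the derivative of `R`. -/
def prodPowDeriv (R Y : (Fin 2 → H) → A) : (k : ℕ) → (Fin (2 * k) → H) → A
  | 0 => fun _ => 0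
  | k + 1 => fun v => prodForm (prodPowDeriv R Y k) R v + prodForm (prodPow R k) Y v

theorem deriv_prodPow {A' : Type*} [Ring A'] (f : A →+* A') (δ : A →+ A')
    (hδ : ∀ s t, δ (s * t) = δ s * f t + f s * δ t) (R : (Fin 2 → H) → A) (k : ℕ)
    (v : Fin (2 * k) → H) :
    δ (prodPow R k v) = prodPowDeriv (fun w => f (R w)) (fun w => δ (R w)) k v := by
  induction k with
  | zero =>
    -- A derivation kills `1`, by the Leibniz rule for `1 * 1`.
    have h := hδ 1 1
    simp only [mul_one, map_one, one_mul] at h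
    exact left_eq_add.1 h
  | succ k ih =>
    change δ (_ * _) = _ * _ + _ * _
    rw [hδ, ih, map_prodPow]
    rfl

/-- Exchanging the two arguments of the differentiated factor is an odd permutation, so both halves
of `Y` contribute equally. This is the source of the factor `2` in the transgression formula. -/
theorem altSum_prodPowDeriv_antisymm [Module ℝ A] (R Y Z : (Fin 2 → H) → A)
    (hY : ∀ a b, Y ![a, b] = Z ![a, b] - Z ![b, a]) (k : ℕ) (v : Fin (2 * k) → H) :
    altSum (prodPowDeriv R Y k) v = 2 • altSum (prodPowDeriv R Z k) v := by
  induction k with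
  | zero => simp [prodPowDeriv, altSum]
  | succ k ih =>
    have h1 : ∀ v, altSum (prodForm (prodPowDeriv R Y k) R) v =
        2 • altSum (prodForm (prodPowDeriv R Z k) R) v := by
      intro v
      rw [altSum_prodForm_congr (α' := fun w => 2 • prodPowDeriv R Z k w)
        (fun w => by rw [ih, altSum_nsmul]), ← altSum_nsmul]
      congr 1
      ext w
      simp only [prodForm, smul_mul_assoc]
    have h2 : ∀ v, altSum (prodForm (prodPow R k) Y) v =
        2 • altSum (prodForm (prodPow R k) Z) v := by
      intro v
      set τ : Equiv.Perm (Fin (2 * k + 2)) :=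
        Equiv.swap (Fin.natAdd (2 * k) 0) (Fin.natAdd (2 * k) 1) with hτ
      have hs : Equiv.Perm.sign τ = -1 := Equiv.Perm.sign_swap (by simp [Fin.ext_iff])
      have h3 := altSum_comp_perm (prodForm (prodPow R k) Z) τ v
      rw [hs, Units.neg_smul, one_smul] at h3
      rw [two_smul, ← sub_neg_eq_add, ← h3, ← altSum_sub]
      congr 1
      ext w
      have e1 : (fun j : Fin 2 => w (Fin.natAdd (2 * k) j)) =
          ![w (Fin.natAdd (2 * k) 0), w (Fin.natAdd (2 * k) 1)] := by
        ext j; fin_cases j <;> rfl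
      have e2 : ∀ i : Fin (2 * k), τ (Fin.castAdd 2 i) = Fin.castAdd 2 i := by
        intro i
        refine Equiv.swap_apply_of_ne_of_ne ?_ ?_ <;>
          simp [Fin.ext_iff] <;> omega
      have e3 : τ (Fin.natAdd (2 * k) 0) = Fin.natAdd (2 * k) 1 := Equiv.swap_apply_left _ _
      have e4 : τ (Fin.natAdd (2 * k) 1) = Fin.natAdd (2 * k) 0 := Equiv.swap_apply_right _ _
      have e5 : (fun j : Fin 2 => w (τ (Fin.natAdd (2 * k) j))) =
          ![w (Fin.natAdd (2 * k) 1), w (Fin.natAdd (2 * k) 0)] := by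
        ext j
        fin_cases j
        exacts [congrArg w e3, congrArg w e4]
      simp only [prodForm, e1, e2, e5]
      rw [hY, mul_sub]
    change altSum (fun w => prodForm (prodPowDeriv R Y k) R w + prodForm (prodPow R k) Y w) v =
      2 • altSum (fun w => prodForm (prodPowDeriv R Z k) R w + prodForm (prodPow R k) Z w) v
    rw [altSum_add, altSum_add, h1, h2, smul_add]

/-- The sum of the products `R ⋯ R η R ⋯ R` with `k` factors `R`. -/
def transProd (R : (Fin 2 → H) → A) (η : H → A) : (k : ℕ) → (Fin (2 * k + 1) → H) → A
  | 0 => fun v => η (v 0)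
  | k + 1 => fun v => prodForm (p := 2 * k + 1) (q := 2) (transProd R η k) R v +
      prodForm (p := 2 * (k + 1)) (q := 1) (prodPow R (k + 1)) (fun w => η (w 0)) v

theorem map_transProd {A' : Type*} [Ring A'] (f : A →+* A') (R : (Fin 2 → H) → A) (η : H → A)
    (k : ℕ) (v : Fin (2 * k + 1) → H) :
    f (transProd R η k v) = transProd (fun w => f (R w)) (fun u => f (η u)) k v := by
  induction k with
  | zero => rfl
  | succ k ih =>
    change f (_ * _ + _ * _) = _ * _ + _ * _
    rw [map_add, map_mul, map_mul, ih, map_prodPow]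

end Products

/-! ## Derivations that satisfy the Bianchi identity -/

section Bianchi

variable {H A A' : Type*} [Ring A] [Ring A'] [Module ℝ A']
  {f : A →+* A'} {δ : H → A →+ A'} {R : (Fin 2 → H) → A}

/-- The 3-cycle through the direction of differentiation and the two arguments of `R` is even and
fixes the arguments of `X`; the sum over its powers is `X` times a Bianchi sum. -/
theorem altSum_mul_bianchi
    (hB : ∀ u v w, δ u (R ![v, w]) + δ v (R ![w, u]) + δ w (R ![u, v]) = 0) {n : ℕ}
    (X : (Fin n → H) → A') (v : Fin (n + 2 + 1) → H) :
    altSum (fun v : Fin (n + 2 + 1) → H => X (fun i => v (Fin.castAdd 2 i).succ) *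
      δ (v 0) (R (fun j => v (Fin.natAdd n j).succ))) v = 0 := by
  set a : Fin (n + 2 + 1) := 0 with ha
  set b : Fin (n + 2 + 1) := (Fin.natAdd n 0).succ with hb
  set c : Fin (n + 2 + 1) := (Fin.natAdd n 1).succ with hc
  have hab : a ≠ b := by simp [a, b, Fin.ext_iff]
  have hac : a ≠ c := by simp [a, c, Fin.ext_iff]
  have hbc : b ≠ c := by simp [b, c, Fin.ext_iff]
  set σ : Equiv.Perm (Fin (n + 2 + 1)) := Equiv.swap a b * Equiv.swap b c with hσ
  have hsign : Equiv.Perm.sign σ = 1 := by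
    rw [hσ, Equiv.Perm.sign_mul, Equiv.Perm.sign_swap hab, Equiv.Perm.sign_swap hbc]; rfl
  have sa : σ a = b := by
    rw [hσ, Equiv.Perm.mul_apply, Equiv.swap_apply_of_ne_of_ne hab hac, Equiv.swap_apply_left]
  have sb : σ b = c := by
    rw [hσ, Equiv.Perm.mul_apply, Equiv.swap_apply_left,
      Equiv.swap_apply_of_ne_of_ne hac.symm hbc.symm]
  have sc : σ c = a := by
    rw [hσ, Equiv.Perm.mul_apply, Equiv.swap_apply_right, Equiv.swap_apply_right]
  have sd : ∀ i : Fin n, σ (Fin.castAdd 2 i).succ = (Fin.castAdd 2 i).succ := by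
    intro i
    have h1 : (Fin.castAdd 2 i).succ ≠ a := by simp [a, Fin.ext_iff]
    have h2 : (Fin.castAdd 2 i).succ ≠ b := by
      simp only [b, ne_eq, Fin.ext_iff, Fin.val_succ, Fin.val_castAdd, Fin.val_natAdd]; omega
    have h3 : (Fin.castAdd 2 i).succ ≠ c := by
      simp only [c, ne_eq, Fin.ext_iff, Fin.val_succ, Fin.val_castAdd, Fin.val_natAdd]; omega
    rw [hσ, Equiv.Perm.mul_apply, Equiv.swap_apply_of_ne_of_ne h2 h3,
      Equiv.swap_apply_of_ne_of_ne h1 h2]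
  refine altSum_eq_zero_of_cyclic _ σ hsign (fun w => ?_) v
  have e1 : ∀ w : Fin (n + 2 + 1) → H, (fun j : Fin 2 => w (Fin.natAdd n j).succ) =
      ![w b, w c] := by
    intro w; ext j; fin_cases j <;> rfl
  rw [e1, e1 (fun i => w (σ i)), e1 (fun i => w (σ (σ i)))]
  simp only [sa, sb, sc, sd]
  rw [← mul_add, ← mul_add, hB, mul_zero]

/-- By Leibniz the derivative falls on the last factor, where `altSum_mul_bianchi` applies, or on
the preceding ones, where the induction hypothesis survives multiplication by the last factor. -/
theorem altSum_deriv_prodPow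
    (hδ : ∀ u s t, δ u (s * t) = δ u s * f t + f s * δ u t)
    (hB : ∀ u v w, δ u (R ![v, w]) + δ v (R ![w, u]) + δ w (R ![u, v]) = 0)
    (k : ℕ) (v : Fin (2 * k + 1) → H) :
    altSum (fun v : Fin (2 * k + 1) → H => δ (v 0) (prodPow R k (fun i => v i.succ))) v = 0 := by
  induction k with
  | zero =>
    have h1 : ∀ u, δ u (1 : A) = 0 := fun u => by
      have h := hδ u 1 1
      simp only [mul_one, map_one, one_mul] at h
      exact left_eq_add.1 h
    simp [prodPow, h1, altSum]
  | succ k ih =>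
    have h1 : (fun v : Fin (2 * (k + 1) + 1) → H =>
        δ (v 0) (prodPow R (k + 1) (fun i => v i.succ))) = fun v : Fin (2 * k + 1 + 2) → H =>
        prodForm (p := 2 * k + 1) (q := 2)
          (fun v : Fin (2 * k + 1) → H => δ (v 0) (prodPow R k (fun i => v i.succ)))
          (fun w => f (R w)) v +
        (fun v : Fin (2 * k + 2 + 1) → H => f (prodPow R k (fun i => v (Fin.castAdd 2 i).succ)) *
          δ (v 0) (R (fun j => v (Fin.natAdd (2 * k) j).succ))) v := by
      ext v
      refine (hδ _ _ _).trans (congrArg₂ (· + ·) (congrArg₂ (· * ·) rfl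
        (congrArg (fun w => f (R w)) (funext fun j => congrArg v (Fin.ext ?_)))) rfl)
      simp only [Fin.val_succ, Fin.val_natAdd]
      have h0 : Nat.mul 2 k = 2 * k := rfl
      omega
    rw [h1]
    refine (altSum_add (n := 2 * k + 1 + 2) _ _ v).trans ?_
    rw [altSum_prodForm_eq_zero ih, zero_add]
    exact altSum_mul_bianchi (n := 2 * k) hB (fun w => f (prodPow R k w)) v

/-- Every term in which a factor `R` is differentiated dies by Bianchi. What remains has `η`
differentiated, and bringing the direction of differentiation next to the argument of `η` passes an
even number of arguments, hence costs no sign. -/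
theorem altSum_deriv_transProd
    (hδ : ∀ u s t, δ u (s * t) = δ u s * f t + f s * δ u t)
    (hB : ∀ u v w, δ u (R ![v, w]) + δ v (R ![w, u]) + δ w (R ![u, v]) = 0)
    (η : H → A) (k : ℕ) (v : Fin (2 * k + 1 + 1) → H) :
    altSum (fun v : Fin (2 * k + 1 + 1) → H =>
        δ (v 0) (transProd R η k (fun i => v i.succ))) v =
      altSum (prodPowDeriv (fun w => f (R w)) (fun w => δ (w 0) (η (w 1))) (k + 1)) v := by
  induction k with
  | zero =>
    congr 1
    ext w
    simp [transProd, prodPowDeriv, prodForm, prodPow]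
  | succ k ih =>
    -- Besides `E`, these are the Leibniz terms: `X1` and `Y` have the derivative before,
    -- respectively on, a final factor `R`; `X3` and `W` have it before, respectively on, a final
    -- factor `η`.
    set E : (Fin 2 → H) → A' := fun w => δ (w 0) (η (w 1)) with hE
    set X1 : (Fin (2 * k + 1 + 1) → H) → A' :=
      fun v => δ (v 0) (transProd R η k (fun i => v i.succ)) with hX1
    set X3 : (Fin (2 * (k + 1) + 1) → H) → A' :=
      fun v => δ (v 0) (prodPow R (k + 1) (fun i => v i.succ)) with hX3
    set Y : (Fin (2 * k + 1 + 2 + 1) → H) → A' :=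
      fun v => f (transProd R η k (fun i => v (Fin.castAdd 2 i).succ)) *
        δ (v 0) (R (fun j => v (Fin.natAdd (2 * k + 1) j).succ)) with hY
    set W : (Fin (2 * (k + 1) + 1 + 1) → H) → A' :=
      fun v => f (prodPow R (k + 1) (fun i => v (Fin.castAdd 1 i).succ)) *
        δ (v 0) (η (v (Fin.last _))) with hW
    have h1 : (fun v : Fin (2 * (k + 1) + 1 + 1) → H =>
        δ (v 0) (transProd R η (k + 1) (fun i => v i.succ))) =
        fun v : Fin (2 * (k + 1) + 2) → H =>
        (prodForm (p := 2 * k + 1 + 1) (q := 2) X1 (fun w => f (R w)) v + Y v) +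
        (prodForm (p := 2 * (k + 1) + 1) (q := 1) X3 (fun w => f (η (w 0))) v + W v) := by
      ext v
      refine (map_add _ _ _).trans (congrArg₂ (· + ·) ?_ ?_)
      · refine (hδ _ _ _).trans (congrArg₂ (· + ·) (congrArg₂ (· * ·) rfl
          (congrArg (fun w => f (R w)) (funext fun j => congrArg v (Fin.ext ?_)))) rfl)
        simp only [Fin.val_succ, Fin.val_natAdd]
        omega
      · refine (hδ _ _ _).trans (congrArg₂ (· + ·) (congrArg₂ (· * ·) rfl
          (congrArg (fun w => f (η w)) (congrArg v (Fin.ext ?_)))) (congrArg₂ (· * ·) rfl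
          (congrArg (fun w => δ (v 0) (η w)) (congrArg v (Fin.ext ?_)))))
        · simp only [Fin.val_succ, Fin.val_natAdd]
          omega
        · simp [Fin.val_succ, Fin.val_natAdd]
    have hσ : ∀ v, altSum W v =
        altSum (prodForm (p := 2 * (k + 1)) (q := 2)
          (prodPow (fun w => f (R w)) (k + 1)) E) v := by
      intro v
      -- The cycle on the indices `0, …, 2 * (k + 1)` has odd length, so it is even.
      set c : Fin (2 * (k + 1) + 1 + 1) := ⟨2 * (k + 1), by omega⟩ with hc
      have hs : Equiv.Perm.sign c.cycleRange = 1 := by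
        rw [Fin.sign_cycleRange]
        exact (even_two_mul (k + 1)).neg_one_pow
      have h2 := altSum_comp_perm (prodForm (p := 2 * (k + 1)) (q := 2)
          (prodPow (fun w => f (R w)) (k + 1)) E) c.cycleRange v
      rw [hs, one_smul] at h2
      rw [← h2]
      congr 1
      ext w
      simp only [prodForm, hE, hW]
      rw [map_prodPow]
      have e1 : ∀ i : Fin (2 * (k + 1)), c.cycleRange (Fin.castAdd 2 i) =
          (Fin.castAdd 1 i).succ := by
        intro i
        ext
        rw [Fin.coe_cycleRange_of_lt (by rw [Fin.lt_def]; exact i.2)]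
        rfl
      have e2 : c.cycleRange (Fin.natAdd (2 * (k + 1)) (0 : Fin 2)) = 0 := by
        rw [show Fin.natAdd (2 * (k + 1)) (0 : Fin 2) = c from Fin.ext rfl]
        exact Fin.cycleRange_self c
      have e3 : c.cycleRange (Fin.natAdd (2 * (k + 1)) (1 : Fin 2)) = Fin.last _ :=
        Fin.cycleRange_of_gt (by rw [Fin.lt_def]; simp [c])
      simp only [e1, e2, e3]
    refine (congrArg (fun F => altSum F v) h1).trans ?_
    refine (altSum_add (n := 2 * (k + 1) + 2) _ _ v).trans ?_
    refine (congrArg₂ (· + ·) (altSum_add (n := 2 * (k + 1) + 2) _ _ v)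
      (altSum_add (n := 2 * (k + 1) + 2) _ _ v)).trans ?_
    have z1 : altSum Y v = 0 :=
      altSum_mul_bianchi (n := 2 * k + 1) hB (fun w => f (transProd R η k w)) v
    have z2 : altSum (prodForm (p := 2 * (k + 1) + 1) (q := 1) X3 (fun w => f (η (w 0)))) v = 0 :=
      altSum_prodForm_eq_zero (altSum_deriv_prodPow hδ hB (k + 1)) _ v
    have z3 := altSum_prodForm_congr (q := 2) ih (fun w => f (R w)) v
    refine (congrArg₂ (· + ·) (congrArg₂ (· + ·) z3 z1) (congrArg₂ (· + ·) z2 (hσ v))).trans ?_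
    rw [add_zero, zero_add]
    exact (altSum_add (n := 2 * (k + 1) + 2) _ _ v).symm

end Bianchi

/-! ## Powers of two-forms -/

section WedgePow

variable {H M : Type*} [AddCommGroup M] [Module ℝ M] {n : ℕ}

theorem altSum_smul (c : ℝ) (F : (Fin n → H) → M) (v : Fin n → H) :
    altSum (fun w => c • F w) v = c • altSum F v :=
  (map_altSum (DistribSMul.toAddMonoidHom M c) F v).symm

variable {A : Type*} [Ring A] [Algebra ℂ A]

theorem wedge_eq_altSum {p q : ℕ} (α : (Fin p → H) → A) (β : (Fin q → H) → A)
    (v : Fin (p + q) → H) :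
    wedge α β v = ((p ! : ℝ) * (q ! : ℝ))⁻¹ • altSum (prodForm α β) v := rfl

/-- Each wedge with a two-form divides by `(2k)! * 2!`; absorbing the inner antisymmetrization gives
back `(2k)!`, which leaves one factor `1 / 2` per step. -/
theorem wedgePow_eq_altSum (R : (Fin 2 → H) → A) (k : ℕ) (v : Fin (2 * k) → H) :
    wedgePow R k v = ((2 : ℝ) ^ k)⁻¹ • altSum (prodPow R k) v := by
  induction k with
  | zero =>
    simp only [wedgePow, prodPow, altSum]
    rw [Finset.sum_eq_single 1 (fun b _ hb => (hb (Subsingleton.elim (α := Equiv.Perm (Fin 0))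
      _ _)).elim) (by simp)]
    simp
  | succ k ih =>
    have h1 : prodForm (wedgePow R k) R =
        fun w => ((2 : ℝ) ^ k)⁻¹ • prodForm (altSum (prodPow R k)) R w := by
      ext w
      simp only [prodForm]
      rw [ih, smul_mul_assoc]
    refine (wedge_eq_altSum (wedgePow R k) R v).trans ?_
    rw [h1, altSum_smul, altSum_prodForm_altSum, ← Nat.cast_smul_eq_nsmul ℝ, smul_smul, smul_smul]
    congr 1
    have : ((2 * k)! : ℝ) ≠ 0 := Nat.cast_ne_zero.2 (Nat.factorial_ne_zero _)
    rw [Nat.factorial_two, pow_succ]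
    field_simp
    norm_num

theorem wedge_one_one (α β : (Fin 1 → H) → A) (v : Fin (1 + 1) → H) :
    wedge α β v = α (fun _ => v 0) * β (fun _ => v 1) - α (fun _ => v 1) * β (fun _ => v 0) := by
  have huniv : (Finset.univ : Finset (Equiv.Perm (Fin (1 + 1)))) =
      {1, Equiv.swap 0 1} := by decide
  have e0 : ∀ i : Fin 1, Fin.castAdd 1 i = (0 : Fin (1 + 1)) := by decide
  have e1 : ∀ i : Fin 1, Fin.natAdd 1 i = (1 : Fin (1 + 1)) := by decide
  unfold wedge
  rw [huniv, Finset.sum_pair (by decide)]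
  have hs : Equiv.Perm.sign (Equiv.swap (0 : Fin (1 + 1)) 1) = -1 :=
    Equiv.Perm.sign_swap (by decide)
  simp only [e0, e1, hs, Equiv.Perm.sign_one, one_smul, Units.neg_smul, Equiv.Perm.one_apply,
    Equiv.swap_apply_left, Equiv.swap_apply_right]
  simp [sub_eq_add_neg]

end WedgePow

/-! ## Multilinearity -/

section Multilinear

variable {H M : Type*} [AddCommGroup H] [Module ℝ H] [AddCommGroup M] [Module ℝ M] {n : ℕ}

/-- `F` is a multilinear function. -/
def IsMultilinear (F : (Fin n → H) → M) : Prop :=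
  ∃ m : MultilinearMap ℝ (fun _ : Fin n => H) M, ∀ v, F v = m v

namespace IsMultilinear

theorem add {F G : (Fin n → H) → M} (hF : IsMultilinear F) (hG : IsMultilinear G) :
    IsMultilinear (fun v => F v + G v) := by
  obtain ⟨a, ha⟩ := hF
  obtain ⟨b, hb⟩ := hG
  exact ⟨a + b, fun v => by simp [ha, hb]⟩

theorem altSum {F : (Fin n → H) → M} (hF : IsMultilinear F) :
    ∃ a : H [⋀^Fin n]→ₗ[ℝ] M, ∀ v, altSum F v = a v := by
  obtain ⟨m, hm⟩ := hF
  refine ⟨MultilinearMap.alternatization m, fun v => ?_⟩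
  rw [MultilinearMap.alternatization_apply]
  simp [FrechetCW.altSum, hm]

theorem prodForm {A : Type*} [Ring A] [Algebra ℝ A] {p q : ℕ} {α : (Fin p → H) → A}
    {β : (Fin q → H) → A} (hα : IsMultilinear α) (hβ : IsMultilinear β) :
    IsMultilinear (prodForm α β) := by
  obtain ⟨a, ha⟩ := hα
  obtain ⟨b, hb⟩ := hβ
  refine ⟨(LinearMap.mul' ℝ A).compMultilinearMap
    ((a.domCoprod b).domDomCongr finSumFinEquiv), fun v => ?_⟩
  simp [FrechetCW.prodForm, ha, hb]

theorem prodPow {A : Type*} [Ring A] [Algebra ℝ A] {R : (Fin 2 → H) → A}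
    (hR : IsMultilinear R) (k : ℕ) : IsMultilinear (prodPow R k) := by
  induction k with
  | zero =>
    exact ⟨MultilinearMap.constOfIsEmpty (ι := Fin 0) ℝ (fun _ => H) 1, fun v => rfl⟩
  | succ k ih => exact ih.prodForm hR

theorem transProd {A : Type*} [Ring A] [Algebra ℝ A] {R : (Fin 2 → H) → A}
    (hR : IsMultilinear R) (η : H →ₗ[ℝ] A) (k : ℕ) : IsMultilinear (transProd R η k) := by
  have h1 : IsMultilinear (fun w : Fin 1 → H => η (w 0)) :=
    ⟨MultilinearMap.ofSubsingleton ℝ H A 0 η, fun v => by simp⟩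
  induction k with
  | zero => exact h1
  | succ k ih =>
    exact (IsMultilinear.prodForm ih hR).add
      (IsMultilinear.prodForm (q := 1) (hR.prodPow (k + 1)) h1)

end IsMultilinear

end Multilinear

/-! ## Quadrature -/

section Quadrature

/-- For the nodes `0, …, N - 1` the Vandermonde matrix is invertible, so weights with the moments
`∫₀¹ tⁿ dt` can be solved for. -/
theorem exists_quadrature_weights (N : ℕ) :
    ∃ w t : Fin N → ℝ, ∀ n < N, ∑ i, w i * t i ^ n = ((n : ℝ) + 1)⁻¹ := by
  let t : Fin N → ℝ := fun i => (i : ℕ)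
  have ht : Function.Injective t := fun i j h => Fin.ext (by simpa [t] using h)
  have hdet : IsUnit (Matrix.vandermonde t).det :=
    isUnit_iff_ne_zero.2 (Matrix.det_vandermonde_ne_zero_iff.2 ht)
  refine ⟨Matrix.vecMul (fun n : Fin N => ((n : ℝ) + 1)⁻¹) (Matrix.vandermonde t)⁻¹, t,
    fun n hn => ?_⟩
  have h1 := Matrix.vecMul_vecMul (fun n : Fin N => ((n : ℝ) + 1)⁻¹) (Matrix.vandermonde t)⁻¹
    (Matrix.vandermonde t)
  rw [Matrix.nonsing_inv_mul _ hdet, Matrix.vecMul_one] at h1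
  exact congrFun h1 ⟨n, hn⟩

open Polynomial

variable {A : Type*} [Ring A] [Algebra ℝ A]

/-- Evaluation of polynomials with coefficients in `A` at real numbers. -/
def evalReal (t : ℝ) : A[X] →+* A :=
  eval₂RingHom' (RingHom.id A) (algebraMap ℝ A t) fun a => (Algebra.commutes t a).symm

theorem evalReal_C (t : ℝ) (a : A) : evalReal t (C a) = a := by
  simp [evalReal, eval₂RingHom']

theorem evalReal_X (t : ℝ) : evalReal t (X : A[X]) = algebraMap ℝ A t := by
  simp [evalReal, eval₂RingHom']

theorem evalReal_eq_sum {p : A[X]} {n : ℕ} (hp : p.natDegree < n) (t : ℝ) :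
    evalReal t p = ∑ i ∈ Finset.range n, t ^ i • p.coeff i := by
  change eval₂ (RingHom.id A) (algebraMap ℝ A t) p = _
  rw [eval₂_eq_sum_range' _ hp]
  refine Finset.sum_congr rfl fun i _ => ?_
  rw [RingHom.id_apply, ← map_pow, ← Algebra.commutes, ← Algebra.smul_def]

/-- The fundamental theorem of calculus for polynomials: the derivative has degree at most `N`, and
the quadrature is exact there. -/
theorem evalReal_one_sub_evalReal_zero {N : ℕ} {w t : Fin (N + 1) → ℝ}
    (hw : ∀ n < N + 1, ∑ i, w i * t i ^ n = ((n : ℝ) + 1)⁻¹) {p : A[X]}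
    (hp : p.natDegree ≤ N + 1) :
    evalReal 1 p - evalReal 0 p = ∑ i, w i • evalReal (t i) (derivative p) := by
  have hd : (derivative p).natDegree < N + 1 :=
    lt_of_le_of_lt (natDegree_derivative_le p) (by omega)
  have h1 : ∀ i, w i • evalReal (t i) (derivative p) =
      ∑ n ∈ Finset.range (N + 1), (w i * t i ^ n) • (p.coeff (n + 1) * ((n : A) + 1)) := by
    intro i
    rw [evalReal_eq_sum hd, Finset.smul_sum]
    exact Finset.sum_congr rfl fun n _ => by rw [coeff_derivative, smul_smul]
  rw [evalReal_eq_sum (Nat.lt_succ_of_le hp), evalReal_eq_sum (Nat.lt_succ_of_le hp),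
    Finset.sum_range_succ', Finset.sum_range_succ' _ (N + 1), Finset.sum_congr rfl fun i _ => h1 i,
    Finset.sum_comm]
  simp only [one_pow, one_smul, pow_succ, mul_zero, zero_smul, Finset.sum_const_zero, pow_zero,
    zero_add, add_sub_cancel_right]
  refine Finset.sum_congr rfl fun n hn => ?_
  rw [← Finset.sum_smul, hw n (Finset.mem_range.1 hn)]
  have h2 : p.coeff (n + 1) * ((n : A) + 1) = ((n : ℝ) + 1) • p.coeff (n + 1) := by
    rw [Algebra.smul_def, Algebra.commutes]
    simp
  have h3 : ((n : ℝ) + 1) ≠ 0 := by positivity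
  simp only [one_mul]
  rw [h2, smul_smul, inv_mul_cancel₀ h3, one_smul]

variable {H : Type*}

/-- The curve `t ↦ R + t Y + t² Z` is made into a polynomial `S` over `A`, so the antisymmetrized
`k`-th power has degree at most `2 * k` and the polynomial quadrature applies to it. -/
theorem altSum_prodPow_sub {k N : ℕ} (hN : 2 * k ≤ N + 1) {w t : Fin (N + 1) → ℝ}
    (hw : ∀ n < N + 1, ∑ i, w i * t i ^ n = ((n : ℝ) + 1)⁻¹)
    (R Y Z : (Fin 2 → H) → A) (v : Fin (2 * k) → H) :
    altSum (prodPow (fun u => R u + Y u + Z u) k) v - altSum (prodPow R k) v =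
      ∑ i, w i • altSum (prodPowDeriv (fun u => R u + t i • Y u + t i ^ 2 • Z u)
        (fun u => Y u + (2 * t i) • Z u) k) v := by
  set S : (Fin 2 → H) → A[X] := fun u => C (R u) + C (Y u) * X + C (Z u) * X ^ 2 with hS
  have hSt : ∀ s u, evalReal s (S u) = R u + s • Y u + s ^ 2 • Z u := by
    intro s u
    simp only [hS, map_add, map_mul, map_pow, evalReal_C, evalReal_X]
    rw [← map_pow, ← Algebra.commutes, ← Algebra.commutes, ← Algebra.smul_def, ← Algebra.smul_def]
  have hSd : ∀ s u, evalReal s (derivative (S u)) = Y u + (2 * s) • Z u := by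
    intro s u
    have h1 : derivative (S u) = C (Y u) + C (Z u) * (X + X) := by
      simp [hS, derivative_mul, pow_two]
    rw [h1, map_add, map_mul, map_add, evalReal_C, evalReal_C, evalReal_X, ← map_add,
      ← Algebra.commutes, ← Algebra.smul_def, two_mul]
  have hdegS : ∀ u, (S u).natDegree ≤ 2 := by
    intro u
    have h1 : (C (Y u) * X).natDegree ≤ 1 := by
      simpa using natDegree_C_mul_X_pow_le (Y u) 1
    have h2 := natDegree_C_mul_X_pow_le (Z u) 2
    refine natDegree_add_le_of_degree_le (natDegree_add_le_of_degree_le ?_ ?_) h2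
    · simp
    · omega
  have hdeg : ∀ k (v : Fin (2 * k) → H), (prodPow S k v).natDegree ≤ 2 * k := by
    intro k
    induction k with
    | zero => intro v; simp [prodPow]
    | succ k ih =>
      intro v
      exact natDegree_mul_le_of_le (ih _) (hdegS _)
  have hdeg2 : (altSum (prodPow S k) v).natDegree ≤ N + 1 := by
    refine natDegree_sum_le_of_forall_le _ _ fun σ _ => ?_
    refine le_trans ?_ ((hdeg k (fun i => v (σ i))).trans hN)
    rcases Int.units_eq_one_or (Equiv.Perm.sign σ) with h | h <;> simp [h]
  have he : ∀ s, evalReal s (altSum (prodPow S k) v) =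
      altSum (prodPow (fun u => R u + s • Y u + s ^ 2 • Z u) k) v := by
    intro s
    refine (map_altSum (M := A[X]) (N := A) (evalReal s).toAddMonoidHom _ v).trans ?_
    congr 1
    ext u
    refine (map_prodPow (evalReal s) S k u).trans ?_
    simp only [hSt]
  have h := evalReal_one_sub_evalReal_zero hw hdeg2
  rw [he, he] at h
  simp only [one_smul, one_pow, zero_smul, add_zero, ne_eq, OfNat.ofNat_ne_zero,
    not_false_eq_true, zero_pow] at h
  rw [h]
  refine Finset.sum_congr rfl fun i _ => ?_
  congr 1
  refine (map_altSum (M := A[X]) (N := A) ((evalReal (t i)).toAddMonoidHom.comp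
    (derivative : A[X] →ₗ[A] A[X]).toAddMonoidHom) _ v).trans ?_
  congr 1
  ext u
  -- Formal differentiation followed by evaluation is a derivation over evaluation.
  refine (deriv_prodPow (evalReal (t i)) ((evalReal (t i)).toAddMonoidHom.comp
    (derivative : A[X] →ₗ[A] A[X]).toAddMonoidHom) ?_ S k u).trans ?_
  · intro p q
    simp [derivative_mul]
  · simp only [hSt]
    congr 1
    ext u
    exact hSd _ _

end Quadrature

end FrechetCW

end

noncomputable section

namespace FrechetCW

open Set Filter
open scoped Topology

set_option linter.unusedSectionVars false

/-! ## Partial derivatives -/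

section Partial

variable {E : Type*} [AddCommGroup E] [Module ℝ E] [TopologicalSpace E]
  [IsTopologicalAddGroup E] [ContinuousSMul ℝ E]
  {K : Type*} [AddCommGroup K] [Module ℝ K] [TopologicalSpace K]
  [IsTopologicalAddGroup K] [ContinuousSMul ℝ K]
  {F : Type*} [AddCommGroup F] [Module ℝ F] [TopologicalSpace F]
  [IsTopologicalAddGroup F] [ContinuousSMul ℝ F]

theorem dirDeriv_partial_fst (f : E × K → F) (x u : E) (k : K) :
    dirDeriv (fun y => f (y, k)) x u = dirDeriv f (x, k) (u, 0) := by
  simp [dirDeriv]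

theorem SmoothOn.comp_of_clm {f : K → F} {U : Set K} (h : SmoothOn f U) (a : E →L[ℝ] K)
    {V : Set E} (hV : ∀ x ∈ V, a x ∈ U) : SmoothOn (fun x => f (a x)) V :=
  (h.comp_clm a).mono hV

theorem SmoothOn.partial_fst [LocallyConvexSpace ℝ F] {f : E × K → F} {U : Set E}
    (hU : IsOpen U) (hf : SmoothOn f (U ×ˢ univ)) (k : K) : SmoothOn (fun x => f (x, k)) U :=
  hf.comp ((SmoothOn.clm (ContinuousLinearMap.id ℝ E) U).prodMk (SmoothOn.const k U))
    (hU.prod isOpen_univ) fun _ hx => ⟨hx, mem_univ _⟩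

end Partial

/-! ## Connections and curvature on open subsets of a Frechet space -/

section Local

variable {H : Type*} [AddCommGroup H] [Module ℝ H] [TopologicalSpace H] [FrechetSpace H]
  {A : Type*} [Ring A] [Algebra ℂ A] [TopologicalSpace A] [FrechetSpace A] [ContinuousMul A]

/-- The ring of smooth functions on `O`. -/
def smoothRing (A : Type*) [Ring A] [Algebra ℂ A] [TopologicalSpace A] [FrechetSpace A]
    [ContinuousMul A] (O : Set H) : Subring (H → A) where
  carrier := {s | SmoothOn s O}
  mul_mem' ha hb := SmoothOn.mul ha hb
  one_mem' := SmoothOn.const 1 O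
  add_mem' ha hb := SmoothOn.add ha hb
  zero_mem' := SmoothOn.const 0 O
  neg_mem' {a} ha := by
    have := SmoothOn.clm_comp ha (-ContinuousLinearMap.id ℝ A)
    exact this

/-- Evaluation at the point `x`. -/
def smoothEval (A : Type*) [Ring A] [Algebra ℂ A] [TopologicalSpace A] [FrechetSpace A]
    [ContinuousMul A] (O : Set H) (x : H) : smoothRing A O →+* A :=
  (Pi.evalRingHom (fun _ : H => A) x).comp (smoothRing A O).subtype

variable {O : Set H} {x : H}

/-- The covariant derivative `s ↦ D_u s + [a, s]` at the point `x`, where `a` is the value of the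
connection form in the direction `u`. -/
def covDeriv (hx : x ∈ O) (a : A) (u : H) : smoothRing A O →+ A where
  toFun s := dirDeriv s.1 x u + (a * s.1 x - s.1 x * a)
  map_zero' := by
    have : dirDeriv (fun _ : H => (0 : A)) x u = 0 := (HasDirDeriv.const 0 x u).dirDeriv_eq
    change dirDeriv (fun _ : H => (0 : A)) x u + (a * 0 - 0 * a) = 0
    simp [this]
  map_add' s t := by
    have : dirDeriv (fun y => s.1 y + t.1 y) x u = dirDeriv s.1 x u + dirDeriv t.1 x u :=
      ((SmoothOn.hasDirDeriv s.2 hx u).add (SmoothOn.hasDirDeriv t.2 hx u)).dirDeriv_eq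
    change dirDeriv (fun y => s.1 y + t.1 y) x u + (a * (s.1 x + t.1 x) - (s.1 x + t.1 x) * a) = _
    rw [this]
    noncomm_ring

theorem covDeriv_mul (hx : x ∈ O) (a : A) (u : H) (s t : smoothRing A O) :
    covDeriv hx a u (s * t) =
      covDeriv hx a u s * smoothEval A O x t + smoothEval A O x s * covDeriv hx a u t := by
  have : dirDeriv (fun y => s.1 y * t.1 y) x u =
      dirDeriv s.1 x u * t.1 x + s.1 x * dirDeriv t.1 x u :=
    ((SmoothOn.hasDirDeriv s.2 hx u).mul (SmoothOn.hasDirDeriv t.2 hx u)).dirDeriv_eq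
  change dirDeriv (fun y => s.1 y * t.1 y) x u + (a * (s.1 x * t.1 x) - (s.1 x * t.1 x) * a) =
    (dirDeriv s.1 x u + (a * s.1 x - s.1 x * a)) * t.1 x +
      s.1 x * (dirDeriv t.1 x u + (a * t.1 x - t.1 x * a))
  rw [this]
  noncomm_ring

/-- The exterior derivative of the one-form `T`. -/
def extD₁ {F : Type*} [AddCommGroup F] [Module ℝ F] [TopologicalSpace F] (T : H × H → F) (x : H)
    (v : Fin 2 → H) : F :=
  dirDeriv (fun y => T (y, v 1)) x (v 0) - dirDeriv (fun y => T (y, v 0)) x (v 1)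

/-- The curvature of the connection form `T`. -/
def curvature (T : H × H → A) (x : H) (v : Fin 2 → H) : A :=
  extD₁ T x v + (T (x, v 0) * T (x, v 1) - T (x, v 1) * T (x, v 0))

variable {T : H × H → A}

/-- A partial derivative of `T` is its total derivative at a point and in a direction that depend
linearly and continuously on the parameters. -/
theorem smoothOn_dirDeriv_partial {F : Type*} [AddCommGroup F] [Module ℝ F] [TopologicalSpace F]
    [FrechetSpace F] {T : H × H → F} (hO : IsOpen O) (hT : SmoothOn T (O ×ˢ univ)) (i j : Fin 2) :
    SmoothOn (fun p : H × (Fin 2 → H) => dirDeriv (fun y => T (y, p.2 i)) p.1 (p.2 j))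
      (O ×ˢ univ) := by
  have h1 := hT.dirDeriv (hO.prod isOpen_univ)
  simp only [dirDeriv_partial_fst]
  let e1 : H × (Fin 2 → H) →L[ℝ] H := ContinuousLinearMap.fst ℝ H (Fin 2 → H)
  let e2 : Fin 2 → (H × (Fin 2 → H) →L[ℝ] H) := fun i =>
    (ContinuousLinearMap.proj (R := ℝ) (φ := fun _ : Fin 2 => H) i).comp
      (ContinuousLinearMap.snd ℝ H (Fin 2 → H))
  exact h1.comp_of_clm ((e1.prod (e2 i)).prod ((e2 j).prod 0)) fun p hp =>
    ⟨⟨hp.1, mem_univ _⟩, mem_univ _⟩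

theorem smoothOn_comp_proj {n : ℕ} {F : Type*} [AddCommGroup F] [Module ℝ F] [TopologicalSpace F]
    [FrechetSpace F] {T : H × H → F} (hT : SmoothOn T (O ×ˢ univ)) (i : Fin n) :
    SmoothOn (fun p : H × (Fin n → H) => T (p.1, p.2 i)) (O ×ˢ univ) :=
  hT.comp_of_clm ((ContinuousLinearMap.fst ℝ H (Fin n → H)).prod
    ((ContinuousLinearMap.proj (R := ℝ) (φ := fun _ : Fin n => H) i).comp
      (ContinuousLinearMap.snd ℝ H (Fin n → H)))) fun _ hp => ⟨hp.1, mem_univ _⟩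

theorem smoothOn_curvature (hO : IsOpen O) (hT : SmoothOn T (O ×ˢ univ)) :
    SmoothOn (fun p : H × (Fin 2 → H) => curvature T p.1 p.2) (O ×ˢ univ) :=
  ((smoothOn_dirDeriv_partial hO hT 1 0).sub (smoothOn_dirDeriv_partial hO hT 0 1)).add
    (((smoothOn_comp_proj hT 0).mul (smoothOn_comp_proj hT 1)).sub
      ((smoothOn_comp_proj hT 1).mul (smoothOn_comp_proj hT 0)))

/-- The curvature on fixed vectors, as a smooth function. -/
def curvatureFun (hO : IsOpen O) (hT : SmoothOn T (O ×ˢ univ)) (v : Fin 2 → H) :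
    smoothRing A O :=
  ⟨fun x => curvature T x v, (smoothOn_curvature hO hT).partial_fst hO v⟩

/-- The Bianchi identity. -/
theorem bianchi (hO : IsOpen O) (hT : SmoothOn T (O ×ˢ univ)) (hx : x ∈ O) (u v w : H) :
    covDeriv hx (T (x, u)) u (curvatureFun hO hT ![v, w]) +
      covDeriv hx (T (x, v)) v (curvatureFun hO hT ![w, u]) +
      covDeriv hx (T (x, w)) w (curvatureFun hO hT ![u, v]) = 0 := by
  have hs : ∀ v, SmoothOn (fun y => T (y, v)) O := fun v => hT.partial_fst hO v
  have hd : ∀ v w, SmoothOn (fun y => dirDeriv (fun z => T (z, w)) y v) O := fun v w =>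
    SmoothOn.partial_fst hO ((hs w).dirDeriv hO) v
  have key : ∀ u v w, covDeriv hx (T (x, u)) u (curvatureFun hO hT ![v, w]) =
      dirDeriv (fun y => dirDeriv (fun z => T (z, w)) y v) x u -
      dirDeriv (fun y => dirDeriv (fun z => T (z, v)) y w) x u +
      ((dirDeriv (fun z => T (z, v)) x u * T (x, w) + T (x, v) * dirDeriv (fun z => T (z, w)) x u)
      - (dirDeriv (fun z => T (z, w)) x u * T (x, v) +
        T (x, w) * dirDeriv (fun z => T (z, v)) x u)) +
      (T (x, u) * (dirDeriv (fun z => T (z, w)) x v - dirDeriv (fun z => T (z, v)) x w +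
        (T (x, v) * T (x, w) - T (x, w) * T (x, v))) -
        (dirDeriv (fun z => T (z, w)) x v - dirDeriv (fun z => T (z, v)) x w +
        (T (x, v) * T (x, w) - T (x, w) * T (x, v))) * T (x, u)) := by
    intro u v w
    have h1 := HasDirDeriv.dirDeriv_eq ((((hd v w).hasDirDeriv hx u).sub ((hd w v).hasDirDeriv hx u)).add
      ((((hs v).hasDirDeriv hx u).mul ((hs w).hasDirDeriv hx u)).sub
        (((hs w).hasDirDeriv hx u).mul ((hs v).hasDirDeriv hx u))))
    exact congrArg₂ (fun a b : A => a + b) h1 rfl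
  -- Once the second derivatives are matched by symmetry they cancel in pairs; the first-order terms
  -- cancel as well, and the cubic ones do by the Jacobi identity.
  rw [key, key, key, (hs w).dirDeriv_symm hO hx v u, (hs u).dirDeriv_symm hO hx w v,
    (hs v).dirDeriv_symm hO hx u w]
  noncomm_ring

end Local

/-! ## One-forms under changes of charts -/

section Charts

variable {H : Type*} [AddCommGroup H] [Module ℝ H] [TopologicalSpace H] [FrechetSpace H]
  {B : Type*} [TopologicalSpace B] [ChartedSpace H B] [FrechetManifold H B]
  {F : Type*} [AddCommGroup F] [Module ℝ F] [TopologicalSpace F] [FrechetSpace F]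

theorem smoothOn_transition {e c : OpenPartialHomeomorph B H} (he : e ∈ atlas H B)
    (hc : c ∈ atlas H B) :
    SmoothOn (fun x => c (e.symm x)) (e.target ∩ e.symm ⁻¹' c.source) := by
  have := FrechetManifold.smooth_change (H := H) e he c hc
  rwa [OpenPartialHomeomorph.trans_source, OpenPartialHomeomorph.symm_source] at this

theorem isOpen_preimage (e : OpenPartialHomeomorph B H) {W : Set B} (hW : IsOpen W) :
    IsOpen (e.target ∩ e.symm ⁻¹' W) :=
  e.symm.isOpen_inter_preimage hW

theorem dirDeriv_id_of_eqOn {φ : H → H} {x : H} (h : ∀ᶠ y in 𝓝 x, φ y = y) (v : H) :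
    dirDeriv φ x v = v := by
  have h1 : φ =ᶠ[𝓝 x] fun y => ContinuousLinearMap.id ℝ H y := h
  rw [dirDeriv_congr h1]
  exact (hasDirDeriv_continuousLinearMap _ x v).dirDeriv_eq

theorem chartVec_chartAt (b : B) (v : H) : chartVec (chartAt H b) (chartAt H b b) v = v := by
  unfold chartVec
  rw [(chartAt H b).left_inv (mem_chart_source H b)]
  refine dirDeriv_id_of_eqOn ?_ v
  filter_upwards [(chartAt H b).open_target.mem_nhds (mem_chart_target H b)] with y hy
  exact (chartAt H b).right_inv hy

theorem mem_preimage_chartAt (e : OpenPartialHomeomorph B H) {x : H} (hx : x ∈ e.target) :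
    x ∈ e.target ∩ e.symm ⁻¹' (chartAt H (e.symm x)).source :=
  ⟨hx, mem_chart_source H _⟩

theorem chartVec_linear {e : OpenPartialHomeomorph B H} (he : e ∈ atlas H B) {x : H}
    (hx : x ∈ e.target) : ∃ l : H →L[ℝ] H, ∀ v, chartVec e x v = l v :=
  ⟨(smoothOn_transition he (chart_mem_atlas H (e.symm x))).fderivL
    (isOpen_preimage e (chartAt H (e.symm x)).open_source) (mem_preimage_chartAt e hx),
    fun _ => rfl⟩

/-- The coordinate expressions of a tangent vector in two charts are related by the derivative of
the change of charts. -/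
theorem chartVec_change {e c : OpenPartialHomeomorph B H} (he : e ∈ atlas H B)
    (hc : c ∈ atlas H B) {y : H} (hy : y ∈ e.target ∩ e.symm ⁻¹' c.source) (v : H) :
    chartVec e y v = chartVec c (c (e.symm y)) (dirDeriv (fun z => c (e.symm z)) y v) := by
  have hO := isOpen_preimage e c.open_source
  unfold chartVec
  rw [c.left_inv hy.2]
  set d := chartAt H (e.symm y) with hd
  have hmem : c (e.symm y) ∈ c.target ∩ c.symm ⁻¹' d.source :=
    ⟨c.map_source hy.2, by rw [mem_preimage, c.left_inv hy.2]; exact mem_chart_source H _⟩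
  have h1 := (smoothOn_transition hc (chart_mem_atlas H (e.symm y))).dirDeriv_comp
    (isOpen_preimage c d.open_source) ((smoothOn_transition he hc).hasDirDeriv hy v) hmem
  rw [← h1.dirDeriv_eq]
  refine dirDeriv_congr ?_ v
  filter_upwards [hO.mem_nhds hy] with z hz
  rw [c.left_inv hz.2]

theorem inChart_change {k : ℕ} (ω : Form H B F k) {e c : OpenPartialHomeomorph B H}
    (he : e ∈ atlas H B) (hc : c ∈ atlas H B) {y : H}
    (hy : y ∈ e.target ∩ e.symm ⁻¹' c.source) (v : Fin k → H) :
    ω.inChart e y v =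
      ω.inChart c (c (e.symm y)) (fun j => dirDeriv (fun z => c (e.symm z)) y (v j)) := by
  unfold Form.inChart
  simp only [chartVec_change he hc hy]
  rw [c.left_inv hy.2]

/-- The chain rule for the change from `e` to the preferred chart. -/
theorem mDeriv_chartVec {f : B → F} {W : Set B} (hW : IsOpen W) (hf : SmoothFunOn H f W)
    {e : OpenPartialHomeomorph B H} (he : e ∈ atlas H B) {x : H} (hx : x ∈ e.target)
    (hxW : e.symm x ∈ W) (v : H) :
    mDeriv H f (e.symm x) (chartVec e x v) = dirDeriv (fun y => f (e.symm y)) x v := by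
  unfold mDeriv chartVec
  set c := chartAt H (e.symm x) with hc
  have hxc : x ∈ e.target ∩ e.symm ⁻¹' c.source := mem_preimage_chartAt e hx
  have hmem : c (e.symm x) ∈ c.target ∩ c.symm ⁻¹' W :=
    ⟨c.map_source hxc.2, by rw [mem_preimage, c.left_inv hxc.2]; exact hxW⟩
  have h1 := (hf c (chart_mem_atlas H _)).dirDeriv_comp (isOpen_preimage c hW)
    ((smoothOn_transition he (chart_mem_atlas H _)).hasDirDeriv hxc v) hmem
  rw [← h1.dirDeriv_eq]
  refine dirDeriv_congr ?_ v
  filter_upwards [(isOpen_preimage e c.open_source).mem_nhds hxc] with z hz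
  rw [c.left_inv hz.2]

/-- The coordinate expression of a one-form as a function of the point and the vector. -/
def Form.inChart₁ (ω : Form H B F 1) (e : OpenPartialHomeomorph B H) (p : H × H) : F :=
  ω.inChart e p.1 fun _ => p.2

theorem IsSmoothFormOn.smoothOn_inChart₁ {ω : Form H B F 1} {W : Set B}
    (h : IsSmoothFormOn ω W) {e : OpenPartialHomeomorph B H} (he : e ∈ atlas H B) :
    SmoothOn (ω.inChart₁ e) ((e.target ∩ e.symm ⁻¹' W) ×ˢ univ) :=
  (h.2 e he).comp_of_clm ((ContinuousLinearMap.fst ℝ H H).prod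
    (ContinuousLinearMap.pi fun _ => ContinuousLinearMap.snd ℝ H H)) fun _ hp =>
      ⟨hp.1, mem_univ _⟩

theorem extD_eq_extD₁ (ω : Form H B F 1) (b : B) (v : Fin 2 → H) :
    extD ω b v = extD₁ (ω.inChart₁ (chartAt H b)) (chartAt H b b) v := by
  have e0 : (0 : Fin 2).removeNth v = fun _ => v 1 := by
    ext j; fin_cases j; rfl
  have e1 : (1 : Fin 2).removeNth v = fun _ => v 0 := by
    ext j; fin_cases j; rfl
  unfold extD extD₁ Form.inChart₁
  rw [Fin.sum_univ_two, e0, e1]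
  simp [sub_eq_add_neg]

/-- The exterior derivative of one-forms may be computed in any chart. -/
theorem extD_inChart {ω : Form H B F 1} {W : Set B} (hW : IsOpen W) (hω : IsSmoothFormOn ω W)
    {e : OpenPartialHomeomorph B H} (he : e ∈ atlas H B) {x : H} (hx : x ∈ e.target)
    (hxW : e.symm x ∈ W) (v : Fin 2 → H) :
    (extD ω).inChart e x v = extD₁ (ω.inChart₁ e) x v := by
  set b := e.symm x with hb
  set c := chartAt H b with hc
  have hca : c ∈ atlas H B := chart_mem_atlas H b
  set φ : H → H := fun y => c (e.symm y) with hφ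
  have hS := isOpen_preimage e c.open_source
  have hxS : x ∈ e.target ∩ e.symm ⁻¹' c.source := mem_preimage_chartAt e hx
  have hφs : SmoothOn φ (e.target ∩ e.symm ⁻¹' c.source) := smoothOn_transition he hca
  have hcb : c.symm (c b) = b := c.left_inv (mem_chart_source H b)
  obtain ⟨a, ha⟩ := hω.1 b hxW
  have hO := isOpen_preimage c hW
  have hmem : c b ∈ c.target ∩ c.symm ⁻¹' W :=
    ⟨mem_chart_target H b, by rw [mem_preimage, hcb]; exact hxW⟩
  have hT := hω.smoothOn_inChart₁ hca
  have hO2 := hO.prod (isOpen_univ (X := H))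
  have hval : ∀ u, ω.inChart₁ c (c b, u) = a fun _ => u := by
    intro u
    change ω (c.symm (c b)) (fun _ => chartVec c (c b) u) = _
    rw [hcb, chartVec_chartAt, ha]
  -- At a fixed point the form is linear in the vector, so the difference quotient is constant.
  have hvert : ∀ u z, dirDeriv (ω.inChart₁ c) (c b, u) (0, z) = a fun _ => z := by
    intro u z
    refine HasDirDeriv.dirDeriv_eq (tendsto_const_nhds.congr' ?_)
    filter_upwards [self_mem_nhdsWithin] with t ht
    have ht' : t ≠ 0 := ht
    have h1 : (c b, u) + t • ((0 : H), z) = (c b, u + t • z) := by simp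
    rw [h1, hval, hval]
    have h2 : (fun _ : Fin 1 => u + t • z) = (fun _ => u) + t • (fun _ => z) := rfl
    have h3 : a ((fun _ : Fin 1 => u) + t • (fun _ => z)) =
        a (fun _ => u) + t • a (fun _ => z) := by
      have e1 : ∀ z : H, (fun _ : Fin 1 => z) = Function.update (fun _ => (0 : H)) 0 z := by
        intro z; ext j; fin_cases j; rfl
      have e2 : (fun _ : Fin 1 => u) + t • (fun _ => z) =
        Function.update (fun _ => (0 : H)) 0 (u + t • z) := (e1 (u + t • z))
      rw [e2, a.map_update_add, a.map_update_smul, ← e1, ← e1]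
    rw [h2, h3, add_sub_cancel_left, smul_smul, inv_mul_cancel₀ ht', one_smul]
  -- Besides the transformed derivative there is one extra term, the form applied to the second
  -- derivative of the change of charts; by symmetry it cancels in the exterior derivative.
  have key : ∀ u z, dirDeriv (fun y => ω.inChart₁ e (y, u)) x z =
      dirDeriv (fun y => ω.inChart₁ c (y, dirDeriv φ x u)) (c b) (dirDeriv φ x z) +
        a fun _ => dirDeriv (fun y => dirDeriv φ y u) x z := by
    intro u z
    have hpair : HasDirDeriv (fun y => (φ y, dirDeriv φ y u)) x z
        (dirDeriv φ x z, dirDeriv (fun y => dirDeriv φ y u) x z) :=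
      (hφs.hasDirDeriv hxS z).prodMk_nhds
        ((SmoothOn.partial_fst hS (hφs.dirDeriv hS) u).hasDirDeriv hxS z)
    have h1 := hT.dirDeriv_comp hO2 hpair ⟨hmem, mem_univ _⟩
    have h2 : dirDeriv (fun y => ω.inChart₁ e (y, u)) x z =
        dirDeriv (fun y => ω.inChart₁ c (φ y, dirDeriv φ y u)) x z := by
      refine dirDeriv_congr ?_ z
      filter_upwards [hS.mem_nhds hxS] with y hy
      exact inChart_change ω he hca hy _
    rw [h2, h1.dirDeriv_eq, dirDeriv_partial_fst, ← hvert (dirDeriv φ x u),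
      ← hT.dirDeriv_add hO2 ⟨hmem, mem_univ _⟩]
    simp
    rfl
  unfold extD₁
  rw [key, key, hφs.dirDeriv_symm hS hxS, add_sub_add_right_eq_sub]
  exact extD_eq_extD₁ ω b _

end Charts

/-! ## Powers of the curvature and transgression on open subsets of a Frechet space -/

section LocalPowers

variable {H : Type*} [AddCommGroup H] [Module ℝ H] [TopologicalSpace H] [FrechetSpace H]
  {A : Type*} [Ring A] [Algebra ℂ A] [TopologicalSpace A] [FrechetSpace A] [ContinuousMul A]
  {O : Set H} {x : H} {n : ℕ}

theorem smoothOn_reindex {F : Type*} [AddCommGroup F] [Module ℝ F] [TopologicalSpace F]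
    [FrechetSpace F] {m n : ℕ} {S : H × (Fin m → H) → F} (hS : SmoothOn S (O ×ˢ univ))
    (r : Fin m → Fin n) :
    SmoothOn (fun p : H × (Fin n → H) => S (p.1, fun i => p.2 (r i))) (O ×ˢ univ) :=
  hS.comp_of_clm ((ContinuousLinearMap.fst ℝ H (Fin n → H)).prod
    (ContinuousLinearMap.pi fun i =>
      (ContinuousLinearMap.proj (R := ℝ) (φ := fun _ : Fin n => H) (r i)).comp
        (ContinuousLinearMap.snd ℝ H (Fin n → H)))) fun _ hp => ⟨hp.1, mem_univ _⟩

theorem smoothOn_altSum {S : H × (Fin n → H) → A} (hS : SmoothOn S (O ×ˢ univ)) :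
    SmoothOn (fun p : H × (Fin n → H) => altSum (fun v => S (p.1, v)) p.2) (O ×ˢ univ) := by
  refine SmoothOn.sum _ fun σ _ => ?_
  have h1 := smoothOn_reindex hS σ
  rcases Int.units_eq_one_or (Equiv.Perm.sign σ) with h | h
  · simpa only [h, one_smul] using h1
  · simpa only [h, neg_smul, one_smul, Units.neg_smul] using h1.const_smul (-1)

theorem smoothOn_prodForm {p q : ℕ} {S : H × (Fin p → H) → A} {S' : H × (Fin q → H) → A}
    (hS : SmoothOn S (O ×ˢ univ)) (hS' : SmoothOn S' (O ×ˢ univ)) :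
    SmoothOn (fun z : H × (Fin (p + q) → H) =>
      prodForm (fun v => S (z.1, v)) (fun v => S' (z.1, v)) z.2) (O ×ˢ univ) :=
  (smoothOn_reindex hS (Fin.castAdd q)).mul (smoothOn_reindex hS' (Fin.natAdd p))

theorem smoothOn_prodPow {R : H × (Fin 2 → H) → A} (hR : SmoothOn R (O ×ˢ univ)) (k : ℕ) :
    SmoothOn (fun z : H × (Fin (2 * k) → H) => prodPow (fun v => R (z.1, v)) k z.2)
      (O ×ˢ univ) := by
  induction k with
  | zero => exact SmoothOn.const 1 _
  | succ k ih =>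
    exact smoothOn_prodForm (S := fun z => prodPow (fun v => R (z.1, v)) k z.2) ih hR

theorem smoothOn_transProd {R : H × (Fin 2 → H) → A} (hR : SmoothOn R (O ×ˢ univ))
    {η : H × H → A} (hη : SmoothOn η (O ×ˢ univ)) (k : ℕ) :
    SmoothOn (fun z : H × (Fin (2 * k + 1) → H) =>
      transProd (fun v => R (z.1, v)) (fun u => η (z.1, u)) k z.2) (O ×ˢ univ) := by
  induction k with
  | zero => exact smoothOn_comp_proj hη 0
  | succ k ih =>
    exact (smoothOn_prodForm (p := 2 * k + 1) (q := 2) (S := fun z =>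
      transProd (fun v => R (z.1, v)) (fun u => η (z.1, u)) k z.2) ih hR).add
      (smoothOn_prodForm (p := 2 * (k + 1)) (q := 1)
        (S := fun z => prodPow (fun v => R (z.1, v)) (k + 1) z.2)
        (smoothOn_prodPow hR (k + 1)) (smoothOn_comp_proj hη 0))

/-- The covariant exterior derivative of the form `S` with respect to the connection form `T`. -/
def covExtD (T : H × H → A) (S : H → (Fin n → H) → A) (x : H) (v : Fin (n + 1) → H) : A :=
  ∑ i : Fin (n + 1), (-1 : ℝ) ^ (i : ℕ) • (dirDeriv (fun y => S y (i.removeNth v)) x (v i) +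
    (T (x, v i) * S x (i.removeNth v) - S x (i.removeNth v) * T (x, v i)))

/-- Expansion along the first argument merges the sum over `i` with the antisymmetrization. This is
the passage from forms to the algebra of derivations. -/
theorem covExtD_altSum (hx : x ∈ O) (T : H × H → A) (S : (Fin n → H) → smoothRing A O)
    (v : Fin (n + 1) → H) :
    covExtD T (fun y => altSum fun w => smoothEval A O y (S w)) x v =
      altSum (fun w : Fin (n + 1) → H =>
        covDeriv hx (T (x, w 0)) (w 0) (S fun j => w j.succ)) v := by
  rw [← sum_altSum_removeNth (fun u w => covDeriv hx (T (x, u)) u (S w)) v]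
  refine Finset.sum_congr rfl fun i _ => ?_
  congr 1
  have h1 : ∀ y, altSum (fun w => smoothEval A O y (S w)) (i.removeNth v) =
      (altSum S (i.removeNth v)).1 y := fun y =>
    (map_altSum (M := smoothRing A O) (N := A) (smoothEval A O y).toAddMonoidHom S _).symm
  simp only [h1]
  exact map_altSum (covDeriv hx (T (x, v i)) (v i)) S _

variable {T : H × H → A}

/-- Powers of the curvature are covariantly closed. -/
theorem covExtD_prodPow_curvature (hO : IsOpen O) (hT : SmoothOn T (O ×ˢ univ)) (hx : x ∈ O)
    (k : ℕ) (v : Fin (2 * k + 1) → H) :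
    covExtD T (fun y => altSum (prodPow (curvature T y) k)) x v = 0 := by
  have h1 : ∀ y, prodPow (curvature T y) k =
      fun w => smoothEval A O y (prodPow (curvatureFun hO hT) k w) := by
    intro y
    ext w
    exact (map_prodPow (smoothEval A O y) (curvatureFun hO hT) k w).symm
  simp only [h1]
  rw [covExtD_altSum hx]
  exact altSum_deriv_prodPow (f := smoothEval A O x)
    (δ := fun u => covDeriv hx (T (x, u)) u) (R := curvatureFun hO hT)
    (fun u s t => covDeriv_mul hx _ u s t) (bianchi hO hT hx) k v

theorem covExtD_transProd (hO : IsOpen O) (hT : SmoothOn T (O ×ˢ univ)) {η : H × H → A}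
    (hη : SmoothOn η (O ×ˢ univ)) (hx : x ∈ O) (k : ℕ) (v : Fin (2 * k + 1 + 1) → H) :
    covExtD T (fun y => altSum (transProd (curvature T y) (fun u => η (y, u)) k)) x v =
      altSum (prodPowDeriv (curvature T x) (fun w => dirDeriv (fun y => η (y, w 1)) x (w 0) +
        (T (x, w 0) * η (x, w 1) - η (x, w 1) * T (x, w 0))) (k + 1)) v := by
  let ηf : H → smoothRing A O := fun u => ⟨fun y => η (y, u), hη.partial_fst hO u⟩
  have h1 : ∀ y, transProd (curvature T y) (fun u => η (y, u)) k =
      fun w => smoothEval A O y (transProd (curvatureFun hO hT) ηf k w) := by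
    intro y
    ext w
    exact (map_transProd (smoothEval A O y) (curvatureFun hO hT) ηf k w).symm
  simp only [h1]
  rw [covExtD_altSum hx]
  exact altSum_deriv_transProd (f := smoothEval A O x)
    (δ := fun u => covDeriv hx (T (x, u)) u) (R := curvatureFun hO hT)
    (fun u s t => covDeriv_mul hx _ u s t) (bianchi hO hT hx) ηf k v

/-- The difference of the powers of the curvatures of two connections. -/
theorem prodPow_curvature_sub (hO : IsOpen O) (hT : SmoothOn T (O ×ˢ univ)) {η : H × H → A}
    (hη : SmoothOn η (O ×ˢ univ)) (hx : x ∈ O) {k N : ℕ} (hN : 2 * (k + 1) ≤ N + 1)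
    {w t : Fin (N + 1) → ℝ} (hw : ∀ n < N + 1, ∑ i, w i * t i ^ n = ((n : ℝ) + 1)⁻¹)
    (v : Fin (2 * (k + 1)) → H) :
    altSum (prodPow (curvature (fun p => T p + η p) x) (k + 1)) v -
        altSum (prodPow (curvature T x) (k + 1)) v =
      ∑ i, (2 * w i) • covExtD (fun p => T p + t i • η p) (fun y =>
        altSum (transProd (curvature (fun p => T p + t i • η p) y) (fun u => η (y, u)) k)) x v := by
  set Y : (Fin 2 → H) → A := fun u => extD₁ η x u +
    (T (x, u 0) * η (x, u 1) - η (x, u 1) * T (x, u 0) -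
      (T (x, u 1) * η (x, u 0) - η (x, u 0) * T (x, u 1))) with hY
  set Z : (Fin 2 → H) → A := fun u => η (x, u 0) * η (x, u 1) - η (x, u 1) * η (x, u 0) with hZ
  have hsm : ∀ s : ℝ, SmoothOn (fun p => T p + s • η p) (O ×ˢ univ) := fun s =>
    hT.add (hη.const_smul s)
  -- The curvature along the segment of connections is quadratic in the parameter.
  have hcurv : ∀ s : ℝ, curvature (fun p => T p + s • η p) x =
      fun u => curvature T x u + s • Y u + s ^ 2 • Z u := by
    intro s
    ext u
    have hd : ∀ a b, dirDeriv (fun y => T (y, a) + s • η (y, a)) x b =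
        dirDeriv (fun y => T (y, a)) x b + s • dirDeriv (fun y => η (y, a)) x b := fun a b =>
      (((hT.partial_fst hO a).hasDirDeriv hx b).add
        (((hη.const_smul s).partial_fst hO a).hasDirDeriv hx b)).dirDeriv_eq.trans
        (congrArg _ ((((hη.partial_fst hO a).hasDirDeriv hx b).clm
          (s • ContinuousLinearMap.id ℝ A)).dirDeriv_eq))
    simp only [curvature, extD₁, hY, hZ, hd, mul_add, add_mul, smul_mul_assoc, mul_smul_comm,
      smul_add, smul_sub, pow_two, mul_smul]
    abel
  have hone : (fun p => T p + η p) = fun p => T p + (1 : ℝ) • η p := by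
    ext p; rw [one_smul]
  rw [hone, hcurv 1]
  simp only [one_pow, one_smul]
  rw [altSum_prodPow_sub hN hw]
  refine Finset.sum_congr rfl fun i _ => ?_
  have h1 := covExtD_transProd hO (hsm (t i)) hη hx k v
  rw [h1, mul_comm 2 (w i), mul_smul, ← hcurv (t i)]
  -- The velocity `Y + 2 t Z` of the curvature is the antisymmetrization of the covariant derivative
  -- of `η` for the connection form `T + t η`.
  rw [altSum_prodPowDeriv_antisymm _ _ (fun w => dirDeriv (fun y => η (y, w 1)) x (w 0) +
        ((T (x, w 0) + t i • η (x, w 0)) * η (x, w 1) -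
          η (x, w 1) * (T (x, w 0) + t i • η (x, w 0))))]
  · simp only [two_smul]
  · intro a b
    simp only [hY, hZ, extD₁, Matrix.cons_val_zero, Matrix.cons_val_one, mul_add, add_mul,
      smul_mul_assoc, mul_smul_comm, smul_sub, two_mul, add_smul]
    abel

end LocalPowers

/-! ## Forms with values in the adjoint bundle -/

section MapArgs

variable {H H' A M : Type*} [AddCommGroup M] [Ring A]

theorem altSum_map_args {n : ℕ} (F : (Fin n → H') → M) (f : H → H') (v : Fin n → H) :
    altSum F (fun j => f (v j)) = altSum (fun w => F fun j => f (w j)) v := rfl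

theorem prodPow_map_args (R : (Fin 2 → H') → A) (f : H → H') (k : ℕ) (v : Fin (2 * k) → H) :
    prodPow R k (fun j => f (v j)) = prodPow (fun w => R fun j => f (w j)) k v := by
  induction k with
  | zero => rfl
  | succ k ih => exact congrArg₂ (· * ·) (ih _) rfl

theorem transProd_map_args (R : (Fin 2 → H') → A) (η : H' → A) (f : H → H') (k : ℕ)
    (v : Fin (2 * k + 1) → H) :
    transProd R η k (fun j => f (v j)) =
      transProd (fun w => R fun j => f (w j)) (fun u => η (f u)) k v := by
  induction k with
  | zero => rfl
  | succ k ih =>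
    exact congrArg₂ (· + ·) (congrArg₂ (· * ·) (ih _) rfl)
      (congrArg₂ (· * ·) (prodPow_map_args R f (k + 1) _) rfl)

end MapArgs

/-! ### Bilinearity of the curvature and locality of the covariant exterior derivative -/

section LocalLinear

variable {H : Type*} [AddCommGroup H] [Module ℝ H] [TopologicalSpace H] [FrechetSpace H]
  {A : Type*} [Ring A] [Algebra ℂ A] [TopologicalSpace A] [FrechetSpace A] [ContinuousMul A]
  {O : Set H} {x : H}

theorem isMultilinear_of_bilinear {M : Type*} [AddCommGroup M] [Module ℝ M]
    (f : H →ₗ[ℝ] H →ₗ[ℝ] M) : IsMultilinear (fun v : Fin 2 → H => f (v 0) (v 1)) :=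
  ⟨(MultilinearMap.ofSubsingleton ℝ H (H →ₗ[ℝ] M) (0 : Fin 1) f).uncurryRight, fun _ => rfl⟩

/-- One vector is the direction of a derivative, the other sits inside the differentiated function;
for the latter, linearity of `T` is needed at all points near `x`. -/
theorem isMultilinear_curvature {T : H × H → A} (hO : IsOpen O) (hT : SmoothOn T (O ×ˢ univ))
    (hl : ∀ y ∈ O, ∃ l : H →ₗ[ℝ] A, ∀ u, T (y, u) = l u) (hx : x ∈ O) :
    IsMultilinear (curvature T x) := by
  have hs : ∀ v, SmoothOn (fun y => T (y, v)) O := fun v => hT.partial_fst hO v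
  have hadd : ∀ y ∈ O, ∀ u w, T (y, u + w) = T (y, u) + T (y, w) := by
    intro y hy u w
    obtain ⟨l, hl⟩ := hl y hy
    simp [hl]
  have hsmul : ∀ y ∈ O, ∀ (r : ℝ) u, T (y, r • u) = r • T (y, u) := by
    intro y hy r u
    obtain ⟨l, hl⟩ := hl y hy
    simp [hl]
  have dadd : ∀ u w z, dirDeriv (fun y => T (y, u + w)) x z =
      dirDeriv (fun y => T (y, u)) x z + dirDeriv (fun y => T (y, w)) x z := by
    intro u w z
    rw [← (((hs u).hasDirDeriv hx z).add ((hs w).hasDirDeriv hx z)).dirDeriv_eq]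
    refine dirDeriv_congr ?_ z
    filter_upwards [hO.mem_nhds hx] with y hy using hadd y hy u w
  have dsmul : ∀ (r : ℝ) u z, dirDeriv (fun y => T (y, r • u)) x z =
      r • dirDeriv (fun y => T (y, u)) x z := by
    intro r u z
    have h1 := (((hs u).hasDirDeriv hx z).clm (r • ContinuousLinearMap.id ℝ A)).dirDeriv_eq
    refine Eq.trans (dirDeriv_congr ?_ z) h1
    filter_upwards [hO.mem_nhds hx] with y hy using hsmul y hy r u
  have key : curvature T x = fun v => LinearMap.mk₂ ℝ (fun a b =>
      dirDeriv (fun y => T (y, b)) x a - dirDeriv (fun y => T (y, a)) x b +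
        (T (x, a) * T (x, b) - T (x, b) * T (x, a)))
      (fun a a' b => by
        rw [(hs b).dirDeriv_add hO hx, dadd, hadd x hx]; noncomm_ring)
      (fun r a b => by
        rw [(hs b).dirDeriv_smul hx, dsmul, hsmul x hx]
        simp only [smul_mul_assoc, mul_smul_comm, smul_add, smul_sub])
      (fun a b b' => by
        rw [(hs a).dirDeriv_add hO hx, dadd, hadd x hx]; noncomm_ring)
      (fun r a b => by
        rw [(hs a).dirDeriv_smul hx, dsmul, hsmul x hx]
        simp only [smul_mul_assoc, mul_smul_comm, smul_add, smul_sub]) (v 0) (v 1) := by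
    ext v
    rfl
  rw [key]
  exact isMultilinear_of_bilinear _

theorem covExtD_congr {n : ℕ} (T : H × H → A) {S S' : H → (Fin n → H) → A} (hO : IsOpen O)
    (hx : x ∈ O) (h : ∀ y ∈ O, S y = S' y) (v : Fin (n + 1) → H) :
    covExtD T S x v = covExtD T S' x v := by
  refine Finset.sum_congr rfl fun i _ => ?_
  have h1 : dirDeriv (fun y => S y (i.removeNth v)) x (v i) =
      dirDeriv (fun y => S' y (i.removeNth v)) x (v i) := by
    refine dirDeriv_congr ?_ _
    filter_upwards [hO.mem_nhds hx] with y hy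
    rw [h y hy]
  rw [h1, h x hx]

/-- Multiplication by a complex number. -/
def smulCLM (A : Type*) [Ring A] [Algebra ℂ A] [TopologicalSpace A] [ContinuousMul A] (c : ℂ) :
    A →L[ℝ] A where
  toFun a := c • a
  map_add' := smul_add c
  map_smul' r a := smul_comm c r a
  cont := by
    have : Continuous fun a : A => (c • (1 : A)) * a := by fun_prop
    simpa using this

end LocalLinear

/-! ### Conjugation by the structure group -/

section Adjoint

variable {G A : Type*} [Group G] [Ring A]

/-- Conjugation by `ρ g`. -/
def conjHom (ρ : G →* A) (g : G) : A →+* A where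
  toFun a := ρ g * a * ρ g⁻¹
  map_one' := by rw [mul_one, ← map_mul, mul_inv_cancel, map_one]
  map_zero' := by simp
  map_add' a b := by noncomm_ring
  map_mul' a b := by
    have h : ρ g⁻¹ * ρ g = 1 := by rw [← map_mul, inv_mul_cancel, map_one]
    calc ρ g * (a * b) * ρ g⁻¹ = ρ g * a * 1 * b * ρ g⁻¹ := by noncomm_ring
      _ = ρ g * a * ρ g⁻¹ * (ρ g * b * ρ g⁻¹) := by rw [← h]; noncomm_ring

theorem eq_conjHom_of_mul_eq {ρ : G →* A} {g : G} {a a' : A} (h : ρ g * a = a' * ρ g) :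
    a' = conjHom ρ g a := by
  change a' = ρ g * a * ρ g⁻¹
  rw [h, mul_assoc, ← map_mul, mul_inv_cancel, map_one, mul_one]

end Adjoint

/-! ### Gluing of local forms by `λ` -/

section Global

variable {H : Type*} [AddCommGroup H] [Module ℝ H] [TopologicalSpace H] [FrechetSpace H]
  {B : Type*} [TopologicalSpace B] [ChartedSpace H B] [FrechetManifold H B]
  {L : Type*} [AddCommGroup L] [Module ℝ L] [TopologicalSpace L]
  {G : Type*} [Group G] [TopologicalSpace G] [ChartedSpace L G]
  {A : Type*} [Ring A] [Algebra ℂ A] [TopologicalSpace A] [FrechetSpace A] [ContinuousMul A]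
  {ρ : G →* A}
  {V : Type*} [AddCommGroup V] [Module ℂ V] [TopologicalSpace V] [Module A V]
  {I : Type*} {E : B → Type*} [∀ b, AddCommGroup (E b)] [∀ b, Module ℂ (E b)]
  {P : GVectorBundle H L ρ V I E} {n : ℕ}

/-- The local expressions `F i` over `U i` of a smooth `Ad P`-valued form. -/
structure IsAdForm (P : GVectorBundle H L ρ V I E) (F : I → Form H B A n) : Prop where
  smooth : ∀ i, IsSmoothFormOn (F i) (P.U i)
  change : ∀ i j, ∀ b ∈ P.U i ∩ P.U j, ∀ v, F i b v = conjHom ρ (P.g i j b) (F j b v)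

namespace AdMorphism

variable (Λ : AdMorphism P)

/-- The complex-valued form `λ ∘ F`. -/
def glue (F : I → Form H B A n) : Form H B ℂ n := fun b v =>
  Λ.form (P.indexAt b) b (F (P.indexAt b) b v)

/-- The conjugation in the change rule for `F` is undone by `form_change`, so the chosen index does
not matter. -/
theorem glue_apply {F : I → Form H B A n} (hF : IsAdForm P F) {i : I} {b : B} (hb : b ∈ P.U i)
    (v : Fin n → H) : Λ.glue F b v = Λ.form i b (F i b v) := by
  rw [hF.change i (P.indexAt b) b ⟨hb, P.mem_indexAt b⟩]
  exact (Λ.form_change i (P.indexAt b) b ⟨hb, P.mem_indexAt b⟩ _).symm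

theorem isSmoothFormOn_glue {F : I → Form H B A n} (hF : IsAdForm P F) :
    IsSmoothFormOn (Λ.glue F) univ := by
  constructor
  · intro b _
    obtain ⟨a, ha⟩ := (hF.smooth (P.indexAt b)).1 b (P.mem_indexAt b)
    exact ⟨(Λ.form (P.indexAt b) b).compAlternatingMap a, fun v => by simp [glue, ha]⟩
  · intro e he
    -- The index `P.indexAt` may jump from point to point; near a given point it is replaced by a
    -- fixed one.
    refine SmoothOn.of_local ((isOpen_preimage e isOpen_univ).prod isOpen_univ) ?_
    rintro ⟨x, v⟩ ⟨hx, -⟩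
    set i := P.indexAt (e.symm x) with hi
    have hO := isOpen_preimage e (P.isOpen_U i)
    refine ⟨(e.target ∩ e.symm ⁻¹' P.U i) ×ˢ univ, hO.prod isOpen_univ,
      ⟨⟨hx.1, P.mem_indexAt _⟩, mem_univ _⟩, ?_⟩
    have h1 : SmoothOn (fun p : H × (Fin n → H) =>
        Λ.form i (e.symm p.1) ((F i).inChart e p.1 p.2))
        ((e.target ∩ e.symm ⁻¹' P.U i) ×ˢ univ) :=
      (Λ.smooth_form i e he).comp
        ((SmoothOn.clm (ContinuousLinearMap.fst ℝ H (Fin n → H)) _).prodMk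
          ((hF.smooth i).2 e he)) (hO.prod isOpen_univ) fun p hp => ⟨hp.1, mem_univ _⟩
    refine (h1.congr (hO.prod isOpen_univ) fun p hp => ?_).mono inter_subset_right
    exact (Λ.glue_apply hF hp.1.2 _).symm

/-- The commutation of `λ` with the covariant derivative on sections of the adjoint bundle that is
defined by the local connection forms `ϑ i`, in coordinates. -/
def Commutes (ϑ : I → Form H B A 1) : Prop :=
  ∀ i, ∀ b ∈ P.U i, ∀ s : H → A,
    SmoothOn s ((chartAt H b).target ∩ (chartAt H b).symm ⁻¹' P.U i) → ∀ u : H,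
      dirDeriv (fun x => Λ.form i ((chartAt H b).symm x) (s x)) (chartAt H b b) u =
        Λ.form i b (dirDeriv s (chartAt H b b) u +
          (ϑ i b (fun _ => u) * s (chartAt H b b) - s (chartAt H b b) * ϑ i b (fun _ => u)))

/-- The covariant derivative is affine in the connection form. Its values at the two ends have the
same image under `λ`, so the coefficient of `t` is annihilated. -/
theorem Commutes.affine {Λ : AdMorphism P} {ϑ ϑ' : I → Form H B A 1} (h : Λ.Commutes ϑ)
    (h' : Λ.Commutes ϑ') (t : ℝ) :
    Λ.Commutes fun i b v => ϑ i b v + t • (ϑ' i b v - ϑ i b v) := by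
  intro i b hb s hs u
  have e1 := h i b hb s hs u
  have e2 := h' i b hb s hs u
  set a := ϑ i b fun _ => u
  set a' := ϑ' i b fun _ => u
  set s0 := s (chartAt H b b)
  have e3 : dirDeriv s (chartAt H b b) u +
      ((a + t • (a' - a)) * s0 - s0 * (a + t • (a' - a))) =
      (dirDeriv s (chartAt H b b) u + (a * s0 - s0 * a)) +
      t • ((dirDeriv s (chartAt H b b) u + (a' * s0 - s0 * a')) -
        (dirDeriv s (chartAt H b b) u + (a * s0 - s0 * a))) := by
    simp only [add_mul, mul_add, smul_mul_assoc, mul_smul_comm, sub_mul, mul_sub, smul_sub,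
      smul_add]
    abel
  rw [e3, map_add, map_smul, map_sub, ← e1, ← e2, sub_self, smul_zero, add_zero]

/-- The morphism `a ↦ λ (c a)`. -/
def scale (c : ℂ) : AdMorphism P where
  form i b := Λ.form i b ∘ₗ (smulCLM A c).toLinearMap
  smooth_form i e he :=
    (Λ.smooth_form i e he).comp_of_clm
      ((ContinuousLinearMap.fst ℝ H A).prod ((smulCLM A c).comp (ContinuousLinearMap.snd ℝ H A)))
      fun _ hp => ⟨hp.1, mem_univ _⟩
  form_change i j b hb a := by
    change Λ.form i b (c • _) = Λ.form j b (c • a)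
    rw [← Λ.form_change i j b hb, mul_smul_comm, smul_mul_assoc]

theorem scale_form (c : ℂ) (i : I) (b : B) (a : A) :
    (Λ.scale c).form i b a = Λ.form i b (c • a) := rfl

/-- The hypothesis is applied to the section `c • s`. Scaling absorbs both the Taylor coefficients
of `f` and the quadrature weights. -/
theorem Commutes.scale {Λ : AdMorphism P} {ϑ : I → Form H B A 1} (h : Λ.Commutes ϑ) (c : ℂ) :
    (Λ.scale c).Commutes ϑ := by
  intro i b hb s hs u
  refine (h i b hb (fun x => smulCLM A c (s x)) (hs.clm_comp _) u).trans ?_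
  have hmem : chartAt H b b ∈ (chartAt H b).target ∩ (chartAt H b).symm ⁻¹' P.U i :=
    ⟨mem_chart_target H b, by
      rw [mem_preimage, (chartAt H b).left_inv (mem_chart_source H b)]; exact hb⟩
  rw [((hs.hasDirDeriv hmem u).clm (smulCLM A c)).dirDeriv_eq, scale_form]
  congr 1
  simp [smulCLM, smul_add, smul_sub]

theorem mem_chartAt_preimage {i : I} {b : B} (hb : b ∈ P.U i) :
    chartAt H b b ∈ (chartAt H b).target ∩ (chartAt H b).symm ⁻¹' P.U i :=
  ⟨mem_chart_target H b, by
    rw [mem_preimage, (chartAt H b).left_inv (mem_chart_source H b)]; exact hb⟩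

theorem inChart₁_chartAt {F : Type*} [AddCommGroup F] [Module ℝ F] [TopologicalSpace F]
    (ω : Form H B F 1) (b : B) (u : H) :
    ω.inChart₁ (chartAt H b) (chartAt H b b, u) = ω b fun _ => u := by
  change ω ((chartAt H b).symm (chartAt H b b)) (fun _ => chartVec _ _ u) = _
  rw [chartVec_chartAt, (chartAt H b).left_inv (mem_chart_source H b)]

theorem inChart_chartAt {F : Type*} [AddCommGroup F] [Module ℝ F] [TopologicalSpace F]
    (ω : Form H B F n) (b : B) (v : Fin n → H) :
    ω.inChart (chartAt H b) (chartAt H b b) v = ω b v := by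
  change ω ((chartAt H b).symm (chartAt H b b)) (fun j => chartVec _ _ (v j)) = _
  simp only [chartVec_chartAt]
  rw [(chartAt H b).left_inv (mem_chart_source H b)]

/-- `d (λ ∘ F)` is `λ` applied to the covariant exterior derivative of `F`. -/
theorem extD_glue {F : I → Form H B A n} (hF : IsAdForm P F) {ϑ : I → Form H B A 1}
    (hc : Λ.Commutes ϑ) {i : I} {b : B} (hb : b ∈ P.U i) (v : Fin (n + 1) → H) :
    extD (Λ.glue F) b v = Λ.form i b (covExtD ((ϑ i).inChart₁ (chartAt H b))
      (fun y => (F i).inChart (chartAt H b) y) (chartAt H b b) v) := by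
  set c := chartAt H b with hcdef
  have hO := isOpen_preimage c (P.isOpen_U i)
  have hmem := mem_chartAt_preimage (H := H) hb
  unfold extD covExtD
  rw [map_sum]
  refine Finset.sum_congr rfl fun j _ => ?_
  rw [map_smul]
  congr 1
  -- The commutation hypothesis is used on the coefficients of `F i` at constant coordinate vectors.
  have hs := SmoothOn.partial_fst hO ((hF.smooth i).2 c (chart_mem_atlas H b)) (j.removeNth v)
  have h1 := hc i b hb _ hs (v j)
  rw [inChart₁_chartAt]
  refine Eq.trans (dirDeriv_congr ?_ _) h1
  filter_upwards [hO.mem_nhds hmem] with y hy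
  exact Λ.glue_apply hF hy.2 _

end AdMorphism

end Global

/-! ### Connection families, their Chern-Weil forms and transgression -/

section Families

variable {H : Type*} [AddCommGroup H] [Module ℝ H] [TopologicalSpace H] [FrechetSpace H]
  {B : Type*} [TopologicalSpace B] [ChartedSpace H B] [FrechetManifold H B]
  {L : Type*} [AddCommGroup L] [Module ℝ L] [TopologicalSpace L]
  {G : Type*} [Group G] [TopologicalSpace G] [ChartedSpace L G]
  {A : Type*} [Ring A] [Algebra ℂ A] [TopologicalSpace A] [FrechetSpace A] [ContinuousMul A]
  {ρ : G →* A}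
  {V : Type*} [AddCommGroup V] [Module ℂ V] [TopologicalSpace V] [Module A V]
  {I : Type*} {E : B → Type*} [∀ b, AddCommGroup (E b)] [∀ b, Module ℂ (E b)]
  {P : GVectorBundle H L ρ V I E} {n : ℕ}

/-- The curvature of an operator-valued connection form. -/
def opCurv (ϑ : Form H B A 1) : Form H B A 2 := fun b v =>
  extD ϑ b v + wedge (ϑ b) (ϑ b) v

theorem opCurv_inChart {ϑ : Form H B A 1} {W : Set B} (hW : IsOpen W) (hϑ : IsSmoothFormOn ϑ W)
    {e : OpenPartialHomeomorph B H} (he : e ∈ atlas H B) {x : H}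
    (hx : x ∈ e.target ∩ e.symm ⁻¹' W) :
    (opCurv ϑ).inChart e x = curvature (ϑ.inChart₁ e) x := by
  ext v
  refine congrArg₂ (fun a b : A => a + b) (extD_inChart hW hϑ he hx.1 hx.2 v) ?_
  exact wedge_one_one _ _ _

theorem inChart₁_linear {F : Type*} [AddCommGroup F] [Module ℝ F] [TopologicalSpace F]
    [FrechetSpace F] {ω : Form H B F 1} {W : Set B}
    (hω : IsSmoothFormOn ω W) {e : OpenPartialHomeomorph B H} (he : e ∈ atlas H B) {x : H}
    (hx : x ∈ e.target ∩ e.symm ⁻¹' W) :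
    ∃ l : H →ₗ[ℝ] F, ∀ u, ω.inChart₁ e (x, u) = l u := by
  obtain ⟨a, ha⟩ := hω.1 _ hx.2
  obtain ⟨l, hl⟩ := chartVec_linear he hx.1
  refine ⟨((MultilinearMap.ofSubsingleton ℝ H F (0 : Fin 1)).symm a.toMultilinearMap) ∘ₗ
    l.toLinearMap, fun u => ?_⟩
  change ω _ (fun _ => chartVec e x u) = a (fun _ => l u)
  rw [ha, hl]

theorem opCurv_eq_curvature {ϑ : Form H B A 1} {W : Set B} (hW : IsOpen W)
    (hϑ : IsSmoothFormOn ϑ W) {b : B} (hb : b ∈ W) :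
    opCurv ϑ b = curvature (ϑ.inChart₁ (chartAt H b)) (chartAt H b b) := by
  have hx : chartAt H b b ∈ (chartAt H b).target ∩ (chartAt H b).symm ⁻¹' W :=
    ⟨mem_chart_target H b, by
      rw [mem_preimage, (chartAt H b).left_inv (mem_chart_source H b)]; exact hb⟩
  rw [← opCurv_inChart hW hϑ (chart_mem_atlas H b) hx]
  ext v
  exact (AdMorphism.inChart_chartAt _ b v).symm

theorem isMultilinear_opCurv {ϑ : Form H B A 1} {W : Set B} (hW : IsOpen W)
    (hϑ : IsSmoothFormOn ϑ W) {b : B} (hb : b ∈ W) : IsMultilinear (opCurv ϑ b) := by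
  have hx : chartAt H b b ∈ (chartAt H b).target ∩ (chartAt H b).symm ⁻¹' W :=
    ⟨mem_chart_target H b, by
      rw [mem_preimage, (chartAt H b).left_inv (mem_chart_source H b)]; exact hb⟩
  rw [opCurv_eq_curvature hW hϑ hb]
  exact isMultilinear_curvature (isOpen_preimage _ hW)
    (hϑ.smoothOn_inChart₁ (chart_mem_atlas H b))
    (fun y hy => inChart₁_linear hϑ (chart_mem_atlas H b) hy) hx

/-- Smooth operator-valued forms `ϑ i` on `U i` that transform as connection forms. -/
structure IsConnectionFamily (P : GVectorBundle H L ρ V I E) (ϑ : I → Form H B A 1) : Prop where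
  smooth_trans : ∀ i j, SmoothFunOn H (fun b => ρ (P.g i j b)) (P.U i ∩ P.U j)
  smooth : ∀ i, IsSmoothFormOn (ϑ i) (P.U i)
  gauge : ∀ i j, ∀ b ∈ P.U i ∩ P.U j, ∀ v : Fin 1 → H,
    ρ (P.g i j b) * ϑ j b v =
      ϑ i b v * ρ (P.g i j b) + mDeriv H (fun b' => ρ (P.g i j b')) b (v 0)

namespace IsConnectionFamily

variable {ϑ ϑ' : I → Form H B A 1}

/-- With `h = ρ(g_ij)`, differentiate `h ϑ_j = ϑ_i h + dh` and antisymmetrize: the second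
derivatives of `h` drop out, and the quadratic terms follow by using the relation twice. In this
form no inverse has to be differentiated. -/
theorem mul_opCurv (h : IsConnectionFamily P ϑ) (i j : I) {b : B} (hb : b ∈ P.U i ∩ P.U j)
    (v : Fin 2 → H) :
    ρ (P.g i j b) * opCurv (ϑ j) b v = opCurv (ϑ i) b v * ρ (P.g i j b) := by
  set c := chartAt H b with hc
  have hca : c ∈ atlas H B := chart_mem_atlas H b
  have hW := (P.isOpen_U i).inter (P.isOpen_U j)
  set O := c.target ∩ c.symm ⁻¹' (P.U i ∩ P.U j) with hOdef
  have hO : IsOpen O := isOpen_preimage c hW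
  set x := c b with hxdef
  have hxb : c.symm x = b := c.left_inv (mem_chart_source H b)
  have hx : x ∈ O := ⟨mem_chart_target H b, by rw [mem_preimage, hxb]; exact hb⟩
  set h0 : H → A := fun y => ρ (P.g i j (c.symm y)) with hh0
  have hh : SmoothOn h0 O := h.smooth_trans i j c hca
  have hTi : SmoothOn ((ϑ i).inChart₁ c) (O ×ˢ univ) :=
    ((h.smooth i).smoothOn_inChart₁ hca).mono
      (prod_mono (fun y hy => ⟨hy.1, hy.2.1⟩) Subset.rfl)
  have hTj : SmoothOn ((ϑ j).inChart₁ c) (O ×ˢ univ) :=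
    ((h.smooth j).smoothOn_inChart₁ hca).mono
      (prod_mono (fun y hy => ⟨hy.1, hy.2.2⟩) Subset.rfl)
  have hgauge : ∀ y ∈ O, ∀ u, h0 y * (ϑ j).inChart₁ c (y, u) =
      (ϑ i).inChart₁ c (y, u) * h0 y + dirDeriv h0 y u := by
    intro y hy u
    rw [← mDeriv_chartVec hW (h.smooth_trans i j) hca hy.1 hy.2 u]
    exact h.gauge i j (c.symm y) hy.2 fun _ => chartVec c y u
  have hd : ∀ u w, dirDeriv h0 x w * (ϑ j).inChart₁ c (x, u) +
      h0 x * dirDeriv (fun y => (ϑ j).inChart₁ c (y, u)) x w =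
      dirDeriv (fun y => (ϑ i).inChart₁ c (y, u)) x w * h0 x +
        (ϑ i).inChart₁ c (x, u) * dirDeriv h0 x w + dirDeriv (fun y => dirDeriv h0 y u) x w := by
    intro u w
    have e1 := (hh.hasDirDeriv hx w).mul ((hTj.partial_fst hO u).hasDirDeriv hx w)
    have e2 := (((hTi.partial_fst hO u).hasDirDeriv hx w).mul (hh.hasDirDeriv hx w)).add
      ((SmoothOn.partial_fst hO (hh.dirDeriv hO) u).hasDirDeriv hx w)
    rw [← e1.dirDeriv_eq, ← e2.dirDeriv_eq]
    refine dirDeriv_congr ?_ w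
    filter_upwards [hO.mem_nhds hx] with y hy using hgauge y hy u
  rw [opCurv_eq_curvature (P.isOpen_U i) (h.smooth i) hb.1,
    opCurv_eq_curvature (P.isOpen_U j) (h.smooth j) hb.2]
  have hρ : ρ (P.g i j b) = h0 x := by rw [hh0]; simp only [hxb]
  rw [hρ]
  have d1 := hd (v 1) (v 0)
  have d2 := hd (v 0) (v 1)
  have g1 := hgauge x hx (v 1)
  have g0 := hgauge x hx (v 0)
  -- Now `d1` and `d2` contain the same second derivative, which disappears in their difference.
  rw [hh.dirDeriv_symm hO hx (v 1) (v 0)] at d1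
  simp only [curvature, extD₁]
  set a0 := (ϑ i).inChart₁ c (x, v 0)
  set a1 := (ϑ i).inChart₁ c (x, v 1)
  set b0 := (ϑ j).inChart₁ c (x, v 0)
  set b1 := (ϑ j).inChart₁ c (x, v 1)
  set q0 := dirDeriv h0 x (v 0)
  set q1 := dirDeriv h0 x (v 1)
  have r1 := eq_sub_of_add_eq' d1
  have r2 := eq_sub_of_add_eq' d2
  have s1 : h0 x * (b0 * b1) = a0 * (a1 * h0 x + q1) + q0 * b1 := by
    rw [← mul_assoc, g0, add_mul, mul_assoc, g1]
  have s2 : h0 x * (b1 * b0) = a1 * (a0 * h0 x + q0) + q1 * b0 := by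
    rw [← mul_assoc, g1, add_mul, mul_assoc, g0]
  rw [mul_add, mul_sub, mul_sub, r1, r2, s1, s2]
  noncomm_ring

theorem opCurv_change (h : IsConnectionFamily P ϑ) (i j : I) {b : B} (hb : b ∈ P.U i ∩ P.U j) :
    opCurv (ϑ i) b = fun v => conjHom ρ (P.g i j b) (opCurv (ϑ j) b v) :=
  funext fun v => eq_conjHom_of_mul_eq (h.mul_opCurv i j hb v)

/-- The inhomogeneous terms of the two gauge rules are equal and cancel. -/
theorem diff_change (h : IsConnectionFamily P ϑ) (h' : IsConnectionFamily P ϑ') (i j : I) {b : B}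
    (hb : b ∈ P.U i ∩ P.U j) (v : Fin 1 → H) :
    ϑ' i b v - ϑ i b v = conjHom ρ (P.g i j b) (ϑ' j b v - ϑ j b v) := by
  refine eq_conjHom_of_mul_eq ?_
  rw [mul_sub, h.gauge i j b hb, h'.gauge i j b hb, sub_mul]
  abel

theorem affine (h : IsConnectionFamily P ϑ) (h' : IsConnectionFamily P ϑ') (t : ℝ) :
    IsConnectionFamily P fun i b v => ϑ i b v + t • (ϑ' i b v - ϑ i b v) where
  smooth_trans := h.smooth_trans
  smooth i := by
    refine ⟨fun b hb => ?_, fun e he => ?_⟩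
    · obtain ⟨a, ha⟩ := (h.smooth i).1 b hb
      obtain ⟨a', ha'⟩ := (h'.smooth i).1 b hb
      exact ⟨a + t • (a' - a), fun v => by simp [ha, ha']⟩
    · exact ((h.smooth i).2 e he).add
        ((((h'.smooth i).2 e he).sub ((h.smooth i).2 e he)).const_smul t)
  gauge i j b hb v := by
    have e1 := h.gauge i j b hb v
    have e2 := h'.gauge i j b hb v
    rw [mul_add, mul_smul_comm, mul_sub, e1, e2]
    simp only [add_mul, smul_mul_assoc, sub_mul, add_sub_add_right_eq_sub]
    abel

/-- Conjugation is a ring homomorphism, so it commutes with products and alternating sums of the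
curvature. -/
theorem isAdForm_prodPow (h : IsConnectionFamily P ϑ) (k : ℕ) :
    IsAdForm P fun i b => altSum (prodPow (opCurv (ϑ i) b) k) where
  smooth i := by
    refine ⟨fun b hb => ?_, fun e he => ?_⟩
    · exact ((isMultilinear_opCurv (P.isOpen_U i) (h.smooth i) hb).prodPow k).altSum
    · have hO := isOpen_preimage e (P.isOpen_U i)
      have h1 := smoothOn_altSum (smoothOn_prodPow
        (smoothOn_curvature hO ((h.smooth i).smoothOn_inChart₁ he)) k)
      refine h1.congr (hO.prod isOpen_univ) fun p hp => ?_
      simp only [Form.inChart, altSum_map_args, prodPow_map_args]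
      have h2 := opCurv_inChart (P.isOpen_U i) (h.smooth i) he hp.1
      rw [← h2]
      rfl
  change i j b hb v := by
    rw [h.opCurv_change i j hb]
    have h1 := map_altSum (conjHom ρ (P.g i j b)).toAddMonoidHom
      (prodPow (opCurv (ϑ j) b) k) v
    refine Eq.trans ?_ h1.symm
    congr 1
    ext w
    exact (map_prodPow (conjHom ρ (P.g i j b)) _ k w).symm

theorem inChart_prodPow (h : IsConnectionFamily P ϑ) (k : ℕ) (i : I)
    {e : OpenPartialHomeomorph B H} (he : e ∈ atlas H B) {x : H}
    (hx : x ∈ e.target ∩ e.symm ⁻¹' P.U i) :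
    Form.inChart (fun b => altSum (prodPow (opCurv (ϑ i) b) k)) e x =
      altSum (prodPow (curvature ((ϑ i).inChart₁ e) x) k) := by
  ext v
  simp only [Form.inChart, altSum_map_args, prodPow_map_args]
  rw [← opCurv_inChart (P.isOpen_U i) (h.smooth i) he hx]
  rfl

theorem diff_smooth (h : IsConnectionFamily P ϑ) (h' : IsConnectionFamily P ϑ') (i : I) :
    IsSmoothFormOn (fun b v => ϑ' i b v - ϑ i b v) (P.U i) := by
  refine ⟨fun b hb => ?_, fun e he => ?_⟩
  · obtain ⟨a, ha⟩ := (h.smooth i).1 b hb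
    obtain ⟨a', ha'⟩ := (h'.smooth i).1 b hb
    exact ⟨a' - a, fun v => by simp [ha, ha']⟩
  · exact ((h'.smooth i).2 e he).sub ((h.smooth i).2 e he)

theorem inChart_transProd (h : IsConnectionFamily P ϑ) (η : Form H B A 1) (k : ℕ)
    (i : I) {e : OpenPartialHomeomorph B H} (he : e ∈ atlas H B) {x : H}
    (hx : x ∈ e.target ∩ e.symm ⁻¹' P.U i) :
    Form.inChart (fun b => altSum (transProd (opCurv (ϑ i) b) (fun u => η b fun _ => u) k)) e x =
      altSum (transProd (curvature ((ϑ i).inChart₁ e) x) (fun u => η.inChart₁ e (x, u)) k) := by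
  ext v
  simp only [Form.inChart, altSum_map_args, transProd_map_args]
  rw [← opCurv_inChart (P.isOpen_U i) (h.smooth i) he hx]
  rfl

/-- Three families occur because the curvature is that of an intermediate connection `ϑ₀`, while `η`
is the difference of the endpoints. -/
theorem isAdForm_transProd {ϑ₀ : I → Form H B A 1} (h₀ : IsConnectionFamily P ϑ₀)
    (h : IsConnectionFamily P ϑ) (h' : IsConnectionFamily P ϑ') (k : ℕ) :
    IsAdForm P fun i b => altSum (transProd (opCurv (ϑ₀ i) b)
      (fun u => ϑ' i b (fun _ => u) - ϑ i b (fun _ => u)) k) where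
  smooth i := by
    have hη := h.diff_smooth h' i
    refine ⟨fun b hb => ?_, fun e he => ?_⟩
    · obtain ⟨a, ha⟩ := hη.1 b hb
      have h1 := ((isMultilinear_opCurv (P.isOpen_U i) (h₀.smooth i) hb).transProd
        ((MultilinearMap.ofSubsingleton ℝ H A (0 : Fin 1)).symm a.toMultilinearMap) k).altSum
      have h2 : (fun u => ϑ' i b (fun _ => u) - ϑ i b (fun _ => u)) =
          (MultilinearMap.ofSubsingleton ℝ H A (0 : Fin 1)).symm a.toMultilinearMap := by
        ext u
        exact ha fun _ => u
      rw [← h2] at h1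
      exact h1
    · have hO := isOpen_preimage e (P.isOpen_U i)
      have h1 := smoothOn_altSum (smoothOn_transProd
        (smoothOn_curvature hO ((h₀.smooth i).smoothOn_inChart₁ he))
        (hη.smoothOn_inChart₁ he) k)
      refine h1.congr (hO.prod isOpen_univ) fun p hp => ?_
      exact (congrFun (h₀.inChart_transProd (fun b v => ϑ' i b v - ϑ i b v) k i he hp.1) p.2).symm
  change i j b hb v := by
    rw [h₀.opCurv_change i j hb]
    have h1 := map_altSum (conjHom ρ (P.g i j b)).toAddMonoidHom
      (transProd (opCurv (ϑ₀ j) b) (fun u => ϑ' j b (fun _ => u) - ϑ j b (fun _ => u)) k) v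
    refine Eq.trans ?_ h1.symm
    have h2 : (fun u => ϑ' i b (fun _ => u) - ϑ i b (fun _ => u)) =
        fun u => conjHom ρ (P.g i j b) (ϑ' j b (fun _ => u) - ϑ j b (fun _ => u)) :=
      funext fun u => h.diff_change h' i j hb fun _ => u
    rw [h2]
    congr 1
    ext w
    exact (map_transProd (conjHom ρ (P.g i j b)) _ _ k w).symm

/-- The Chern-Weil forms of a connection that commutes with `λ` are closed. -/
theorem extD_glue_prodPow (h : IsConnectionFamily P ϑ) (Λ : AdMorphism P) (hc : Λ.Commutes ϑ)
    (k : ℕ) (b : B) (v : Fin (2 * k + 1) → H) :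
    extD (Λ.glue fun i b => altSum (prodPow (opCurv (ϑ i) b) k)) b v = 0 := by
  have hb := P.mem_indexAt b
  have hO := isOpen_preimage (chartAt H b) (P.isOpen_U (P.indexAt b))
  have hx := AdMorphism.mem_chartAt_preimage (H := H) hb
  rw [Λ.extD_glue (h.isAdForm_prodPow k) hc hb, covExtD_congr _ hO hx
    fun y hy => h.inChart_prodPow k (P.indexAt b) (chart_mem_atlas H b) hy,
    covExtD_prodPow_curvature hO ((h.smooth _).smoothOn_inChart₁ (chart_mem_atlas H b)) hx,
    map_zero]

end IsConnectionFamily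

theorem extD_finset_sum {T : Type*} (s : Finset T) (ω : T → Form H B ℂ n)
    (hω : ∀ τ ∈ s, IsSmoothFormOn (ω τ) univ) (b : B) (v : Fin (n + 1) → H) :
    extD (fun b v => ∑ τ ∈ s, ω τ b v) b v = ∑ τ ∈ s, extD (ω τ) b v := by
  have hO := isOpen_preimage (chartAt H b) isOpen_univ
  have hx : chartAt H b b ∈ (chartAt H b).target ∩ (chartAt H b).symm ⁻¹' univ :=
    ⟨mem_chart_target H b, mem_univ _⟩
  unfold extD
  rw [Finset.sum_comm]
  refine Finset.sum_congr rfl fun i _ => ?_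
  rw [← Finset.smul_sum]
  congr 1
  classical
  induction s using Finset.induction_on with
  | empty => exact (HasDirDeriv.const 0 _ _).dirDeriv_eq
  | insert a s ha ih =>
    rw [Finset.sum_insert ha, ← ih fun τ hτ => hω τ (by simp [hτ])]
    have hs : ∀ τ ∈ insert a s, SmoothOn (fun x => (ω τ).inChart (chartAt H b) x (i.removeNth v))
        ((chartAt H b).target ∩ (chartAt H b).symm ⁻¹' univ) := fun τ hτ =>
      SmoothOn.partial_fst hO ((hω τ hτ).2 _ (chart_mem_atlas H b)) _
    have h2 := ((hs a (by simp)).hasDirDeriv hx (v i)).add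
      ((SmoothOn.sum s fun τ hτ => hs τ (by simp [hτ])).hasDirDeriv hx (v i))
    refine Eq.trans ?_ h2.dirDeriv_eq
    congr 1
    ext x
    exact Finset.sum_insert ha

theorem isSmoothFormOn_finset_sum {T : Type*} (s : Finset T) (ω : T → Form H B ℂ n) {W : Set B}
    (hω : ∀ τ ∈ s, IsSmoothFormOn (ω τ) W) :
    IsSmoothFormOn (fun b v => ∑ τ ∈ s, ω τ b v) W := by
  classical
  refine ⟨fun b hb => ?_, fun e he => SmoothOn.sum s fun τ hτ => (hω τ hτ).2 e he⟩
  induction s using Finset.induction_on with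
  | empty => exact ⟨0, fun v => by simp⟩
  | insert τ s hτ ih =>
    obtain ⟨a, ha⟩ := (hω τ (by simp)).1 b hb
    obtain ⟨a', ha'⟩ := ih fun σ hσ => hω σ (by simp [hσ])
    exact ⟨a + a', fun v => by simp [Finset.sum_insert hτ, ha, ← ha']⟩

/-- The Chern-Weil forms of two connections that commute with `λ` differ by an exact form. -/
theorem IsConnectionFamily.exists_transgression {ϑ ϑ' : I → Form H B A 1}
    (h : IsConnectionFamily P ϑ) (h' : IsConnectionFamily P ϑ') (Λ : AdMorphism P)
    (hc : Λ.Commutes ϑ) (hc' : Λ.Commutes ϑ') (k : ℕ) :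
    ∃ τ : Form H B ℂ (2 * k + 1), IsSmoothFormOn τ univ ∧ ∀ b v,
      Λ.glue (fun i b => altSum (prodPow (opCurv (ϑ' i) b) (k + 1))) b v -
        Λ.glue (fun i b => altSum (prodPow (opCurv (ϑ i) b) (k + 1))) b v = extD τ b v := by
  -- The `(k + 1)`-st power of the curvature has degree at most `2k + 2` in the parameter, so `2k +
  -- 2` nodes integrate its derivative exactly.
  obtain ⟨w, t, hw⟩ := exists_quadrature_weights (2 * k + 1 + 1)
  let ϑt : ℝ → I → Form H B A 1 := fun s i b v => ϑ i b v + s • (ϑ' i b v - ϑ i b v)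
  have ht : ∀ s, IsConnectionFamily P (ϑt s) := fun s => h.affine h' s
  have hct : ∀ s, Λ.Commutes (ϑt s) := fun s => hc.affine hc' s
  let F : ℝ → I → Form H B A (2 * k + 1) := fun s i b => altSum (transProd (opCurv (ϑt s i) b)
      (fun u => ϑ' i b (fun _ => u) - ϑ i b (fun _ => u)) k)
  have hF : ∀ s, IsAdForm P (F s) := fun s => (ht s).isAdForm_transProd h h' k
  have hsm : ∀ q ∈ Finset.univ, IsSmoothFormOn
      ((Λ.scale ((2 * w q : ℝ) : ℂ)).glue (F (t q))) univ := fun q _ =>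
    (Λ.scale _).isSmoothFormOn_glue (hF (t q))
  refine ⟨fun b v => ∑ q, (Λ.scale ((2 * w q : ℝ) : ℂ)).glue (F (t q)) b v,
    isSmoothFormOn_finset_sum _ _ hsm, fun b v => ?_⟩
  rw [extD_finset_sum _ _ hsm]
  set i := P.indexAt b with hi
  have hb : b ∈ P.U i := P.mem_indexAt b
  have hca := chart_mem_atlas H b
  have hO := isOpen_preimage (chartAt H b) (P.isOpen_U i)
  have hx := AdMorphism.mem_chartAt_preimage (H := H) hb
  have hT := (h.smooth i).smoothOn_inChart₁ hca
  have hη := (h.diff_smooth h' i).smoothOn_inChart₁ hca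
  change Λ.form i b (altSum (prodPow (opCurv (ϑ' i) b) (k + 1)) v) -
    Λ.form i b (altSum (prodPow (opCurv (ϑ i) b) (k + 1)) v) = _
  rw [← map_sub, opCurv_eq_curvature (P.isOpen_U i) (h.smooth i) hb,
    opCurv_eq_curvature (P.isOpen_U i) (h'.smooth i) hb]
  have h1 : (ϑ' i).inChart₁ (chartAt H b) = fun p => (ϑ i).inChart₁ (chartAt H b) p +
      Form.inChart₁ (fun b v => ϑ' i b v - ϑ i b v) (chartAt H b) p := by
    ext p
    exact (add_sub_cancel _ _).symm
  rw [h1, prodPow_curvature_sub hO hT hη hx (N := 2 * k + 1) (by omega) hw, map_sum]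
  refine Finset.sum_congr rfl fun q _ => ?_
  rw [(Λ.scale _).extD_glue (hF (t q)) ((hct (t q)).scale _) hb, AdMorphism.scale_form,
    Complex.coe_smul]
  congr 2
  exact (covExtD_congr _ hO hx (fun y hy => (ht (t q)).inChart_transProd
    (fun b v => ϑ' i b v - ϑ i b v) k i hca hy) v).symm

end Families

/-! ## Representations of Frechet Lie groups -/

section LieGroup

variable {L : Type*} [AddCommGroup L] [Module ℝ L] [TopologicalSpace L] [FrechetSpace L]
  {G : Type*} [Group G] [TopologicalSpace G] [IsTopologicalGroup G] [ChartedSpace L G]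
  [FrechetLieGroup L G]
  {K : Type*} [AddCommGroup K] [Module ℝ K] [TopologicalSpace K] [IsTopologicalAddGroup K]
  [ContinuousSMul ℝ K]

/-- Smoothness of the multiplication with the first coordinate frozen at that of `h`. -/
theorem smoothOn_mul_left (h : G) {d c : OpenPartialHomeomorph G L} (hd : d ∈ atlas L G)
    (hc : c ∈ atlas L G) :
    SmoothOn (fun z => c (h * d.symm z)) (d.target ∩ d.symm ⁻¹' {g | h * g ∈ c.source}) := by
  have hh : ∀ p : L, (chartAt L h).symm (chartAt L h h) = h := fun _ =>
    (chartAt L h).left_inv (mem_chart_source L h)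
  have h1 := FrechetLieGroup.smooth_mul (L := L) (chartAt L h) (chart_mem_atlas L h) d hd c hc
  have hO : IsOpen {p : L × L | p.1 ∈ (chartAt L h).target ∧ p.2 ∈ d.target ∧
      (chartAt L h).symm p.1 * d.symm p.2 ∈ c.source} := by
    have h2 : ContinuousOn (fun p : L × L => (chartAt L h).symm p.1 * d.symm p.2)
        ((chartAt L h).target ×ˢ d.target) :=
      ((chartAt L h).symm.continuousOn.comp continuousOn_fst fun p hp => hp.1).mul
        (d.symm.continuousOn.comp continuousOn_snd fun p hp => hp.2)
    have h3 := h2.isOpen_inter_preimage ((chartAt L h).open_target.prod d.open_target)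
      c.open_source
    convert h3 using 1
    ext p
    simp [and_assoc]
  have h4 := h1.comp ((SmoothOn.const (chartAt L h h)
    (d.target ∩ d.symm ⁻¹' {g | h * g ∈ c.source})).prodMk
    (SmoothOn.clm (ContinuousLinearMap.id ℝ L) _)) hO (by
      intro z hz
      refine ⟨mem_chart_target L h, hz.1, ?_⟩
      rw [hh z]
      exact hz.2)
  simpa [hh] using h4

theorem smoothOn_mul_right (h : G) {d c : OpenPartialHomeomorph G L} (hd : d ∈ atlas L G)
    (hc : c ∈ atlas L G) :
    SmoothOn (fun z => c (d.symm z * h)) (d.target ∩ d.symm ⁻¹' {g | g * h ∈ c.source}) := by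
  have hh : ∀ p : L, (chartAt L h).symm (chartAt L h h) = h := fun _ =>
    (chartAt L h).left_inv (mem_chart_source L h)
  have h1 := FrechetLieGroup.smooth_mul (L := L) d hd (chartAt L h) (chart_mem_atlas L h) c hc
  have hO : IsOpen {p : L × L | p.1 ∈ d.target ∧ p.2 ∈ (chartAt L h).target ∧
      d.symm p.1 * (chartAt L h).symm p.2 ∈ c.source} := by
    have h2 : ContinuousOn (fun p : L × L => d.symm p.1 * (chartAt L h).symm p.2)
        (d.target ×ˢ (chartAt L h).target) :=
      (d.symm.continuousOn.comp continuousOn_fst fun p hp => hp.1).mul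
        ((chartAt L h).symm.continuousOn.comp continuousOn_snd fun p hp => hp.2)
    have h3 := h2.isOpen_inter_preimage (d.open_target.prod (chartAt L h).open_target)
      c.open_source
    convert h3 using 1
    ext p
    simp [and_assoc]
  have h4 := h1.comp ((SmoothOn.clm (ContinuousLinearMap.id ℝ L)
    (d.target ∩ d.symm ⁻¹' {g | g * h ∈ c.source})).prodMk
    (SmoothOn.const (chartAt L h h) _)) hO (by
      intro z hz
      refine ⟨hz.1, mem_chart_target L h, ?_⟩
      rw [hh z]
      exact hz.2)
  simpa [hh] using h4

/-- The map `γ` into the Lie group is continuous at `x` and has a directional derivative there. -/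
def HasDirDerivInChart (L : Type*) [AddCommGroup L] [Module ℝ L] [TopologicalSpace L]
    [ChartedSpace L G] (γ : K → G) (x u : K) : Prop :=
  ContinuousAt γ x ∧ ∃ d ∈ atlas L G, γ x ∈ d.source ∧ ∃ a, HasDirDeriv (fun y => d (γ y)) x u a

namespace HasDirDerivInChart

variable {γ : K → G} {x u : K}

/-- Only existence matters: `Ad` and `mcForm` are defined through `limUnder`, and become usable once
the underlying limits are known to exist. -/
theorem mul_left (hγ : HasDirDerivInChart L γ x u) (h : G) {c : OpenPartialHomeomorph G L}
    (hc : c ∈ atlas L G) (hx : h * γ x ∈ c.source) :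
    ∃ a, HasDirDeriv (fun y => c (h * γ y)) x u a := by
  obtain ⟨hcont, d, hd, hxd, a, ha⟩ := hγ
  have hO : IsOpen (d.target ∩ d.symm ⁻¹' {g | h * g ∈ c.source}) :=
    isOpen_preimage d (c.open_source.preimage (continuous_const_mul h))
  have h1 := (smoothOn_mul_left h hd hc).dirDeriv_comp hO ha
    ⟨d.map_source hxd, by rw [mem_preimage, d.left_inv hxd]; exact hx⟩
  refine ⟨_, h1.congr ?_⟩
  filter_upwards [hcont (d.open_source.mem_nhds hxd)] with y hy
  rw [d.left_inv hy]

theorem mul_right (hγ : HasDirDerivInChart L γ x u) (h : G) {c : OpenPartialHomeomorph G L}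
    (hc : c ∈ atlas L G) (hx : γ x * h ∈ c.source) :
    ∃ a, HasDirDeriv (fun y => c (γ y * h)) x u a := by
  obtain ⟨hcont, d, hd, hxd, a, ha⟩ := hγ
  have hO : IsOpen (d.target ∩ d.symm ⁻¹' {g | g * h ∈ c.source}) :=
    isOpen_preimage d (c.open_source.preimage (continuous_mul_const h))
  have h1 := (smoothOn_mul_right h hd hc).dirDeriv_comp hO ha
    ⟨d.map_source hxd, by rw [mem_preimage, d.left_inv hxd]; exact hx⟩
  refine ⟨_, h1.congr ?_⟩
  filter_upwards [hcont (d.open_source.mem_nhds hxd)] with y hy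
  rw [d.left_inv hy]

end HasDirDerivInChart

variable {A : Type*} [Ring A] [Algebra ℂ A] [TopologicalSpace A] [FrechetSpace A]
  [ContinuousMul A] {ρ : G →* A}

/-- The derivative of the representation `ρ` as a continuous linear map. -/
def dRepL (hρ : SmoothFunOn L (fun g : G => ρ g) univ) : L →L[ℝ] A :=
  (hρ (chartAt L (1 : G)) (chart_mem_atlas L 1)).fderivL (isOpen_preimage _ isOpen_univ)
    ⟨mem_chart_target L (1 : G), mem_univ _⟩

theorem dRep_eq (hρ : SmoothFunOn L (fun g : G => ρ g) univ) (a : L) :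
    dRep ρ a = dRepL hρ a := rfl

theorem hasDirDeriv_rep (hρ : SmoothFunOn L (fun g : G => ρ g) univ) {γ : K → G} {x u : K}
    (hγ : ContinuousAt γ x) (h1 : γ x = 1) {a : L}
    (ha : HasDirDeriv (fun y => chartAt L (1 : G) (γ y)) x u a) :
    HasDirDeriv (fun y => ρ (γ y)) x u (dRep ρ a) := by
  set c := chartAt L (1 : G) with hc
  have h2 := (hρ c (chart_mem_atlas L 1)).dirDeriv_comp (isOpen_preimage c isOpen_univ) ha
    ⟨by rw [h1]; exact mem_chart_target L (1 : G), mem_univ _⟩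
  rw [h1] at h2
  refine HasDirDeriv.congr h2 ?_
  filter_upwards [hγ (c.open_source.mem_nhds (by rw [h1]; exact mem_chart_source L (1 : G)))]
    with y hy
  rw [c.left_inv hy]

theorem hasDirDeriv_rep_chart (hρ : SmoothFunOn L (fun g : G => ρ g) univ) (a : L) :
    HasDirDeriv (fun z => ρ ((chartAt L (1 : G)).symm z)) (chartAt L (1 : G) 1) a (dRep ρ a) :=
  (hρ _ (chart_mem_atlas L 1)).hasDirDeriv ⟨mem_chart_target L (1 : G), mem_univ _⟩ a

/-- The derivative of `z ↦ ρ(g z g⁻¹)` at `1` is computed twice, through the chart of `G` and by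
Leibniz in `A`. Conjugation is treated as a left translation followed by a right one. -/
theorem dRep_Ad (hρ : SmoothFunOn L (fun g : G => ρ g) univ) (g : G) (a : L) :
    dRep ρ (Ad g a) = ρ g * dRep ρ a * ρ g⁻¹ := by
  set c := chartAt L (1 : G) with hc
  set x := c 1 with hx
  have hca : c ∈ atlas L G := chart_mem_atlas L 1
  have hxt : x ∈ c.target := mem_chart_target L (1 : G)
  have h1 : c.symm x = 1 := c.left_inv (mem_chart_source L (1 : G))
  have hcont : ContinuousAt c.symm x := c.symm.continuousAt hxt
  have hγ0 : HasDirDerivInChart L c.symm x a := by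
    refine ⟨hcont, c, hca, c.map_target hxt, a, ?_⟩
    refine HasDirDeriv.congr (hasDirDeriv_continuousLinearMap (ContinuousLinearMap.id ℝ L) x a) ?_
    filter_upwards [c.open_target.mem_nhds hxt] with y hy
    exact (c.right_inv hy).symm
  have hγ1 : HasDirDerivInChart L (fun z => g * c.symm z) x a :=
    ⟨continuousAt_const.mul hcont, chartAt L (g * c.symm x), chart_mem_atlas L _,
      mem_chart_source L _, hγ0.mul_left g (chart_mem_atlas L _) (mem_chart_source L _)⟩
  have hval : g * c.symm x * g⁻¹ = 1 := by rw [h1, mul_one, mul_inv_cancel]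
  obtain ⟨w, hw⟩ := hγ1.mul_right g⁻¹ hca (by rw [hval]; exact mem_chart_source L (1 : G))
  have h2 : Ad g a = w := hw.dirDeriv_eq
  have h3 := hasDirDeriv_rep hρ (γ := fun z => g * c.symm z * g⁻¹)
    ((continuousAt_const.mul hcont).mul continuousAt_const) hval hw
  have h4 := ((HasDirDeriv.const (ρ g) x a).mul (hasDirDeriv_rep_chart hρ a)).mul
    (HasDirDeriv.const (ρ g⁻¹) x a)
  rw [h2, ← h3.dirDeriv_eq]
  simp only [map_mul]
  rw [h4.dirDeriv_eq]
  simp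

variable {H : Type*} [AddCommGroup H] [Module ℝ H] [TopologicalSpace H] [FrechetSpace H]
  {B : Type*} [TopologicalSpace B] [ChartedSpace H B] [FrechetManifold H B]

theorem smoothFunOn_rep_comp (hρ : SmoothFunOn L (fun g : G => ρ g) univ) {g : B → G} {W : Set B}
    (hW : IsOpen W) (hg : SmoothMapOn H L g W) : SmoothFunOn H (fun b => ρ (g b)) W := by
  intro e he
  refine SmoothOn.of_local (isOpen_preimage e hW) fun x hx => ?_
  set d := chartAt L (g (e.symm x)) with hd
  have hda : d ∈ atlas L G := chart_mem_atlas L _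
  have hW' : IsOpen (W ∩ g ⁻¹' d.source) := hg.1.isOpen_inter_preimage hW d.open_source
  have hO := isOpen_preimage e hW'
  refine ⟨e.target ∩ e.symm ⁻¹' (W ∩ g ⁻¹' d.source), hO,
    ⟨hx.1, hx.2, mem_chart_source L _⟩, ?_⟩
  have h1 := (hρ d hda).comp (hg.2 e he d hda) (isOpen_preimage d isOpen_univ)
    fun y hy => ⟨d.map_source hy.2.2, mem_univ _⟩
  refine (h1.congr hO fun y hy => ?_).mono inter_subset_right
  simp only [d.left_inv hy.2.2]

/-- As for `dRep_Ad`, with the curve `y ↦ g(b)⁻¹ g(y)`, which passes through `1` at `b`. -/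
theorem dRep_mcForm (hρ : SmoothFunOn L (fun g : G => ρ g) univ) {g : B → G} {W : Set B}
    (hW : IsOpen W) (hg : SmoothMapOn H L g W) {b : B} (hb : b ∈ W) (v : H) :
    dRep ρ (mcForm (L := L) g b v) = ρ (g b)⁻¹ * mDeriv H (fun y => ρ (g y)) b v := by
  set c := chartAt H b with hc
  set x := c b with hx
  have hca : c ∈ atlas H B := chart_mem_atlas H b
  have hxt : x ∈ c.target := mem_chart_target H b
  have hxb : c.symm x = b := c.left_inv (mem_chart_source H b)
  set d := chartAt L (g b) with hd
  have hda : d ∈ atlas L G := chart_mem_atlas L _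
  have hcont : ContinuousAt (fun y => g (c.symm y)) x := by
    refine ContinuousAt.comp (g := g) ?_ (c.symm.continuousAt hxt)
    rw [hxb]
    exact hg.1.continuousAt (hW.mem_nhds hb)
  have hγ0 : HasDirDerivInChart L (fun y => g (c.symm y)) x v :=
    ⟨hcont, d, hda, by change g (c.symm x) ∈ d.source; rw [hxb]; exact mem_chart_source L _, _,
      (hg.2 c hca d hda).hasDirDeriv ⟨hxt, by
        rw [mem_preimage, hxb]
        exact ⟨hb, mem_chart_source L _⟩⟩ v⟩
  have hval : (g b)⁻¹ * g (c.symm x) = 1 := by rw [hxb, inv_mul_cancel]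
  obtain ⟨w, hw⟩ := hγ0.mul_left (g b)⁻¹ (chart_mem_atlas L (1 : G))
    (by rw [hval]; exact mem_chart_source L (1 : G))
  have h2 : mcForm (L := L) g b v = w := hw.dirDeriv_eq
  have h3 := hasDirDeriv_rep hρ (γ := fun y => (g b)⁻¹ * g (c.symm y))
    (continuousAt_const.mul hcont) hval hw
  have h4 := (HasDirDeriv.const (ρ (g b)⁻¹) x v).mul
    ((smoothFunOn_rep_comp hρ hW hg c hca).hasDirDeriv
      ⟨hxt, by rw [mem_preimage, hxb]; exact hb⟩ v)
  rw [h2, ← h3.dirDeriv_eq]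
  simp only [map_mul]
  rw [h4.dirDeriv_eq]
  simp
  rfl

end LieGroup

/-! ## Connections of bundles with structure group -/

section Main

variable {H : Type*} [AddCommGroup H] [Module ℝ H] [TopologicalSpace H] [FrechetSpace H]
  {B : Type*} [TopologicalSpace B] [ChartedSpace H B] [FrechetManifold H B]
  {L : Type*} [AddCommGroup L] [Module ℝ L] [TopologicalSpace L] [FrechetSpace L]
  {G : Type*} [Group G] [TopologicalSpace G] [IsTopologicalGroup G] [ChartedSpace L G]
  [FrechetLieGroup L G]
  {A : Type*} [Ring A] [Algebra ℂ A] [TopologicalSpace A] [FrechetSpace A] [ContinuousMul A]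
  {ρ : G →* A}
  {V : Type*} [AddCommGroup V] [Module ℂ V] [TopologicalSpace V] [Module A V]
  {I : Type*} {E : B → Type*} [∀ b, AddCommGroup (E b)] [∀ b, Module ℂ (E b)]
  {P : GVectorBundle H L ρ V I E}

/-- Under `dRep` the adjoint action becomes conjugation and the Maurer-Cartan term becomes `ρ(g)⁻¹
d(ρ(g))`; multiplying by `ρ(g)` on the left clears the inverse. -/
theorem Connection.isConnectionFamily (hρ : SmoothFunOn L (fun g : G => ρ g) univ)
    (D : Connection P) : IsConnectionFamily P D.opForm where
  smooth_trans i j :=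
    smoothFunOn_rep_comp hρ ((P.isOpen_U i).inter (P.isOpen_U j)) (P.smooth_g i j)
  smooth i := by
    refine ⟨fun b hb => ?_, fun e he => ((D.smooth_θ i).2 e he).clm_comp (dRepL hρ)⟩
    obtain ⟨a, ha⟩ := (D.smooth_θ i).1 b hb
    refine ⟨(dRepL hρ).toLinearMap.compAlternatingMap a, fun v => ?_⟩
    change dRep ρ (D.θ i b v) = dRepL hρ (a v)
    rw [ha, dRep_eq hρ]
  gauge i j b hb v := by
    have h1 : ρ (P.g i j b) * ρ (P.g i j b)⁻¹ = 1 := by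
      rw [← map_mul, mul_inv_cancel, map_one]
    change ρ (P.g i j b) * dRep ρ (D.θ j b v) = dRep ρ (D.θ i b v) * ρ (P.g i j b) + _
    rw [D.gauge i j b hb, dRep_eq hρ, map_add, ← dRep_eq hρ, ← dRep_eq hρ, dRep_Ad hρ,
      dRep_mcForm hρ ((P.isOpen_U i).inter (P.isOpen_U j)) (P.smooth_g i j) hb, inv_inv, mul_add,
      ← mul_assoc, ← mul_assoc, ← mul_assoc, h1, one_mul, one_mul]

/-- A function `s` of the coordinates is a coordinate expression of the local section `s ∘ chartAt H
b`, to which the hypothesis applies. -/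
theorem AdMorphism.CommutesWith.commutes {Λ : AdMorphism P} {D : Connection P}
    (h : Λ.CommutesWith D) : Λ.Commutes D.opForm := by
  intro i b hb s hs u
  set c := chartAt H b with hc
  have hca : c ∈ atlas H B := chart_mem_atlas H b
  have hW : IsOpen (c.source ∩ P.U i) := c.open_source.inter (P.isOpen_U i)
  have hσ : SmoothFunOn H (fun b' => s (c b')) (c.source ∩ P.U i) := by
    intro e he
    refine hs.comp ((smoothOn_transition he hca).mono fun y hy => ⟨hy.1, hy.2.1⟩)
      (isOpen_preimage c (P.isOpen_U i)) fun y hy => ⟨c.map_source hy.2.1, ?_⟩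
    rw [mem_preimage, c.left_inv hy.2.1]
    exact hy.2.2
  have hloc : ∀ᶠ y in 𝓝 (c b), c (c.symm y) = y := by
    filter_upwards [c.open_target.mem_nhds (mem_chart_target H b)] with y hy
    exact c.right_inv hy
  have h1 := h i _ hW inter_subset_right _ hσ b ⟨mem_chart_source H b, hb⟩ u
  have h2 : mDeriv H (fun b' => s (c b')) b u = dirDeriv s (c b) u := by
    refine dirDeriv_congr ?_ u
    filter_upwards [hloc] with y hy
    rw [hy]
  have h3 : mDeriv H (fun b' => Λ.form i b' (s (c b'))) b u =
      dirDeriv (fun x => Λ.form i (c.symm x) (s x)) (c b) u := by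
    refine dirDeriv_congr ?_ u
    filter_upwards [hloc] with y hy
    rw [hy]
  rw [← h3, h1, Connection.adNabla, h2]

/-- All constants move into `scale`, so only antisymmetrized powers of the curvature remain to be
studied. -/
theorem AdMorphism.chernForm_eq_glue (Λ : AdMorphism P) (D : Connection P) (f : ℂ → ℂ) (k : ℕ) :
    Λ.chernForm D f k =
      (Λ.scale (iteratedDeriv k f 0 / (k.factorial : ℂ) * ((((2 : ℝ) ^ k)⁻¹ : ℝ) : ℂ))).glue
        fun i b => altSum (prodPow (opCurv (D.opForm i) b) k) := by
  ext b v
  change Λ.form _ b (_ • wedgePow (opCurv (D.opForm _) b) k v) = Λ.form _ b _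
  rw [wedgePow_eq_altSum, ← Complex.coe_smul, smul_smul]
  rfl

theorem AdMorphism.induced_commutesWith (hρ : SmoothFunOn L (fun g : G => ρ g) univ)
    (l : A →L[ℝ] ℂ) (hl : AdInvariant ρ l) (D : Connection P) :
    (AdMorphism.induced P l hl).CommutesWith D := by
  intro i W hW _ σ hσ b hb v
  change mDeriv H (fun b' => l (σ b')) b v = l (mDeriv H σ b v +
    (D.opForm i b (fun _ => v) * σ b - σ b * D.opForm i b (fun _ => v)))
  have hx : chartAt H b b ∈ (chartAt H b).target ∩ (chartAt H b).symm ⁻¹' W :=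
    ⟨mem_chart_target H b, by
      rw [mem_preimage, (chartAt H b).left_inv (mem_chart_source H b)]; exact hb⟩
  have h1 : mDeriv H (fun b' => l (σ b')) b v = l (mDeriv H σ b v) :=
    (((hσ _ (chart_mem_atlas H b)).hasDirDeriv hx v).clm l).dirDeriv_eq
  have h2 : ∀ (s : A) (a : L), l (dRep ρ a * s - s * dRep ρ a) = 0 := by
    intro s a
    have hd := hasDirDeriv_rep_chart hρ a
    have h3 := ((hd.mul (HasDirDeriv.const s _ a)).sub
      ((HasDirDeriv.const s _ a).mul hd)).clm l
    simp only [mul_zero, add_zero, zero_mul, zero_add] at h3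
    rw [← h3.dirDeriv_eq]
    have h4 : ∀ g : G, l (ρ g * s - s * ρ g) = 0 := by
      intro g
      -- Invariance at `s * ρ g`, where the conjugate collapses to `ρ g * s`; the identity `h4` is
      -- then differentiated at `g = 1`.
      have h5 := hl g (s * ρ g)
      rw [← mul_assoc, mul_assoc, ← map_mul, mul_inv_cancel, map_one, mul_one] at h5
      rw [map_sub, h5, sub_self]
    simp only [h4]
    exact (HasDirDeriv.const 0 _ _).dirDeriv_eq
  rw [h1, map_add]
  change _ = _ + l (dRep ρ _ * σ b - σ b * dRep ρ _)
  rw [h2, add_zero]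

theorem sameDeRhamClass_of_eq {k : ℕ} {ω ω' : Form H B ℂ k} (hk : k = 0)
    (h : ∀ b v, ω b v = ω' b v) : SameDeRhamClass ω ω' := by
  subst hk
  exact fun b v => sub_eq_zero.2 (h b v)

theorem sameDeRhamClass_of_extD {k : ℕ} {ω ω' : Form H B ℂ (k + 1)} (τ : Form H B ℂ k)
    (hτ : IsSmoothFormOn τ univ) (h : ∀ b v, ω b v - ω' b v = extD τ b v) :
    SameDeRhamClass ω ω' :=
  ⟨τ, hτ, h⟩

theorem AdMorphism.sameDeRhamClass_chernForm (hρ : SmoothFunOn L (fun g : G => ρ g) univ)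
    (Λ : AdMorphism P) (f : ℂ → ℂ) {D D' : Connection P} (hD : Λ.CommutesWith D)
    (hD' : Λ.CommutesWith D') (k : ℕ) :
    SameDeRhamClass (Λ.chernForm D f k) (Λ.chernForm D' f k) := by
  cases k with
  | zero =>
    -- In degree zero the power of the curvature is the constant `1`, so the connection does not
    -- enter.
    have h (D : Connection P) (b : B) (v : Fin (2 * 0) → H) : Λ.chernForm D f 0 b v =
        Λ.form (P.indexAt b) b ((iteratedDeriv 0 f 0 / (Nat.factorial 0 : ℂ)) • (1 : A)) := rfl
    exact sameDeRhamClass_of_eq rfl fun b v => (h D b v).trans (h D' b v).symm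
  | succ k =>
    rw [Λ.chernForm_eq_glue, Λ.chernForm_eq_glue]
    generalize iteratedDeriv (k + 1) f 0 / ((k + 1).factorial : ℂ) *
      ((((2 : ℝ) ^ (k + 1))⁻¹ : ℝ) : ℂ) = c
    -- The segment runs from `D'` to `D`, to match the order of the difference in `SameDeRhamClass`.
    obtain ⟨τ, hτ, h⟩ := (D'.isConnectionFamily hρ).exists_transgression
      (D.isConnectionFamily hρ) _ (hD'.commutes.scale c) (hD.commutes.scale c) k
    exact sameDeRhamClass_of_extD (k := 2 * k + 1) τ hτ h

end Main

end FrechetCW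

end

theorem proposition2p2
    {H : Type*} [AddCommGroup H] [Module ℝ H] [TopologicalSpace H] [FrechetCW.FrechetSpace H]
    {B : Type*} [TopologicalSpace B] [ChartedSpace H B] [FrechetCW.FrechetManifold H B]
    {L : Type*} [AddCommGroup L] [Module ℝ L] [TopologicalSpace L] [FrechetCW.FrechetSpace L]
    {G : Type*} [Group G] [TopologicalSpace G] [IsTopologicalGroup G] [ChartedSpace L G]
    [FrechetCW.FrechetLieGroup L G]
    {A : Type*} [Ring A] [Algebra ℂ A] [TopologicalSpace A] [FrechetCW.FrechetSpace A]
    [ContinuousMul A]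
    {ρ : G →* A} (hρ : FrechetCW.SmoothFunOn L (fun g : G => ρ g) Set.univ)
    {V : Type*} [AddCommGroup V] [Module ℂ V] [TopologicalSpace V] [FrechetCW.FrechetSpace V]
    [Module A V] [IsScalarTower ℂ A V] [ContinuousSMul A V]
    {I : Type*} {E : B → Type*} [∀ b, AddCommGroup (E b)] [∀ b, Module ℂ (E b)]
    (P : FrechetCW.GVectorBundle H L ρ V I E) :
    -- every morphism `λ : Ad P → B × ℂ` and every analytic function `f`
    (∀ (Λ : FrechetCW.AdMorphism P) (f : ℂ → ℂ), AnalyticOnNhd ℂ f Set.univ →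
      -- `λ(f(Ω))` is a well defined smooth closed form if `d ∘ λ = λ ∘ ∇^ad`
      (∀ D : FrechetCW.Connection P, Λ.CommutesWith D → ∀ k : ℕ,
        (∀ i, ∀ b ∈ P.U i, ∀ v, Λ.chernForm D f k b v = Λ.form i b (D.curvFun f k i b v)) ∧
        FrechetCW.IsSmoothFormOn (Λ.chernForm D f k) Set.univ ∧
        FrechetCW.IsClosedForm (Λ.chernForm D f k)) ∧
      -- its de Rham class does not depend on such a connection
      (∀ D D' : FrechetCW.Connection P, Λ.CommutesWith D → Λ.CommutesWith D' → ∀ k : ℕ,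
        FrechetCW.SameDeRhamClass (Λ.chernForm D f k) (Λ.chernForm D' f k))) ∧
    -- the hypothesis holds for all connections if `λ` comes from an `Ad`-invariant linear form
    (∀ (l : A →L[ℝ] ℂ) (hl : FrechetCW.AdInvariant ρ l) (D : FrechetCW.Connection P),
      (FrechetCW.AdMorphism.induced P l hl).CommutesWith D) := by
  refine ⟨fun Λ f _ => ⟨fun D hD k => ⟨fun i b hb v => ?_, ?_, ?_⟩, fun D D' hD hD' k => ?_⟩,
    fun l hl D => FrechetCW.AdMorphism.induced_commutesWith hρ l hl D⟩
  · have h1 := D.isConnectionFamily hρ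
    rw [Λ.chernForm_eq_glue, FrechetCW.AdMorphism.glue_apply _ (h1.isAdForm_prodPow k) hb,
      FrechetCW.AdMorphism.scale_form, mul_smul, Complex.coe_smul,
      ← FrechetCW.wedgePow_eq_altSum]
    rfl
  · rw [Λ.chernForm_eq_glue]
    exact FrechetCW.AdMorphism.isSmoothFormOn_glue _ ((D.isConnectionFamily hρ).isAdForm_prodPow k)
  · rw [Λ.chernForm_eq_glue]
    exact fun b v => (D.isConnectionFamily hρ).extD_glue_prodPow _ (hD.commutes.scale _) k b v
  · exact Λ.sameDeRhamClass_chernForm hρ f hD hD' k
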